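/- **Setting.** All fields are on $\mathbb{R}^3$ with Cartesian coordinates $x^i$; repeated indices are summed and $\epsilon_{ijk}=\epsilon^{ijk}$ is the Levi-Civita symbol. A *fluid flow* on an open set $\Omega\subseteq\mathbb{R}\times\mathbb{R}^3$ of space-time is a pair of a smooth velocity $u$ and a smooth density $\rho>0$ with $\partial_t\rho+\partial_i(\rho u^i)=0$. A smooth scalar $K$, vector $K^i$, or skew-tensor $K^{ij}=-K^{ji}$ (more generally, an antisymmetric contravariant tensor) is an *invariant* of the flow if $\mathfrak{D}_t K=0$, where $\mathfrak{D}_t=\partial_t+\mathcal{L}_u$, that is, $$\mathfrak{D}_tK=\partial_tK+u^j\partial_jK,\qquad (\mathfrak{D}_tK)^i=\partial_tK^i+u^j\partial_jK^i-K^j\partial_ju^i,$$ $$(\mathfrak{D}_tK)^{ij}=\partial_tK^{ij}+u^k\partial_kK^{ij}-K^{kj}\partial_ku^i-K^{ik}\partial_ku^j .$$ **Operations.** Consider the following operations. (i) On scalars: $f(K_1,\dots,K_m)$ with $f$ a differentiable function on an open subset of $\mathbb{R}^m$; and the directional derivatives $\mathcal{K}_0\cdot\mathrm{grad}$, where $\mathcal{K}_0$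 is a vector ($K_0^i\partial_iK$), a skew-tensor ($K_0^{ij}\partial_jK$), or the tensor $\tfrac1\rho\epsilon$ ($\tfrac1\rho\epsilon^{ijk}\partial_kK$). (ii) On vectors and skew-tensors $\mathcal{K}$: multiplication $f(K_0)\mathcal{K}$ by a differentiable function of scalars; the exterior product with a vector or skew-tensor ($K_0^iK^j-K^iK_0^j$ and $K_0^iK^{jk}+K_0^jK^{ki}+K_0^kK^{ij}$; the product of two skew-tensors is zero); the densitized cross product with a skew-tensor ($\rho\,\epsilon_{ijk}K_0^{ij}K^k$ and $\rho\,\epsilon_{jkl}K_0^{ij}K^{kl}$); the densitized divergence ($\tfrac1\rho\partial_i(\rho K^i)$ and $\tfrac1\rho\partial_j(\rho K^{ji})$); and addition. A *composition* is built from finitely many input scalars, vectors and skew-tensors by these operations, all $f$ being smooth on open sets; it is *defined* at those points where all its functions $f$ are evaluated inside their domains. A *local operator* with result of a given type (scalar, vector or skew-tensor) is an operator acting on finitely many scalars, vectors and skew-tensors whose value at $(t,x)$ is a smooth function of $t$, $x$ and the spatial derivatives up to some finite order of the inputs, of $\rho$, and of $u$, at $(t,x)$. It is a *material operation* if, in every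 fluid flow on $\mathbb{R}\times\mathbb{R}^3$, it maps invariants to invariants. **Theorem.** (a) In every fluid flow on every open $\Omega$, the tensor $\tfrac1\rho\epsilon$ is an invariant, and each of the operations in (i) and (ii) maps invariants, of the types on which it acts, to invariants (for $f$ differentiable but not smooth, the result is differentiable and satisfies $\mathfrak{D}_t=0$). (b) The operations generate: for every material operation $\Phi$ there is a composition $T$ which equals $\Phi$, for all smooth fields $u$, $\rho>0$ and inputs, at all points where $T$ is defined, and which is generically defined, in the sense that for any smooth $\rho>0$, smooth inputs $D$ and point $x$ there are smooth inputs $D'$ such that $T$ is defined at $x$ on $\rho$ and $D+\varepsilon D'$ for all sufficiently small $\varepsilon\neq0$. (c) If all inputs and the result of $\Phi$ are scalars, then $T$ can be chosen to use only the operations in (i). -/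

import Mathlib

open scoped ContDiff
open Set Filter Topology

namespace MaterialOps

/-! ### Tensors on three-dimensional Euclidean space, in Cartesian components -/

/-- Points and vectors of three-dimensional space. -/
abbrev Vec : Type := Fin 3 → ℝ

/-- Components `K^{ij}` of a contravariant tensor of rank two. -/
abbrev Ten : Type := Fin 3 → Fin 3 → ℝ

/-- Components `K^{ijk}` of a contravariant tensor of rank three. -/
abbrev Tri : Type := Fin 3 → Fin 3 → Fin 3 → ℝ

/-- The Levi-Civita symbol. -/
noncomputable def eps (i j k : Fin 3) : ℝ :=
  (((j : ℕ) : ℝ) - ((i : ℕ) : ℝ)) * (((k : ℕ) : ℝ) - ((i : ℕ) : ℝ)) *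
    (((k : ℕ) : ℝ) - ((j : ℕ) : ℝ)) / 2

/-- The partial derivative `∂g/∂x^i` at the point `x`. -/
noncomputable def pd (i : Fin 3) (g : Vec → ℝ) (x : Vec) : ℝ :=
  fderiv ℝ g x (Pi.single i 1)

def IsSkew (A : Ten) : Prop := ∀ i j, A i j = - A j i

/-- Totally antisymmetric: the transpositions of neighbouring indices generate all others. -/
def IsTotallySkew (A : Tri) : Prop := ∀ i j k, A i j k = - A j i k ∧ A i j k = - A i k j

/-- The three types of quantities: scalars, vectors, skew-tensors. -/
inductive Kind : Type
  | scalar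
  | vec
  | skew

/-- The space of values of a quantity of the given type; skew-tensors are stored as all of their
components, the antisymmetry being the predicate `Kind.Symm`. -/
def Kind.Val : Kind → Type
  | .scalar => ℝ
  | .vec => Vec
  | .skew => Ten

noncomputable instance Kind.instNormedAddCommGroupVal : (κ : Kind) → NormedAddCommGroup κ.Val
  | .scalar => inferInstanceAs (NormedAddCommGroup ℝ)
  | .vec => inferInstanceAs (NormedAddCommGroup Vec)
  | .skew => inferInstanceAs (NormedAddCommGroup Ten)

noncomputable instance Kind.instNormedSpaceVal : (κ : Kind) → NormedSpace ℝ κ.Val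
  | .scalar => inferInstanceAs (NormedSpace ℝ ℝ)
  | .vec => inferInstanceAs (NormedSpace ℝ Vec)
  | .skew => inferInstanceAs (NormedSpace ℝ Ten)

def Kind.Symm : (κ : Kind) → κ.Val → Prop
  | .scalar, _ => True
  | .vec, _ => True
  | .skew, A => IsSkew A

/-! ### Advective Lie derivative, fluid flows and invariants

Time-dependent fields are functions of `t : ℝ` and `x : Vec`. -/

/-- `∂_t K + u · ∇K`, the advective Lie derivative of a scalar. -/
noncomputable def advScalar (u : ℝ → Vec → Vec) (K : ℝ → Vec → ℝ) (t : ℝ) (x : Vec) : ℝ :=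
  deriv (fun s => K s x) t + ∑ j, u t x j * pd j (K t) x

/-- `∂_t K^i + u^j ∂_j K^i - K^j ∂_j u^i`. -/
noncomputable def advVec (u : ℝ → Vec → Vec) (K : ℝ → Vec → Vec) (t : ℝ) (x : Vec) : Vec :=
  fun i => advScalar u (fun s y => K s y i) t x - ∑ j, K t x j * pd j (fun y => u t y i) x

/-- `∂_t K^{ij} + u^k ∂_k K^{ij} - K^{kj} ∂_k u^i - K^{ik} ∂_k u^j`. -/
noncomputable def advTen (u : ℝ → Vec → Vec) (K : ℝ → Vec → Ten) (t : ℝ) (x : Vec) : Ten :=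
  fun i j => advScalar u (fun s y => K s y i j) t x
    - ∑ k, K t x k j * pd k (fun y => u t y i) x
    - ∑ k, K t x i k * pd k (fun y => u t y j) x

/-- The advective Lie derivative of a contravariant tensor of rank three. -/
noncomputable def advTri (u : ℝ → Vec → Vec) (K : ℝ → Vec → Tri) (t : ℝ) (x : Vec) : Tri :=
  fun i j k => advScalar u (fun s y => K s y i j k) t x
    - ∑ l, K t x l j k * pd l (fun y => u t y i) x
    - ∑ l, K t x i l k * pd l (fun y => u t y j) x
    - ∑ l, K t x i j l * pd l (fun y => u t y k) x

/-- The advective Lie derivative `𝔇_t = ∂_t + ℒ_u` on quantities of each type. -/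
noncomputable def adv : (κ : Kind) → (ℝ → Vec → Vec) → (ℝ → Vec → κ.Val) → ℝ → Vec → κ.Val
  | .scalar, u, K => advScalar u K
  | .vec, u, K => advVec u K
  | .skew, u, K => advTen u K

/-- A smooth fluid flow on the region `Ω` of space-time: velocity `u` and positive density `ρ`
satisfying mass continuity `∂_t ρ + ∇ · (ρ u) = 0`. -/
structure IsFlowOn (Ω : Set (ℝ × Vec)) (u : ℝ → Vec → Vec) (ρ : ℝ → Vec → ℝ) : Prop where
  smooth_velocity : ContDiffOn ℝ ∞ (fun p : ℝ × Vec => u p.1 p.2) Ω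
  smooth_density : ContDiffOn ℝ ∞ (fun p : ℝ × Vec => ρ p.1 p.2) Ω
  density_pos : ∀ p ∈ Ω, 0 < ρ p.1 p.2
  continuity_eq : ∀ p ∈ Ω, deriv (fun s => ρ s p.2) p.1
    + ∑ j, pd j (fun y => ρ p.1 y * u p.1 y j) p.2 = 0

/-- `K` is differentiable and satisfies `𝔇_t K = 0` on `Ω`. -/
structure IsAdvectedOn (κ : Kind) (Ω : Set (ℝ × Vec)) (u : ℝ → Vec → Vec)
    (K : ℝ → Vec → κ.Val) : Prop where
  differentiable : ∀ p ∈ Ω, DifferentiableAt ℝ (fun q : ℝ × Vec => K q.1 q.2) p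
  symm : ∀ p ∈ Ω, κ.Symm (K p.1 p.2)
  advected : ∀ p ∈ Ω, adv κ u K p.1 p.2 = 0

/-- A (smooth) invariant of type `κ` on `Ω`: `𝔇_t K = 0`. -/
structure IsInvariantOn (κ : Kind) (Ω : Set (ℝ × Vec)) (u : ℝ → Vec → Vec)
    (K : ℝ → Vec → κ.Val) : Prop where
  smooth : ContDiffOn ℝ ∞ (fun q : ℝ × Vec => K q.1 q.2) Ω
  symm : ∀ p ∈ Ω, κ.Symm (K p.1 p.2)
  advected : ∀ p ∈ Ω, adv κ u K p.1 p.2 = 0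

/-- A totally antisymmetric tensor of rank three that is an invariant on `Ω`. -/
structure IsTriInvariantOn (Ω : Set (ℝ × Vec)) (u : ℝ → Vec → Vec)
    (K : ℝ → Vec → Tri) : Prop where
  smooth : ContDiffOn ℝ ∞ (fun q : ℝ × Vec => K q.1 q.2) Ω
  symm : ∀ p ∈ Ω, IsTotallySkew (K p.1 p.2)
  advected : ∀ p ∈ Ω, advTri u K p.1 p.2 = 0

/-! ### The generating operations, acting on fields at a fixed instant

`ρ` is the density at that instant. -/

/-- `K₀ · grad` for a vector: `K₀^i ∂_i K`. -/
noncomputable def gradVec (K₀ : Vec → Vec) (K : Vec → ℝ) (x : Vec) : ℝ :=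
  ∑ i, K₀ x i * pd i K x

/-- `K₀ · grad` for a skew-tensor: `K₀^{ij} ∂_j K`. -/
noncomputable def gradSkew (K₀ : Vec → Ten) (K : Vec → ℝ) (x : Vec) : Vec :=
  fun i => ∑ j, K₀ x i j * pd j K x

/-- The densitized volume tensor `(1/ρ) ε^{ijk}`. -/
noncomputable def volTensor (ρ : Vec → ℝ) (x : Vec) : Tri :=
  fun i j k => (1 / ρ x) * eps i j k

/-- `K₀ · grad` for the densitized volume tensor: `(1/ρ) ε^{ijk} ∂_k K`. -/
noncomputable def gradVol (ρ : Vec → ℝ) (K : Vec → ℝ) (x : Vec) : Ten :=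
  fun i j => ∑ k, volTensor ρ x i j k * pd k K x

/-- Exterior product of vectors: `a^i b^j - b^i a^j`. -/
def wedgeVec (a b : Vec → Vec) (x : Vec) : Ten :=
  fun i j => a x i * b x j - b x i * a x j

/-- Exterior product of a vector and a skew-tensor: `a^i b^{jk} + a^j b^{ki} + a^k b^{ij}`. -/
def wedgeSkew (a : Vec → Vec) (b : Vec → Ten) (x : Vec) : Tri :=
  fun i j k => a x i * b x j k + a x j * b x k i + a x k * b x i j

/-- Densitized cross product of a skew-tensor and a vector: `ρ ε_{ijk} K₀^{ij} K^k`. -/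
noncomputable def crossVec (ρ : Vec → ℝ) (K₀ : Vec → Ten) (K : Vec → Vec) (x : Vec) : ℝ :=
  ρ x * ∑ i, ∑ j, ∑ k, eps i j k * K₀ x i j * K x k

/-- Densitized cross product of skew-tensors: `ρ ε_{jkl} K₀^{ij} K^{kl}`. -/
noncomputable def crossSkew (ρ : Vec → ℝ) (K₀ K : Vec → Ten) (x : Vec) : Vec :=
  fun i => ρ x * ∑ j, ∑ k, ∑ l, eps j k l * K₀ x i j * K x k l

/-- Densitized divergence of a vector: `(1/ρ) ∂_i (ρ K^i)`. -/
noncomputable def divVec (ρ : Vec → ℝ) (K : Vec → Vec) (x : Vec) : ℝ :=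
  (1 / ρ x) * ∑ i, pd i (fun y => ρ y * K y i) x

/-- Densitized divergence of a skew-tensor: `(1/ρ) ∂_j (ρ K^{ji})`. -/
noncomputable def divSkew (ρ : Vec → ℝ) (K : Vec → Ten) (x : Vec) : Vec :=
  fun i => (1 / ρ x) * ∑ j, pd j (fun y => ρ y * K y j i) x

/-! ### Compositions of the generating operations -/

/-- The values of `a` scalars, `b` vectors and `c` skew-tensors. -/
abbrev Inputs (a b c : ℕ) : Type := (Fin a → ℝ) × (Fin b → Vec) × (Fin c → Ten)

/-- Formal compositions of the generating operations, acting on `a` scalars, `b` vectors and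
`c` skew-tensors, with a result of the indicated type. A function `f` of scalars may be defined on
an open set `O` only. The invariants `K₀` that enter the operations are themselves generated.
(The exterior product of a vector and a skew-tensor is absent because its value is
neither a scalar nor a vector nor a skew-tensor, so that it cannot be composed further.) -/
inductive Composition (a b c : ℕ) : Kind → Type
  | inputScalar (i : Fin a) : Composition a b c .scalar
  | inputVec (i : Fin b) : Composition a b c .vec
  | inputSkew (i : Fin c) : Composition a b c .skew
  | func {m : ℕ} (f : (Fin m → ℝ) → ℝ) (O : Set (Fin m → ℝ)) (hO : IsOpen O)
      (hf : ContDiffOn ℝ ∞ f O) (K : Fin m → Composition a b c .scalar) : Composition a b c .scalar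
  | gradVec (K₀ : Composition a b c .vec) (K : Composition a b c .scalar) :
      Composition a b c .scalar
  | gradSkew (K₀ : Composition a b c .skew) (K : Composition a b c .scalar) :
      Composition a b c .vec
  | gradVol (K : Composition a b c .scalar) : Composition a b c .skew
  | mulVec (K₀ : Composition a b c .scalar) (K : Composition a b c .vec) : Composition a b c .vec
  | mulSkew (K₀ : Composition a b c .scalar) (K : Composition a b c .skew) :
      Composition a b c .skew
  | addVec (K L : Composition a b c .vec) : Composition a b c .vec
  | addSkew (K L : Composition a b c .skew) : Composition a b c .skew
  | wedgeVec (K₀ K : Composition a b c .vec) : Composition a b c .skew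
  | crossVec (K₀ : Composition a b c .skew) (K : Composition a b c .vec) : Composition a b c .scalar
  | crossSkew (K₀ K : Composition a b c .skew) : Composition a b c .vec
  | divVec (K : Composition a b c .vec) : Composition a b c .scalar
  | divSkew (K : Composition a b c .skew) : Composition a b c .vec

namespace Composition

variable {a b c : ℕ}

/-- The value of a composition on the density `ρ` and the input fields `D` of an instant. -/
noncomputable def eval (ρ : Vec → ℝ) (D : Vec → Inputs a b c) :
    {κ : Kind} → Composition a b c κ → Vec → κ.Val
  | _, .inputScalar i => fun x => (D x).1 i
  | _, .inputVec i => fun x => (D x).2.1 i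
  | _, .inputSkew i => fun x => (D x).2.2 i
  | _, .func f _ _ _ K => fun x => f (fun i => (K i).eval ρ D x)
  | _, .gradVec K₀ K => MaterialOps.gradVec (K₀.eval ρ D) (K.eval ρ D)
  | _, .gradSkew K₀ K => MaterialOps.gradSkew (K₀.eval ρ D) (K.eval ρ D)
  | _, .gradVol K => MaterialOps.gradVol ρ (K.eval ρ D)
  | _, .mulVec K₀ K => fun x => (show ℝ from K₀.eval ρ D x) • (show Vec from K.eval ρ D x)
  | _, .mulSkew K₀ K => fun x => (show ℝ from K₀.eval ρ D x) • (show Ten from K.eval ρ D x)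
  | _, .addVec K L => fun x => (show Vec from K.eval ρ D x) + (show Vec from L.eval ρ D x)
  | _, .addSkew K L => fun x => (show Ten from K.eval ρ D x) + (show Ten from L.eval ρ D x)
  | _, .wedgeVec K₀ K => MaterialOps.wedgeVec (K₀.eval ρ D) (K.eval ρ D)
  | _, .crossVec K₀ K => MaterialOps.crossVec ρ (K₀.eval ρ D) (K.eval ρ D)
  | _, .crossSkew K₀ K => MaterialOps.crossSkew ρ (K₀.eval ρ D) (K.eval ρ D)
  | _, .divVec K => MaterialOps.divVec ρ (K.eval ρ D)
  | _, .divSkew K => MaterialOps.divSkew ρ (K.eval ρ D)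

/-- The composition is defined at `x`: each function that occurs in it is evaluated in the open
set on which it is defined. -/
def DefinedAt (ρ : Vec → ℝ) (D : Vec → Inputs a b c) (x : Vec) :
    {κ : Kind} → Composition a b c κ → Prop
  | _, .inputScalar _ => True
  | _, .inputVec _ => True
  | _, .inputSkew _ => True
  | _, .func _ O _ _ K =>
      (∀ i, (K i).DefinedAt ρ D x) ∧ (fun i => (show ℝ from (K i).eval ρ D x)) ∈ O
  | _, .gradVec K₀ K => K₀.DefinedAt ρ D x ∧ K.DefinedAt ρ D x
  | _, .gradSkew K₀ K => K₀.DefinedAt ρ D x ∧ K.DefinedAt ρ D x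
  | _, .gradVol K => K.DefinedAt ρ D x
  | _, .mulVec K₀ K => K₀.DefinedAt ρ D x ∧ K.DefinedAt ρ D x
  | _, .mulSkew K₀ K => K₀.DefinedAt ρ D x ∧ K.DefinedAt ρ D x
  | _, .addVec K L => K.DefinedAt ρ D x ∧ L.DefinedAt ρ D x
  | _, .addSkew K L => K.DefinedAt ρ D x ∧ L.DefinedAt ρ D x
  | _, .wedgeVec K₀ K => K₀.DefinedAt ρ D x ∧ K.DefinedAt ρ D x
  | _, .crossVec K₀ K => K₀.DefinedAt ρ D x ∧ K.DefinedAt ρ D x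
  | _, .crossSkew K₀ K => K₀.DefinedAt ρ D x ∧ K.DefinedAt ρ D x
  | _, .divVec K => K.DefinedAt ρ D x
  | _, .divSkew K => K.DefinedAt ρ D x

/-- Only the operations on scalars occur: differentiable functions `f` and `K₀ · grad`. -/
def OnlyScalarOps : {κ : Kind} → Composition a b c κ → Prop
  | _, .inputScalar _ => True
  | _, .inputVec _ => True
  | _, .inputSkew _ => True
  | _, .func _ _ _ _ K => ∀ i, (K i).OnlyScalarOps
  | _, .gradVec K₀ K => K₀.OnlyScalarOps ∧ K.OnlyScalarOps
  | _, .gradSkew K₀ K => K₀.OnlyScalarOps ∧ K.OnlyScalarOps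
  | _, .gradVol K => K.OnlyScalarOps
  | _, .mulVec _ _ => False
  | _, .mulSkew _ _ => False
  | _, .addVec _ _ => False
  | _, .addSkew _ _ => False
  | _, .wedgeVec _ _ => False
  | _, .crossVec _ _ => False
  | _, .crossSkew _ _ => False
  | _, .divVec _ => False
  | _, .divSkew _ => False

end Composition

/-! ### Local operators and material operations -/

/-- Values of the velocity, the density, and the inputs. -/
abbrev Config (a b c : ℕ) : Type := Vec × ℝ × Inputs a b c

/-- Jets of order `k` of configurations: the collections of derivatives of orders `0, …, k`. -/
abbrev Jet (k a b c : ℕ) : Type :=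
  (i : Fin (k + 1)) → ContinuousMultilinearMap ℝ (fun _ : Fin (i : ℕ) => Vec) (Config a b c)

/-- The `k`-jet at `x` of the velocity, density and inputs. -/
noncomputable def jet {a b c : ℕ} (k : ℕ) (u : Vec → Vec) (ρ : Vec → ℝ) (D : Vec → Inputs a b c)
    (x : Vec) : Jet k a b c :=
  fun i => iteratedFDeriv ℝ (i : ℕ) (fun y => ((u y, ρ y, D y) : Config a b c)) x

/-- The value of the density recorded in a jet. -/
def Jet.density {k a b c : ℕ} (J : Jet k a b c) : ℝ := (J 0 (fun _ => 0)).2.1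

/-- A local operator: a differential operator of some finite order acting on `a` scalars, `b`
vectors and `c` skew-tensors. Its value at `(t, x)` is a smooth function of `t`, `x`, and the
spatial derivatives at `(t, x)` of the inputs, the density and the velocity, for all positive
values of the density. -/
structure LocalOperator (a b c : ℕ) (κ : Kind) where
  order : ℕ
  toFun : ℝ → Vec → Jet order a b c → κ.Val
  smooth : ContDiffOn ℝ ∞ (fun q : ℝ × Vec × Jet order a b c => toFun q.1 q.2.1 q.2.2)
    {q | 0 < q.2.2.density}

/-- The value at `(t, x)` of a local operator on the fields `u`, `ρ`, `D` of the instant `t`. -/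
noncomputable def LocalOperator.apply {a b c : ℕ} {κ : Kind} (Φ : LocalOperator a b c κ) (t : ℝ)
    (u : Vec → Vec) (ρ : Vec → ℝ) (D : Vec → Inputs a b c) (x : Vec) : κ.Val :=
  Φ.toFun t x (jet Φ.order u ρ D x)

/-- All inputs are invariants on `Ω`. -/
structure InputsInvariantOn {a b c : ℕ} (Ω : Set (ℝ × Vec)) (u : ℝ → Vec → Vec)
    (D : ℝ → Vec → Inputs a b c) : Prop where
  scalars : ∀ i, IsInvariantOn .scalar Ω u (fun t x => (D t x).1 i)
  vectors : ∀ i, IsInvariantOn .vec Ω u (fun t x => (D t x).2.1 i)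
  skews : ∀ i, IsInvariantOn .skew Ω u (fun t x => (D t x).2.2 i)

/-- A material operation: a local operator that maps invariants to invariants in every fluid flow
in three-dimensional space. -/
def LocalOperator.IsMaterial {a b c : ℕ} {κ : Kind} (Φ : LocalOperator a b c κ) : Prop :=
  ∀ (u : ℝ → Vec → Vec) (ρ : ℝ → Vec → ℝ) (D : ℝ → Vec → Inputs a b c),
    IsFlowOn univ u ρ → InputsInvariantOn univ u D →
      IsInvariantOn κ univ u (fun t x => Φ.apply t (u t) (ρ t) (D t) x)

/-- Smooth input fields at an instant. -/
structure SmoothInputs {a b c : ℕ} (D : Vec → Inputs a b c) : Prop where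
  smooth : ContDiff ℝ ∞ D
  skew : ∀ x i, IsSkew ((D x).2.2 i)

/-- Equality of a local operator and a composition, for all velocities, densities and inputs
at all points where the composition is defined. -/
def LocalOperator.EqWhereDefined {a b c : ℕ} {κ : Kind} (Φ : LocalOperator a b c κ)
    (T : Composition a b c κ) : Prop :=
  ∀ (t : ℝ) (u : Vec → Vec) (ρ : Vec → ℝ) (D : Vec → Inputs a b c) (x : Vec),
    ContDiff ℝ ∞ u → ContDiff ℝ ∞ ρ → (∀ y, 0 < ρ y) → SmoothInputs D →
      T.DefinedAt ρ D x → Φ.apply t u ρ D x = T.eval ρ D x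

/-- Generically defined: any smooth inputs have a smooth direction of perturbation
along which the composition is defined at the given point, for all small nonzero amplitudes. -/
def Composition.GenericallyDefined {a b c : ℕ} {κ : Kind} (T : Composition a b c κ) : Prop :=
  ∀ (ρ : Vec → ℝ) (D : Vec → Inputs a b c) (x : Vec),
    ContDiff ℝ ∞ ρ → (∀ y, 0 < ρ y) → SmoothInputs D →
      ∃ D' : Vec → Inputs a b c, SmoothInputs D' ∧
        ∀ᶠ ε in 𝓝[≠] (0 : ℝ), T.DefinedAt ρ (fun y => D y + ε • D' y) x

/-- The generating operations map invariants of a flow on a region `Ω` to invariants. -/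
structure GeneratorsMaterialOn (Ω : Set (ℝ × Vec)) (u : ℝ → Vec → Vec) (ρ : ℝ → Vec → ℝ) :
    Prop where
  /-- differentiable functions of scalar invariants -/
  func_advected : ∀ (m : ℕ) (f : (Fin m → ℝ) → ℝ) (O : Set (Fin m → ℝ)) (K : Fin m → ℝ → Vec → ℝ),
    IsOpen O → DifferentiableOn ℝ f O → (∀ i, IsAdvectedOn .scalar Ω u (K i)) →
    (∀ p ∈ Ω, (fun i => K i p.1 p.2) ∈ O) →
    IsAdvectedOn .scalar Ω u (fun t x => f (fun i => K i t x))
  func : ∀ (m : ℕ) (f : (Fin m → ℝ) → ℝ) (O : Set (Fin m → ℝ)) (K : Fin m → ℝ → Vec → ℝ),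
    IsOpen O → ContDiffOn ℝ ∞ f O → (∀ i, IsInvariantOn .scalar Ω u (K i)) →
    (∀ p ∈ Ω, (fun i => K i p.1 p.2) ∈ O) →
    IsInvariantOn .scalar Ω u (fun t x => f (fun i => K i t x))
  gradVec : ∀ (K₀ : ℝ → Vec → Vec) (K : ℝ → Vec → ℝ), IsInvariantOn .vec Ω u K₀ →
    IsInvariantOn .scalar Ω u K →
    IsInvariantOn .scalar Ω u (fun t => MaterialOps.gradVec (K₀ t) (K t))
  gradSkew : ∀ (K₀ : ℝ → Vec → Ten) (K : ℝ → Vec → ℝ), IsInvariantOn .skew Ω u K₀ →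
    IsInvariantOn .scalar Ω u K →
    IsInvariantOn .vec Ω u (fun t => MaterialOps.gradSkew (K₀ t) (K t))
  /-- the densitized volume tensor is an invariant -/
  volTensor : IsTriInvariantOn Ω u (fun t => MaterialOps.volTensor (ρ t))
  gradVol : ∀ K : ℝ → Vec → ℝ, IsInvariantOn .scalar Ω u K →
    IsInvariantOn .skew Ω u (fun t => MaterialOps.gradVol (ρ t) (K t))
  mulVec_advected : ∀ (K₀ : ℝ → Vec → ℝ) (K : ℝ → Vec → Vec), IsAdvectedOn .scalar Ω u K₀ →
    IsAdvectedOn .vec Ω u K → IsAdvectedOn .vec Ω u (fun t x => K₀ t x • K t x)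
  mulSkew_advected : ∀ (K₀ : ℝ → Vec → ℝ) (K : ℝ → Vec → Ten), IsAdvectedOn .scalar Ω u K₀ →
    IsAdvectedOn .skew Ω u K → IsAdvectedOn .skew Ω u (fun t x => K₀ t x • K t x)
  mulVec : ∀ (K₀ : ℝ → Vec → ℝ) (K : ℝ → Vec → Vec), IsInvariantOn .scalar Ω u K₀ →
    IsInvariantOn .vec Ω u K → IsInvariantOn .vec Ω u (fun t x => K₀ t x • K t x)
  mulSkew : ∀ (K₀ : ℝ → Vec → ℝ) (K : ℝ → Vec → Ten), IsInvariantOn .scalar Ω u K₀ →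
    IsInvariantOn .skew Ω u K → IsInvariantOn .skew Ω u (fun t x => K₀ t x • K t x)
  addVec : ∀ K L : ℝ → Vec → Vec, IsInvariantOn .vec Ω u K → IsInvariantOn .vec Ω u L →
    IsInvariantOn .vec Ω u (fun t x => K t x + L t x)
  addSkew : ∀ K L : ℝ → Vec → Ten, IsInvariantOn .skew Ω u K → IsInvariantOn .skew Ω u L →
    IsInvariantOn .skew Ω u (fun t x => K t x + L t x)
  wedgeVec : ∀ K₀ K : ℝ → Vec → Vec, IsInvariantOn .vec Ω u K₀ → IsInvariantOn .vec Ω u K →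
    IsInvariantOn .skew Ω u (fun t => MaterialOps.wedgeVec (K₀ t) (K t))
  /-- the exterior product of a vector and a skew-tensor is an invariant of rank three -/
  wedgeSkew : ∀ (K₀ : ℝ → Vec → Vec) (K : ℝ → Vec → Ten), IsInvariantOn .vec Ω u K₀ →
    IsInvariantOn .skew Ω u K →
    IsTriInvariantOn Ω u (fun t => MaterialOps.wedgeSkew (K₀ t) (K t))
  crossVec : ∀ (K₀ : ℝ → Vec → Ten) (K : ℝ → Vec → Vec), IsInvariantOn .skew Ω u K₀ →
    IsInvariantOn .vec Ω u K →
    IsInvariantOn .scalar Ω u (fun t => MaterialOps.crossVec (ρ t) (K₀ t) (K t))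
  crossSkew : ∀ K₀ K : ℝ → Vec → Ten, IsInvariantOn .skew Ω u K₀ → IsInvariantOn .skew Ω u K →
    IsInvariantOn .vec Ω u (fun t => MaterialOps.crossSkew (ρ t) (K₀ t) (K t))
  divVec : ∀ K : ℝ → Vec → Vec, IsInvariantOn .vec Ω u K →
    IsInvariantOn .scalar Ω u (fun t => MaterialOps.divVec (ρ t) (K t))
  divSkew : ∀ K : ℝ → Vec → Ten, IsInvariantOn .skew Ω u K →
    IsInvariantOn .vec Ω u (fun t => MaterialOps.divSkew (ρ t) (K t))

end MaterialOps

/-!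
The advective derivative `𝔇_t` is a derivation that commutes with the gradient of scalars, so it
obeys Leibniz rules on contractions with a gradient (`advScalar_gradVec`, `advVec_gradSkew`) and
on products. It acts on the Levi-Civita symbol by the trace of the velocity gradient
(`sum_eps_mul_eq_trace`), and mass continuity says that `1/ρ` compensates this. Hence the
generating operations map invariants to invariants (`generatorsMaterialOn`).

For the converse, any isotopy of space is a fluid flow which carries the initial density and the
initial inputs, as invariants, and a material operation follows it (`Isotopy.push_apply_eq`). An
isotopy can be the identity at two instants, with a given velocity at one and at rest at the
other, so a material operation sees neither the time nor the velocity
(`LocalOperator.IsMaterial.apply_eq_rest`). What remains, the operation `LocalOperator.rest` on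
densities and inputs, commutes with orientation-preserving local diffeomorphisms
(`LocalOperator.IsMaterial.naturalAt`): near a point, such a map is the composition of a map close
to the identity, which can be cut off, a linear map of positive determinant, which is a product of
transvections and a positive diagonal matrix, and a translation; all of these are ends of
isotopies.

Suppose that the inputs generate three scalars `S` with nonzero Jacobian; the last one can be
multiplied by a sign to make the Jacobian positive (`Composition.oriented`). They serve as
coordinates that are made from the inputs. The derivative along a coordinate is a quotient of
densitized Jacobians, which is a composition (`Composition.eval_partialDeriv`). So are the
components in these coordinates of the density and of the inputs, and therefore all jets. By
naturality, the components of the value of a material operation are functions of these jets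
(`Composition.eval_observable`), and the value itself is obtained from them with the coordinate
frame. This is the composition `Composition.representation`. If all inputs and the result are
scalars, it involves only functions and gradients.

This composition is defined where the Jacobian of `S` does not vanish. Under a perturbation of the
inputs by a multiple `ε` of fixed fields, the Jacobian is a polynomial in `ε` (`PolyFamily`). Thus
generic definedness only requires that it be nonzero for one choice of the inputs at each point
(`Composition.genericallyDefined_representation`). Three scalar inputs may be taken as `S`; from a
vector input `v`, one takes its densitized divergence and the first two derivatives of the latter
along `v` (`Composition.vecScalars`); from a skew-tensor, one takes its divergence `v`, its
densitized product with `v`, and derivatives along `v` (`Composition.skewScalars`).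

There remain the operations on at most two scalars. Where two scalars are independent, they are
the first two of coordinates in which the density is one (`exists_unimodular_coordinates`).
Translations along the third axis and shears in its direction preserve these data. Therefore the
value of a material operation in such coordinates depends on the scalars `A`, `B` only, and has
only the components that shears fix: it is a function of `A` and `B`, times the vector `(1/ρ) ∇A ×
∇B` for a vector, or an exterior product of the third axis for a skew-tensor, which is a
combination of the tensors `(1/ρ) ε ∇A` and `(1/ρ) ε ∇B` (`Composition.standardForm`). This
composition has no singularities, and at points where the scalars are dependent the identity
follows by perturbation and continuity (`Composition.eqWhereDefined_standardForm`).
-/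

namespace MaterialOps

section

/-! ### Calculus of space-time fields -/

/-- Joint smoothness on `Ω` of a time-dependent scalar field. -/
def SmoothOn (Ω : Set (ℝ × Vec)) (F : ℝ → Vec → ℝ) : Prop :=
  ContDiffOn ℝ ∞ (fun q : ℝ × Vec => F q.1 q.2) Ω

section SpaceTime

variable {Ω : Set (ℝ × Vec)} {u : ℝ → Vec → Vec} {F G : ℝ → Vec → ℝ} {p : ℝ × Vec}

theorem hasFDerivAt_slice (h : DifferentiableAt ℝ (fun q : ℝ × Vec => F q.1 q.2) p) :
    HasFDerivAt (F p.1) ((fderiv ℝ (fun q : ℝ × Vec => F q.1 q.2) p).comp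
      (ContinuousLinearMap.inr ℝ ℝ Vec)) p.2 := by
  have h1 : HasFDerivAt (fun q : ℝ × Vec => F q.1 q.2) _ ((fun y => (p.1, y)) p.2) := h.hasFDerivAt
  exact h1.comp p.2 (hasFDerivAt_prodMk_right p.1 p.2)

theorem pd_slice (h : DifferentiableAt ℝ (fun q : ℝ × Vec => F q.1 q.2) p) (j : Fin 3) :
    pd j (F p.1) p.2 = fderiv ℝ (fun q : ℝ × Vec => F q.1 q.2) p (0, Pi.single j 1) := by
  rw [pd, (hasFDerivAt_slice h).fderiv]; rfl

theorem deriv_slice (h : DifferentiableAt ℝ (fun q : ℝ × Vec => F q.1 q.2) p) :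
    deriv (fun s => F s p.2) p.1 = fderiv ℝ (fun q : ℝ × Vec => F q.1 q.2) p (1, 0) := by
  have h1 : HasFDerivAt (fun q : ℝ × Vec => F q.1 q.2) _ ((fun s => (s, p.2)) p.1) := h.hasFDerivAt
  have h2 := (h1.comp p.1 (hasFDerivAt_prodMk_left p.1 p.2)).hasDerivAt.deriv
  simpa [Function.comp_def] using h2

theorem sum_mul_single (v : Vec) : ∑ j, v j • (Pi.single j (1 : ℝ) : Vec) = v := by
  ext i; simp [Finset.sum_apply, Pi.single_apply]

theorem fderiv_eq_sum_pd {g : Vec → ℝ} {x : Vec} (v : Vec) :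
    fderiv ℝ g x v = ∑ j, v j * pd j g x := by
  conv_lhs => rw [← sum_mul_single v]
  simp [map_sum, pd]

/-- The advective derivative is the derivative of the space-time field along `(1, u)`. -/
theorem advScalar_eq_fderiv (h : DifferentiableAt ℝ (fun q : ℝ × Vec => F q.1 q.2) p) :
    advScalar u F p.1 p.2 = fderiv ℝ (fun q : ℝ × Vec => F q.1 q.2) p (1, u p.1 p.2) := by
  have e : ((1 : ℝ), u p.1 p.2) = (1, 0) + ∑ j, u p.1 p.2 j • ((0 : ℝ), (Pi.single j 1 : Vec)) := by
    ext i
    · simp [Prod.fst_sum]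
    · simp [Prod.snd_sum, Finset.sum_apply, Pi.single_apply]
  rw [e, map_add, map_sum, advScalar, deriv_slice h]
  simp only [pd_slice h, map_smul, smul_eq_mul]

theorem SmoothOn.contDiffAt (hF : SmoothOn Ω F) (hΩ : IsOpen Ω) (hp : p ∈ Ω) :
    ContDiffAt ℝ ∞ (fun q : ℝ × Vec => F q.1 q.2) p :=
  ContDiffOn.contDiffAt hF (hΩ.mem_nhds hp)

theorem SmoothOn.differentiableAt (hF : SmoothOn Ω F) (hΩ : IsOpen Ω) (hp : p ∈ Ω) :
    DifferentiableAt ℝ (fun q : ℝ × Vec => F q.1 q.2) p :=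
  (hF.contDiffAt hΩ hp).differentiableAt (by simp)

theorem SmoothOn.slice (hF : SmoothOn Ω F) (hΩ : IsOpen Ω) (hp : p ∈ Ω) :
    DifferentiableAt ℝ (F p.1) p.2 :=
  (hasFDerivAt_slice (hF.differentiableAt hΩ hp)).differentiableAt

theorem SmoothOn.add (hF : SmoothOn Ω F) (hG : SmoothOn Ω G) :
    SmoothOn Ω (fun t x => F t x + G t x) := ContDiffOn.add hF hG

theorem SmoothOn.sub (hF : SmoothOn Ω F) (hG : SmoothOn Ω G) :
    SmoothOn Ω (fun t x => F t x - G t x) := ContDiffOn.sub hF hG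

theorem SmoothOn.mul (hF : SmoothOn Ω F) (hG : SmoothOn Ω G) :
    SmoothOn Ω (fun t x => F t x * G t x) := ContDiffOn.mul hF hG

theorem SmoothOn.const (c : ℝ) : SmoothOn Ω (fun _ _ => c) := contDiffOn_const

theorem SmoothOn.inv (hF : SmoothOn Ω F) (h0 : ∀ p ∈ Ω, F p.1 p.2 ≠ 0) :
    SmoothOn Ω (fun t x => 1 / F t x) := by
  simpa only [one_div] using! ContDiffOn.inv hF h0

theorem SmoothOn.sum {ι : Type*} (s : Finset ι) {H : ι → ℝ → Vec → ℝ}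
    (h : ∀ i ∈ s, SmoothOn Ω (H i)) : SmoothOn Ω (fun t x => ∑ i ∈ s, H i t x) :=
  ContDiffOn.sum h

theorem SmoothOn.fderiv_apply (hF : SmoothOn Ω F) (hΩ : IsOpen Ω) (v : ℝ × Vec) :
    ContDiffOn ℝ ∞ (fun q => fderiv ℝ (fun q : ℝ × Vec => F q.1 q.2) q v) Ω :=
  (ContDiffOn.fderiv_of_isOpen (m := ∞) hF hΩ (by simp)).clm_apply contDiffOn_const

theorem SmoothOn.pd (hF : SmoothOn Ω F) (hΩ : IsOpen Ω) (j : Fin 3) :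
    SmoothOn Ω (fun t => pd j (F t)) :=
  (hF.fderiv_apply hΩ (0, Pi.single j 1)).congr
    fun _ hp => pd_slice (hF.differentiableAt hΩ hp) j

theorem pd_congr {f g : Vec → ℝ} {x : Vec} (h : f =ᶠ[𝓝 x] g) (j : Fin 3) : pd j f x = pd j g x := by
  rw [pd, pd, h.fderiv_eq]

/-- Two fields that agree on an open region have the same spatial derivatives there. -/
theorem pd_congr_of_isOpen (hΩ : IsOpen Ω) (h : ∀ p ∈ Ω, F p.1 p.2 = G p.1 p.2) (hp : p ∈ Ω)
    (j : Fin 3) : pd j (F p.1) p.2 = pd j (G p.1) p.2 := by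
  refine pd_congr ?_ j
  have : ∀ᶠ y in 𝓝 p.2, (p.1, y) ∈ Ω :=
    (Continuous.prodMk_right p.1).continuousAt.eventually (hΩ.mem_nhds hp)
  exact this.mono fun y hy => h _ hy

theorem pd_add {f g : Vec → ℝ} {x : Vec} (hf : DifferentiableAt ℝ f x)
    (hg : DifferentiableAt ℝ g x) (j : Fin 3) :
    pd j (fun y => f y + g y) x = pd j f x + pd j g x := by
  simp [pd, fderiv_fun_add hf hg]

theorem pd_sub {f g : Vec → ℝ} {x : Vec} (hf : DifferentiableAt ℝ f x)
    (hg : DifferentiableAt ℝ g x) (j : Fin 3) :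
    pd j (fun y => f y - g y) x = pd j f x - pd j g x := by
  simp [pd, fderiv_fun_sub hf hg]

theorem pd_neg {f : Vec → ℝ} {x : Vec} (j : Fin 3) :
    pd j (fun y => - f y) x = - pd j f x := by
  simp [pd]

theorem pd_const (c : ℝ) (x : Vec) (j : Fin 3) : pd j (fun _ => c) x = 0 := by
  simp [pd]

theorem pd_mul {f g : Vec → ℝ} {x : Vec} (hf : DifferentiableAt ℝ f x)
    (hg : DifferentiableAt ℝ g x) (j : Fin 3) :
    pd j (fun y => f y * g y) x = f x * pd j g x + pd j f x * g x := by
  simp [pd, fderiv_fun_mul hf hg, mul_comm]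

theorem pd_sum {ι : Type*} (s : Finset ι) {f : ι → Vec → ℝ} {x : Vec}
    (hf : ∀ i ∈ s, DifferentiableAt ℝ (f i) x) (j : Fin 3) :
    pd j (fun y => ∑ i ∈ s, f i y) x = ∑ i ∈ s, pd j (f i) x := by
  simp [pd, fderiv_fun_sum hf]

theorem advScalar_mul (hF : DifferentiableAt ℝ (fun q : ℝ × Vec => F q.1 q.2) p)
    (hG : DifferentiableAt ℝ (fun q : ℝ × Vec => G q.1 q.2) p) :
    advScalar u (fun t x => F t x * G t x) p.1 p.2 =
      F p.1 p.2 * advScalar u G p.1 p.2 + advScalar u F p.1 p.2 * G p.1 p.2 := by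
  rw [advScalar_eq_fderiv hF, advScalar_eq_fderiv hG, advScalar_eq_fderiv (hF.mul hG),
    fderiv_fun_mul hF hG]
  simp [mul_comm]

theorem advScalar_add (hF : DifferentiableAt ℝ (fun q : ℝ × Vec => F q.1 q.2) p)
    (hG : DifferentiableAt ℝ (fun q : ℝ × Vec => G q.1 q.2) p) :
    advScalar u (fun t x => F t x + G t x) p.1 p.2 =
      advScalar u F p.1 p.2 + advScalar u G p.1 p.2 := by
  rw [advScalar_eq_fderiv hF, advScalar_eq_fderiv hG, advScalar_eq_fderiv (hF.add hG),
    fderiv_fun_add hF hG]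
  simp

theorem advScalar_sub (hF : DifferentiableAt ℝ (fun q : ℝ × Vec => F q.1 q.2) p)
    (hG : DifferentiableAt ℝ (fun q : ℝ × Vec => G q.1 q.2) p) :
    advScalar u (fun t x => F t x - G t x) p.1 p.2 =
      advScalar u F p.1 p.2 - advScalar u G p.1 p.2 := by
  rw [advScalar_eq_fderiv hF, advScalar_eq_fderiv hG, advScalar_eq_fderiv (hF.sub hG),
    fderiv_fun_sub hF hG]
  simp

theorem advScalar_const (c : ℝ) : advScalar u (fun _ _ => c) p.1 p.2 = 0 := by
  simp [advScalar, pd_const]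

theorem advScalar_sum {ι : Type*} (s : Finset ι) {H : ι → ℝ → Vec → ℝ}
    (h : ∀ i ∈ s, DifferentiableAt ℝ (fun q : ℝ × Vec => H i q.1 q.2) p) :
    advScalar u (fun t x => ∑ i ∈ s, H i t x) p.1 p.2 = ∑ i ∈ s, advScalar u (H i) p.1 p.2 := by
  have h2 : DifferentiableAt ℝ (fun q : ℝ × Vec => ∑ i ∈ s, H i q.1 q.2) p :=
    DifferentiableAt.fun_sum h
  rw [advScalar_eq_fderiv h2, fderiv_fun_sum h]
  simp only [sum_apply]
  exact Finset.sum_congr rfl fun i hi => (advScalar_eq_fderiv (h i hi)).symm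

theorem advScalar_inv (hF : DifferentiableAt ℝ (fun q : ℝ × Vec => F q.1 q.2) p)
    (h0 : F p.1 p.2 ≠ 0) :
    advScalar u (fun t x => 1 / F t x) p.1 p.2 = - advScalar u F p.1 p.2 / F p.1 p.2 ^ 2 := by
  have h1 := (hasDerivAt_inv h0).comp_hasFDerivAt p hF.hasFDerivAt
  simp only [one_div]
  rw [advScalar_eq_fderiv hF, advScalar_eq_fderiv (F := fun t x => (F t x)⁻¹) h1.differentiableAt]
  have e : (fun q : ℝ × Vec => (F q.1 q.2)⁻¹) = Inv.inv ∘ (fun q : ℝ × Vec => F q.1 q.2) := rfl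
  rw [e, h1.fderiv]
  simp; ring

/-- Mixed derivatives of a smooth space-time field commute. -/
theorem fderiv_fderiv_comm (hF : SmoothOn Ω F) (hΩ : IsOpen Ω) (hp : p ∈ Ω) (v w : ℝ × Vec) :
    fderiv ℝ (fun q => fderiv ℝ (fun q : ℝ × Vec => F q.1 q.2) q v) p w =
      fderiv ℝ (fun q => fderiv ℝ (fun q : ℝ × Vec => F q.1 q.2) q w) p v := by
  have hs := (hF.contDiffAt hΩ hp).isSymmSndFDerivAt
    (by rw [minSmoothness_of_isRCLikeNormedField]; exact WithTop.coe_le_coe.2 (le_top : (2 : ℕ∞) ≤ ⊤))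
  have hd : DifferentiableAt ℝ (fderiv ℝ (fun q : ℝ × Vec => F q.1 q.2)) p :=
    ((ContDiffOn.fderiv_of_isOpen (m := ∞) hF hΩ (by simp)).contDiffAt
      (hΩ.mem_nhds hp)).differentiableAt (by simp)
  rw [fderiv_clm_apply hd (differentiableAt_const v), fderiv_clm_apply hd (differentiableAt_const w)]
  simpa using hs.eq w v

theorem pd_pd_comm (hF : SmoothOn Ω F) (hΩ : IsOpen Ω) (hp : p ∈ Ω) (i j : Fin 3) :
    pd i (fun y => pd j (F p.1) y) p.2 = pd j (fun y => pd i (F p.1) y) p.2 := by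
  have key : ∀ i j : Fin 3, pd i (fun y => pd j (F p.1) y) p.2 =
      fderiv ℝ (fun q => fderiv ℝ (fun q : ℝ × Vec => F q.1 q.2) q (0, Pi.single j 1)) p
        (0, Pi.single i 1) := by
    intro i j
    have h := pd_slice (F := fun t => pd j (F t)) ((hF.pd hΩ j).differentiableAt hΩ hp) i
    rw [h]
    have : (fun q : ℝ × Vec => pd j (F q.1) q.2) =ᶠ[𝓝 p]
        fun q => fderiv ℝ (fun q : ℝ × Vec => F q.1 q.2) q (0, Pi.single j 1) :=
      Filter.Eventually.mono (hΩ.mem_nhds hp) fun q hq =>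
        pd_slice (hF.differentiableAt hΩ hq) j
    rw [this.fderiv_eq]
  rw [key, key, fderiv_fderiv_comm hF hΩ hp]

/-- The commutator of the advective and of a spatial derivative. -/
theorem advScalar_pd (hF : SmoothOn Ω F) (hΩ : IsOpen Ω)
    (hu : ∀ j, SmoothOn Ω (fun t x => u t x j)) (hp : p ∈ Ω) (i : Fin 3) :
    advScalar u (fun t => pd i (F t)) p.1 p.2 =
      pd i (advScalar u F p.1) p.2 - ∑ j, pd i (fun y => u p.1 y j) p.2 * pd j (F p.1) p.2 := by
  have hFt : SmoothOn Ω (fun t x => deriv (fun s => F s x) t) :=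
    (hF.fderiv_apply hΩ (1, 0)).congr fun _ hp => deriv_slice (hF.differentiableAt hΩ hp)
  have e1 : pd i (advScalar u F p.1) p.2 = pd i (fun x => deriv (fun s => F s x) p.1) p.2 +
      ∑ j, (u p.1 p.2 j * pd i (fun y => pd j (F p.1) y) p.2
        + pd i (fun y => u p.1 y j) p.2 * pd j (F p.1) p.2) := by
    have hs : ∀ j ∈ Finset.univ, DifferentiableAt ℝ (fun y => u p.1 y j * pd j (F p.1) y) p.2 :=
      fun j _ => ((hu j).slice hΩ hp).fun_mul ((hF.pd hΩ j).slice hΩ hp)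
    have : advScalar u F p.1 = fun x => deriv (fun s => F s x) p.1 + ∑ j, u p.1 x j * pd j (F p.1) x :=
      rfl
    rw [this, pd_add (hFt.slice hΩ hp) (DifferentiableAt.fun_sum hs), pd_sum _ hs]
    congr 1
    exact Finset.sum_congr rfl fun j _ => pd_mul ((hu j).slice hΩ hp) ((hF.pd hΩ j).slice hΩ hp) i
  have e2 : deriv (fun s => pd i (F s) p.2) p.1 = pd i (fun x => deriv (fun s => F s x) p.1) p.2 := by
    have h1 := deriv_slice (F := fun t => pd i (F t)) ((hF.pd hΩ i).differentiableAt hΩ hp)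
    have h2 := pd_slice (F := fun t x => deriv (fun s => F s x) t) (hFt.differentiableAt hΩ hp) i
    have hn : ∀ᶠ q in 𝓝 p, q ∈ Ω := hΩ.mem_nhds hp
    have c1 : (fun q : ℝ × Vec => pd i (F q.1) q.2) =ᶠ[𝓝 p]
        fun q => fderiv ℝ (fun q : ℝ × Vec => F q.1 q.2) q (0, Pi.single i 1) :=
      hn.mono fun q hq => pd_slice (hF.differentiableAt hΩ hq) i
    have c2 : (fun q : ℝ × Vec => deriv (fun s => F s q.2) q.1) =ᶠ[𝓝 p]
        fun q => fderiv ℝ (fun q : ℝ × Vec => F q.1 q.2) q (1, 0) :=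
      hn.mono fun q hq => deriv_slice (hF.differentiableAt hΩ hq)
    rw [h1, h2, c1.fderiv_eq, c2.fderiv_eq, fderiv_fderiv_comm hF hΩ hp]
  rw [e1, Finset.sum_add_distrib]
  have e3 : advScalar u (fun t => pd i (F t)) p.1 p.2 = deriv (fun s => pd i (F s) p.2) p.1 +
      ∑ j, u p.1 p.2 j * pd j (fun y => pd i (F p.1) y) p.2 := rfl
  rw [e3, e2]
  have : ∀ j, pd j (fun y => pd i (F p.1) y) p.2 = pd i (fun y => pd j (F p.1) y) p.2 :=
    fun j => pd_pd_comm hF hΩ hp j i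
  simp only [this]; ring

end SpaceTime

end

section

/-! ### Invariants generated by functions, gradients and products -/

section Invariants

variable {Ω : Set (ℝ × Vec)} {u : ℝ → Vec → Vec} {ρ : ℝ → Vec → ℝ} {p : ℝ × Vec}

theorem smoothOn_vec_iff {K : ℝ → Vec → Vec} :
    ContDiffOn ℝ ∞ (fun q : ℝ × Vec => K q.1 q.2) Ω ↔ ∀ i, SmoothOn Ω (fun t x => K t x i) :=
  contDiffOn_pi

theorem smoothOn_ten_iff {K : ℝ → Vec → Ten} :
    ContDiffOn ℝ ∞ (fun q : ℝ × Vec => K q.1 q.2) Ω ↔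
      ∀ i j, SmoothOn Ω (fun t x => K t x i j) := by
  rw [contDiffOn_pi]
  exact forall_congr' fun i => contDiffOn_pi

theorem smoothOn_tri_iff {K : ℝ → Vec → Tri} :
    ContDiffOn ℝ ∞ (fun q : ℝ × Vec => K q.1 q.2) Ω ↔
      ∀ i j k, SmoothOn Ω (fun t x => K t x i j k) := by
  rw [contDiffOn_pi]
  refine forall_congr' fun i => ?_
  rw [contDiffOn_pi]
  exact forall_congr' fun j => contDiffOn_pi

theorem isInvariantOn_scalar_iff {K : ℝ → Vec → ℝ} :
    IsInvariantOn .scalar Ω u K ↔ SmoothOn Ω K ∧ ∀ p ∈ Ω, advScalar u K p.1 p.2 = 0 :=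
  ⟨fun h => ⟨h.smooth, h.advected⟩, fun h => ⟨h.1, fun _ _ => trivial, h.2⟩⟩

theorem isInvariantOn_vec_iff {K : ℝ → Vec → Vec} :
    IsInvariantOn .vec Ω u K ↔ (∀ i, SmoothOn Ω (fun t x => K t x i)) ∧
      ∀ p ∈ Ω, ∀ i, advScalar u (fun t x => K t x i) p.1 p.2 =
        ∑ j, K p.1 p.2 j * pd j (fun y => u p.1 y i) p.2 := by
  constructor
  · refine fun h => ⟨smoothOn_vec_iff.1 h.smooth, fun p hp i => sub_eq_zero.1 ?_⟩
    exact congrFun (h.advected p hp) i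
  · refine fun h => ⟨smoothOn_vec_iff.2 h.1, fun _ _ => trivial, fun p hp => funext fun i => ?_⟩
    exact sub_eq_zero.2 (h.2 p hp i)

theorem isInvariantOn_skew_iff {K : ℝ → Vec → Ten} :
    IsInvariantOn .skew Ω u K ↔ (∀ i j, SmoothOn Ω (fun t x => K t x i j)) ∧
      (∀ p ∈ Ω, IsSkew (K p.1 p.2)) ∧
      ∀ p ∈ Ω, ∀ i j, advScalar u (fun t x => K t x i j) p.1 p.2 =
        ∑ k, K p.1 p.2 k j * pd k (fun y => u p.1 y i) p.2 +
        ∑ k, K p.1 p.2 i k * pd k (fun y => u p.1 y j) p.2 := by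
  constructor
  · refine fun h => ⟨smoothOn_ten_iff.1 h.smooth, h.symm, fun p hp i j => ?_⟩
    have h1 : advScalar u (fun t x => K t x i j) p.1 p.2 -
      ∑ k, K p.1 p.2 k j * pd k (fun y => u p.1 y i) p.2 -
      ∑ k, K p.1 p.2 i k * pd k (fun y => u p.1 y j) p.2 = 0 :=
      congrFun (congrFun (h.advected p hp) i) j
    linarith
  · refine fun h => ⟨smoothOn_ten_iff.2 h.1, h.2.1, fun p hp => funext fun i => funext fun j => ?_⟩
    have h1 := h.2.2 p hp i j
    change advScalar u (fun t x => K t x i j) p.1 p.2 -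
      ∑ k, K p.1 p.2 k j * pd k (fun y => u p.1 y i) p.2 -
      ∑ k, K p.1 p.2 i k * pd k (fun y => u p.1 y j) p.2 = 0
    linarith

theorem IsFlowOn.smooth_u (h : IsFlowOn Ω u ρ) (j : Fin 3) : SmoothOn Ω (fun t x => u t x j) :=
  smoothOn_vec_iff.1 h.smooth_velocity j

theorem IsFlowOn.density_ne_zero (h : IsFlowOn Ω u ρ) : ∀ p ∈ Ω, ρ p.1 p.2 ≠ 0 :=
  fun p hp => (h.density_pos p hp).ne'

/-- Mass continuity, as a transport equation. -/
theorem IsFlowOn.advScalar_density (h : IsFlowOn Ω u ρ) (hΩ : IsOpen Ω) (hp : p ∈ Ω) :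
    advScalar u ρ p.1 p.2 = - (ρ p.1 p.2 * ∑ j, pd j (fun y => u p.1 y j) p.2) := by
  have h1 := h.continuity_eq p hp
  have h2 : ∀ j, pd j (fun y => ρ p.1 y * u p.1 y j) p.2 = ρ p.1 p.2 * pd j (fun y => u p.1 y j) p.2
      + pd j (ρ p.1) p.2 * u p.1 p.2 j := fun j =>
    pd_mul (SmoothOn.slice h.smooth_density hΩ hp) (SmoothOn.slice (h.smooth_u j) hΩ hp) j
  simp only [h2, Fin.sum_univ_three, advScalar] at h1 ⊢
  linarith

theorem IsFlowOn.advScalar_inv_density (h : IsFlowOn Ω u ρ) (hΩ : IsOpen Ω) (hp : p ∈ Ω) :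
    advScalar u (fun t x => 1 / ρ t x) p.1 p.2 =
      1 / ρ p.1 p.2 * ∑ j, pd j (fun y => u p.1 y j) p.2 := by
  have h0 := h.density_ne_zero p hp
  rw [advScalar_inv (SmoothOn.differentiableAt h.smooth_density hΩ hp) h0,
    h.advScalar_density hΩ hp]
  field_simp

/-- `𝔇_t` obeys the Leibniz rule on the derivative of a scalar along a vector. -/
theorem advScalar_gradVec (hΩ : IsOpen Ω) (hu : ∀ j, SmoothOn Ω (fun t x => u t x j))
    {K₀ : ℝ → Vec → Vec} {K : ℝ → Vec → ℝ} (h₀ : ∀ i, SmoothOn Ω (fun t x => K₀ t x i))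
    (hK : SmoothOn Ω K) (hp : p ∈ Ω) :
    advScalar u (fun t => gradVec (K₀ t) (K t)) p.1 p.2 =
      gradVec (advVec u K₀ p.1) (K p.1) p.2 + gradVec (K₀ p.1) (advScalar u K p.1) p.2 := by
  have e : (fun t => gradVec (K₀ t) (K t)) = fun t x => ∑ i, K₀ t x i * pd i (K t) x := rfl
  rw [e, advScalar_sum _ fun i _ => ((h₀ i).mul (hK.pd hΩ i)).differentiableAt hΩ hp]
  simp only [advScalar_mul (F := fun t x => K₀ t x _) (G := fun t => pd _ (K t))
    ((h₀ _).differentiableAt hΩ hp) ((hK.pd hΩ _).differentiableAt hΩ hp),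
    advScalar_pd hK hΩ hu hp, gradVec, advVec, Fin.sum_univ_three]
  ring

/-- `𝔇_t` obeys the Leibniz rule on the contraction of a skew-tensor with a gradient. -/
theorem advVec_gradSkew (hΩ : IsOpen Ω) (hu : ∀ j, SmoothOn Ω (fun t x => u t x j))
    {K₀ : ℝ → Vec → Ten} {K : ℝ → Vec → ℝ} (h₀ : ∀ i j, SmoothOn Ω (fun t x => K₀ t x i j))
    (hK : SmoothOn Ω K) (hp : p ∈ Ω) :
    advVec u (fun t => gradSkew (K₀ t) (K t)) p.1 p.2 =
      gradSkew (advTen u K₀ p.1) (K p.1) p.2 + gradSkew (K₀ p.1) (advScalar u K p.1) p.2 := by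
  ext i
  have e : (fun t x => gradSkew (K₀ t) (K t) x i) = fun t x => ∑ j, K₀ t x i j * pd j (K t) x := rfl
  simp only [advVec, Pi.add_apply]
  rw [e, advScalar_sum _ fun j _ => ((h₀ i j).mul (hK.pd hΩ j)).differentiableAt hΩ hp]
  simp only [advScalar_mul (F := fun t x => K₀ t x i _) (G := fun t => pd _ (K t))
    ((h₀ _ _).differentiableAt hΩ hp) ((hK.pd hΩ _).differentiableAt hΩ hp),
    advScalar_pd hK hΩ hu hp, gradSkew, advTen, Fin.sum_univ_three]
  ring

theorem smoothOn_gradVec (hΩ : IsOpen Ω) {K₀ : ℝ → Vec → Vec} {K : ℝ → Vec → ℝ}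
    (h₀ : ∀ i, SmoothOn Ω (fun t x => K₀ t x i)) (hK : SmoothOn Ω K) :
    SmoothOn Ω (fun t => gradVec (K₀ t) (K t)) :=
  SmoothOn.sum _ fun i _ => (h₀ i).mul (hK.pd hΩ i)

theorem smoothOn_gradSkew (hΩ : IsOpen Ω) {K₀ : ℝ → Vec → Ten} {K : ℝ → Vec → ℝ}
    (h₀ : ∀ i j, SmoothOn Ω (fun t x => K₀ t x i j)) (hK : SmoothOn Ω K) (i : Fin 3) :
    SmoothOn Ω (fun t x => gradSkew (K₀ t) (K t) x i) :=
  SmoothOn.sum _ fun j _ => (h₀ i j).mul (hK.pd hΩ j)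

theorem pd_eq_zero_of_isOpen (hΩ : IsOpen Ω) {F : ℝ → Vec → ℝ} (h : ∀ p ∈ Ω, F p.1 p.2 = 0)
    (hp : p ∈ Ω) (j : Fin 3) : pd j (F p.1) p.2 = 0 := by
  rw [pd_congr_of_isOpen (G := fun _ _ => 0) hΩ h hp, pd_const]

theorem gradVec_invariant (hΩ : IsOpen Ω) (hu : ∀ j, SmoothOn Ω (fun t x => u t x j))
    {K₀ : ℝ → Vec → Vec} {K : ℝ → Vec → ℝ} (h₀ : IsInvariantOn .vec Ω u K₀)
    (hK : IsInvariantOn .scalar Ω u K) :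
    IsInvariantOn .scalar Ω u (fun t => gradVec (K₀ t) (K t)) := by
  have s₀ := smoothOn_vec_iff.1 h₀.smooth
  refine isInvariantOn_scalar_iff.2 ⟨smoothOn_gradVec hΩ s₀ hK.smooth, fun p hp => ?_⟩
  rw [advScalar_gradVec hΩ hu s₀ hK.smooth hp]
  have h1 : advVec u K₀ p.1 p.2 = 0 := h₀.advected p hp
  simp [gradVec, h1, pd_eq_zero_of_isOpen hΩ (isInvariantOn_scalar_iff.1 hK).2 hp]

theorem gradSkew_invariant (hΩ : IsOpen Ω) (hu : ∀ j, SmoothOn Ω (fun t x => u t x j))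
    {K₀ : ℝ → Vec → Ten} {K : ℝ → Vec → ℝ} (h₀ : IsInvariantOn .skew Ω u K₀)
    (hK : IsInvariantOn .scalar Ω u K) :
    IsInvariantOn .vec Ω u (fun t => gradSkew (K₀ t) (K t)) := by
  have s₀ := smoothOn_ten_iff.1 h₀.smooth
  refine ⟨smoothOn_vec_iff.2 (smoothOn_gradSkew hΩ s₀ hK.smooth), fun _ _ => trivial,
    fun p hp => ?_⟩
  refine (advVec_gradSkew hΩ hu s₀ hK.smooth hp).trans ?_
  have h1 : advTen u K₀ p.1 p.2 = 0 := h₀.advected p hp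
  refine funext fun i => ?_
  change _ = (0 : ℝ)
  simp [gradSkew, h1, pd_eq_zero_of_isOpen hΩ (isInvariantOn_scalar_iff.1 hK).2 hp]

theorem eps_swap_left (i j k : Fin 3) : eps i j k = - eps j i k := by
  simp only [eps]; ring

theorem eps_swap_right (i j k : Fin 3) : eps i j k = - eps i k j := by
  simp only [eps]; ring

theorem eps_zero_one_two : eps 0 1 2 = 1 := by norm_num [eps]

/-- The infinitesimal action of a matrix on the Levi-Civita symbol is by its trace. -/
theorem sum_eps_mul_eq_trace (M : Fin 3 → Fin 3 → ℝ) (i j k : Fin 3) :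
    ∑ l, eps l j k * M l i + ∑ l, eps i l k * M l j + ∑ l, eps i j l * M l k =
      (∑ l, M l l) * eps i j k := by
  have h : ∀ i : Fin 3, i = 0 ∨ i = 1 ∨ i = 2 := by decide
  simp only [Fin.sum_univ_three, eps]
  obtain rfl | rfl | rfl := h i <;> obtain rfl | rfl | rfl := h j <;>
    obtain rfl | rfl | rfl := h k <;> norm_num <;> ring_nf

theorem volTensor_invariant (hΩ : IsOpen Ω) (hf : IsFlowOn Ω u ρ) :
    IsTriInvariantOn Ω u (fun t => volTensor (ρ t)) := by
  have hinv : SmoothOn Ω (fun t x => 1 / ρ t x) := SmoothOn.inv hf.smooth_density hf.density_ne_zero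
  have hs : ∀ i j k, SmoothOn Ω (fun t x => volTensor (ρ t) x i j k) := fun i j k =>
    hinv.mul (SmoothOn.const (eps i j k))
  refine ⟨smoothOn_tri_iff.2 hs, fun p _ i j k => ⟨?_, ?_⟩, fun p hp => ?_⟩
  · simp only [volTensor]; rw [eps_swap_left]; ring
  · simp only [volTensor]; rw [eps_swap_right]; ring
  · ext i j k
    have e : advScalar u (fun t x => volTensor (ρ t) x i j k) p.1 p.2 =
        1 / ρ p.1 p.2 * (∑ j, pd j (fun y => u p.1 y j) p.2) * eps i j k := by
      have := advScalar_mul (u := u) (F := fun t x => 1 / ρ t x) (G := fun _ _ => eps i j k) (hinv.differentiableAt hΩ hp)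
        ((SmoothOn.const (Ω := Ω) (eps i j k)).differentiableAt hΩ hp)
      simp only [volTensor]
      rw [this, advScalar_const, hf.advScalar_inv_density hΩ hp]
      ring
    have h1 := sum_eps_mul_eq_trace (fun l i => pd l (fun y => u p.1 y i) p.2) i j k
    simp only [Fin.sum_univ_three] at h1
    change advScalar u (fun t x => volTensor (ρ t) x i j k) p.1 p.2 - _ - _ - _ = 0
    rw [e]
    simp only [volTensor, Fin.sum_univ_three]
    linear_combination - (1 / ρ p.1 p.2) * h1

theorem gradVol_invariant (hΩ : IsOpen Ω) (hf : IsFlowOn Ω u ρ) {K : ℝ → Vec → ℝ}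
    (hK : IsInvariantOn .scalar Ω u K) :
    IsInvariantOn .skew Ω u (fun t => gradVol (ρ t) (K t)) := by
  have hv := volTensor_invariant hΩ hf
  have sv := smoothOn_tri_iff (K := fun t => volTensor (ρ t)) |>.1 hv.smooth
  have sK : SmoothOn Ω K := hK.smooth
  refine isInvariantOn_skew_iff.2 ⟨fun i j => SmoothOn.sum _ fun k _ => (sv i j k).mul (sK.pd hΩ k),
    fun p hp i j => ?_, fun p hp i j => ?_⟩
  · simp only [gradVol, ← Finset.sum_neg_distrib]
    refine Finset.sum_congr rfl fun k _ => ?_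
    rw [(hv.symm p hp i j k).1]; ring
  · have e : (fun t x => gradVol (ρ t) (K t) x i j) =
        fun t x => ∑ k, volTensor (ρ t) x i j k * pd k (K t) x := rfl
    rw [e, advScalar_sum _ fun k _ => ((sv i j k).mul (sK.pd hΩ k)).differentiableAt hΩ hp]
    have h1 : ∀ k, advScalar u (fun t x => volTensor (ρ t) x i j k) p.1 p.2 =
        ∑ l, volTensor (ρ p.1) p.2 l j k * pd l (fun y => u p.1 y i) p.2
        + ∑ l, volTensor (ρ p.1) p.2 i l k * pd l (fun y => u p.1 y j) p.2
        + ∑ l, volTensor (ρ p.1) p.2 i j l * pd l (fun y => u p.1 y k) p.2 := fun k => by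
      have : advTri u (fun t => volTensor (ρ t)) p.1 p.2 i j k = 0 := by
        rw [hv.advected p hp]; rfl
      simp only [advTri] at this
      linarith
    simp only [advScalar_mul (F := fun t x => volTensor (ρ t) x i j _) (G := fun t => pd _ (K t))
      ((sv _ _ _).differentiableAt hΩ hp) ((sK.pd hΩ _).differentiableAt hΩ hp), h1,
      advScalar_pd sK hΩ hf.smooth_u hp, gradVol,
      pd_eq_zero_of_isOpen hΩ (isInvariantOn_scalar_iff.1 hK).2 hp, Fin.sum_univ_three]
    ring

theorem mulVec_advected {K₀ : ℝ → Vec → ℝ} {K : ℝ → Vec → Vec}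
    (h₀ : IsAdvectedOn .scalar Ω u K₀) (h : IsAdvectedOn .vec Ω u K) :
    IsAdvectedOn .vec Ω u (fun t x => K₀ t x • K t x) := by
  refine ⟨fun p hp => DifferentiableAt.fun_smul (h₀.differentiable p hp) (h.differentiable p hp), fun _ _ => trivial,
    fun p hp => funext fun i => ?_⟩
  have d₀ : DifferentiableAt ℝ (fun q : ℝ × Vec => K₀ q.1 q.2) p := h₀.differentiable p hp
  have d : DifferentiableAt ℝ (fun q : ℝ × Vec => K q.1 q.2) p := h.differentiable p hp
  have a₀ : advScalar u K₀ p.1 p.2 = 0 := h₀.advected p hp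
  have a : advScalar u (fun t x => K t x i) p.1 p.2 -
    ∑ j, K p.1 p.2 j * pd j (fun y => u p.1 y i) p.2 = 0 := congrFun (h.advected p hp) i
  change advScalar u (fun t x => K₀ t x * K t x i) p.1 p.2 -
    ∑ j, (K₀ p.1 p.2 * K p.1 p.2 j) * pd j (fun y => u p.1 y i) p.2 = 0
  rw [advScalar_mul d₀ (G := fun t x => K t x i) (differentiableAt_pi.1 d i), a₀]
  simp only [mul_assoc, ← Finset.mul_sum]
  linear_combination K₀ p.1 p.2 * a

theorem mulSkew_advected {K₀ : ℝ → Vec → ℝ} {K : ℝ → Vec → Ten}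
    (h₀ : IsAdvectedOn .scalar Ω u K₀) (h : IsAdvectedOn .skew Ω u K) :
    IsAdvectedOn .skew Ω u (fun t x => K₀ t x • K t x) := by
  refine ⟨fun p hp => DifferentiableAt.fun_smul (h₀.differentiable p hp) (h.differentiable p hp), fun p hp i j => ?_,
    fun p hp => funext fun i => funext fun j => ?_⟩
  · change K₀ p.1 p.2 * K p.1 p.2 i j = - (K₀ p.1 p.2 * K p.1 p.2 j i)
    rw [h.symm p hp i j]; ring
  have d₀ : DifferentiableAt ℝ (fun q : ℝ × Vec => K₀ q.1 q.2) p := h₀.differentiable p hp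
  have d : DifferentiableAt ℝ (fun q : ℝ × Vec => K q.1 q.2) p := h.differentiable p hp
  have a₀ : advScalar u K₀ p.1 p.2 = 0 := h₀.advected p hp
  have a : advScalar u (fun t x => K t x i j) p.1 p.2 -
      ∑ k, K p.1 p.2 k j * pd k (fun y => u p.1 y i) p.2 -
      ∑ k, K p.1 p.2 i k * pd k (fun y => u p.1 y j) p.2 = 0 :=
    congrFun (congrFun (h.advected p hp) i) j
  change advScalar u (fun t x => K₀ t x * K t x i j) p.1 p.2 -
    ∑ k, (K₀ p.1 p.2 * K p.1 p.2 k j) * pd k (fun y => u p.1 y i) p.2 -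
    ∑ k, (K₀ p.1 p.2 * K p.1 p.2 i k) * pd k (fun y => u p.1 y j) p.2 = 0
  rw [advScalar_mul d₀ (G := fun t x => K t x i j)
    (differentiableAt_pi.1 (differentiableAt_pi.1 d i) j), a₀]
  simp only [mul_assoc, ← Finset.mul_sum]
  linear_combination K₀ p.1 p.2 * a

theorem IsInvariantOn.isAdvectedOn {κ : Kind} {K : ℝ → Vec → κ.Val} (hΩ : IsOpen Ω)
    (h : IsInvariantOn κ Ω u K) : IsAdvectedOn κ Ω u K :=
  ⟨fun _ hp => (h.smooth.contDiffAt (hΩ.mem_nhds hp)).differentiableAt (by simp), h.symm,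
    h.advected⟩

theorem func_advected {m : ℕ} {f : (Fin m → ℝ) → ℝ} {O : Set (Fin m → ℝ)}
    {K : Fin m → ℝ → Vec → ℝ} (hO : IsOpen O) (hf : DifferentiableOn ℝ f O)
    (hK : ∀ i, IsAdvectedOn .scalar Ω u (K i)) (hKO : ∀ p ∈ Ω, (fun i => K i p.1 p.2) ∈ O) :
    IsAdvectedOn .scalar Ω u (fun t x => f (fun i => K i t x)) := by
  have d : ∀ p ∈ Ω, ∀ i, DifferentiableAt ℝ (fun q : ℝ × Vec => K i q.1 q.2) p :=
    fun p hp i => (hK i).differentiable p hp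
  have dK : ∀ p ∈ Ω, DifferentiableAt ℝ (fun q : ℝ × Vec => (fun i => K i q.1 q.2)) p :=
    fun p hp => differentiableAt_pi.2 (d p hp)
  have df : ∀ p ∈ Ω, DifferentiableAt ℝ f (fun i => K i p.1 p.2) :=
    fun p hp => hf.differentiableAt (hO.mem_nhds (hKO p hp))
  have dc : ∀ p ∈ Ω, DifferentiableAt ℝ (fun q : ℝ × Vec => f (fun i => K i q.1 q.2)) p :=
    fun p hp => DifferentiableAt.comp (g := f) p (df p hp) (dK p hp)
  refine ⟨dc, fun _ _ => trivial, fun p hp => ?_⟩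
  refine (advScalar_eq_fderiv (F := fun t x => f (fun i => K i t x)) (dc p hp)).trans ?_
  have e : (fun q : ℝ × Vec => f (fun i => K i q.1 q.2)) =
    f ∘ (fun q : ℝ × Vec => (fun i => K i q.1 q.2)) := rfl
  rw [e, fderiv_comp p (df p hp) (dK p hp), ContinuousLinearMap.comp_apply, fderiv_pi (d p hp)]
  have z : ContinuousLinearMap.pi (fun i => fderiv ℝ (fun q : ℝ × Vec => K i q.1 q.2) p)
      (1, u p.1 p.2) = 0 := by
    ext i
    simp only [ContinuousLinearMap.coe_pi', Pi.zero_apply]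
    rw [← advScalar_eq_fderiv (d p hp i)]
    exact (hK i).advected p hp
  rw [z, map_zero]; rfl

theorem func_invariant (hΩ : IsOpen Ω) {m : ℕ} {f : (Fin m → ℝ) → ℝ} {O : Set (Fin m → ℝ)}
    {K : Fin m → ℝ → Vec → ℝ} (hO : IsOpen O) (hf : ContDiffOn ℝ ∞ f O)
    (hK : ∀ i, IsInvariantOn .scalar Ω u (K i)) (hKO : ∀ p ∈ Ω, (fun i => K i p.1 p.2) ∈ O) :
    IsInvariantOn .scalar Ω u (fun t x => f (fun i => K i t x)) := by
  have ha := func_advected hO (hf.differentiableOn (by simp)) (fun i => (hK i).isAdvectedOn hΩ) hKO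
  refine ⟨?_, fun _ _ => trivial, ha.advected⟩
  exact ContDiffOn.comp (g := f) (t := O) hf (contDiffOn_pi.2 fun i => (hK i).smooth) hKO

theorem mulVec_invariant (hΩ : IsOpen Ω) {K₀ : ℝ → Vec → ℝ} {K : ℝ → Vec → Vec}
    (h₀ : IsInvariantOn .scalar Ω u K₀) (h : IsInvariantOn .vec Ω u K) :
    IsInvariantOn .vec Ω u (fun t x => K₀ t x • K t x) := by
  have ha := mulVec_advected (h₀.isAdvectedOn hΩ) (h.isAdvectedOn hΩ)
  exact ⟨ContDiffOn.fun_smul h₀.smooth h.smooth, ha.symm, ha.advected⟩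

theorem mulSkew_invariant (hΩ : IsOpen Ω) {K₀ : ℝ → Vec → ℝ} {K : ℝ → Vec → Ten}
    (h₀ : IsInvariantOn .scalar Ω u K₀) (h : IsInvariantOn .skew Ω u K) :
    IsInvariantOn .skew Ω u (fun t x => K₀ t x • K t x) := by
  have ha := mulSkew_advected (h₀.isAdvectedOn hΩ) (h.isAdvectedOn hΩ)
  exact ⟨ContDiffOn.fun_smul h₀.smooth h.smooth, ha.symm, ha.advected⟩

theorem addVec_invariant (hΩ : IsOpen Ω) {K L : ℝ → Vec → Vec}
    (hK : IsInvariantOn .vec Ω u K) (hL : IsInvariantOn .vec Ω u L) :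
    IsInvariantOn .vec Ω u (fun t x => K t x + L t x) := by
  rw [isInvariantOn_vec_iff] at hK hL ⊢
  refine ⟨fun i => (hK.1 i).add (hL.1 i), fun p hp i => ?_⟩
  have := advScalar_add (u := u) (F := fun t x => K t x i) (G := fun t x => L t x i) ((hK.1 i).differentiableAt hΩ hp) ((hL.1 i).differentiableAt hΩ hp)
  simp only [Pi.add_apply]
  rw [this, hK.2 p hp, hL.2 p hp, ← Finset.sum_add_distrib]
  exact Finset.sum_congr rfl fun j _ => by ring

theorem addSkew_invariant (hΩ : IsOpen Ω) {K L : ℝ → Vec → Ten}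
    (hK : IsInvariantOn .skew Ω u K) (hL : IsInvariantOn .skew Ω u L) :
    IsInvariantOn .skew Ω u (fun t x => K t x + L t x) := by
  rw [isInvariantOn_skew_iff] at hK hL ⊢
  refine ⟨fun i j => (hK.1 i j).add (hL.1 i j), fun p hp i j => ?_, fun p hp i j => ?_⟩
  · simp only [Pi.add_apply]
    rw [hK.2.1 p hp i j, hL.2.1 p hp i j]; ring
  · have := advScalar_add (u := u) (F := fun t x => K t x i j) (G := fun t x => L t x i j) ((hK.1 i j).differentiableAt hΩ hp)
      ((hL.1 i j).differentiableAt hΩ hp)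
    simp only [Pi.add_apply]
    rw [this, hK.2.2 p hp, hL.2.2 p hp]
    simp only [Fin.sum_univ_three]; ring

theorem wedgeVec_invariant (hΩ : IsOpen Ω) {K₀ K : ℝ → Vec → Vec}
    (h₀ : IsInvariantOn .vec Ω u K₀) (hK : IsInvariantOn .vec Ω u K) :
    IsInvariantOn .skew Ω u (fun t => wedgeVec (K₀ t) (K t)) := by
  rw [isInvariantOn_vec_iff] at h₀ hK
  refine isInvariantOn_skew_iff.2 ⟨fun i j => ((h₀.1 i).mul (hK.1 j)).sub ((hK.1 i).mul (h₀.1 j)),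
    fun p hp i j => ?_, fun p hp i j => ?_⟩
  · simp only [wedgeVec]; ring
  · have d₀ := fun i => (h₀.1 i).differentiableAt hΩ hp
    have d := fun i => (hK.1 i).differentiableAt hΩ hp
    simp only [wedgeVec]
    rw [advScalar_sub (F := fun t x => K₀ t x i * K t x j) (G := fun t x => K t x i * K₀ t x j)
      (((h₀.1 i).mul (hK.1 j)).differentiableAt hΩ hp)
      (((hK.1 i).mul (h₀.1 j)).differentiableAt hΩ hp), advScalar_mul (d₀ i) (d j),
      advScalar_mul (d i) (d₀ j)]
    simp only [h₀.2 p hp, hK.2 p hp, Fin.sum_univ_three]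
    ring

theorem wedgeSkew_invariant (hΩ : IsOpen Ω) {K₀ : ℝ → Vec → Vec} {K : ℝ → Vec → Ten}
    (h₀ : IsInvariantOn .vec Ω u K₀) (hK : IsInvariantOn .skew Ω u K) :
    IsTriInvariantOn Ω u (fun t => wedgeSkew (K₀ t) (K t)) := by
  rw [isInvariantOn_vec_iff] at h₀
  rw [isInvariantOn_skew_iff] at hK
  have s : ∀ i j k, SmoothOn Ω (fun t x => K₀ t x i * K t x j k) :=
    fun i j k => (h₀.1 i).mul (hK.1 j k)
  refine ⟨smoothOn_tri_iff.2 fun i j k => ((s i j k).add (s j k i)).add (s k i j),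
    fun p hp i j k => ?_, fun p hp => ?_⟩
  · have h := hK.2.1 p hp
    simp only [wedgeSkew]
    constructor <;> rw [h j k, h k i, h i j] <;> ring
  · ext i j k
    have a : ∀ i j k, advScalar u (fun t x => K₀ t x i * K t x j k) p.1 p.2 =
        K₀ p.1 p.2 i * (∑ l, K p.1 p.2 l k * pd l (fun y => u p.1 y j) p.2 +
        ∑ l, K p.1 p.2 j l * pd l (fun y => u p.1 y k) p.2) +
        (∑ l, K₀ p.1 p.2 l * pd l (fun y => u p.1 y i) p.2) * K p.1 p.2 j k := fun i j k => by
      rw [advScalar_mul ((h₀.1 i).differentiableAt hΩ hp) ((hK.1 j k).differentiableAt hΩ hp),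
        h₀.2 p hp, hK.2.2 p hp]
    simp only [advTri, wedgeSkew, Pi.zero_apply]
    rw [advScalar_add (F := fun t x => K₀ t x i * K t x j k + K₀ t x j * K t x k i)
      (G := fun t x => K₀ t x k * K t x i j)
      (((s i j k).add (s j k i)).differentiableAt hΩ hp) ((s k i j).differentiableAt hΩ hp),
      advScalar_add (F := fun t x => K₀ t x i * K t x j k) (G := fun t x => K₀ t x j * K t x k i)
      ((s i j k).differentiableAt hΩ hp) ((s j k i).differentiableAt hΩ hp), a, a, a]
    simp only [Fin.sum_univ_three]
    ring

end Invariants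

end

section

/-! ### Cross products and divergences of invariants -/

section Densitized

variable {Ω : Set (ℝ × Vec)} {u : ℝ → Vec → Vec} {ρ : ℝ → Vec → ℝ} {p : ℝ × Vec}

theorem fin_three_cases (i : Fin 3) : i = 0 ∨ i = 1 ∨ i = 2 := by revert i; decide

theorem eps_eq_zero_of_eq_left (i k : Fin 3) : eps i i k = 0 := by simp [eps]
theorem eps_eq_zero_of_eq_right (i k : Fin 3) : eps i k k = 0 := by simp [eps]
theorem eps_eq_zero_of_eq_outer (i k : Fin 3) : eps i k i = 0 := by simp [eps]

theorem eps_zero_two_one : eps 0 2 1 = -1 := by norm_num [eps]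
theorem eps_one_zero_two : eps 1 0 2 = -1 := by norm_num [eps]
theorem eps_one_two_zero : eps 1 2 0 = 1 := by norm_num [eps]
theorem eps_two_zero_one : eps 2 0 1 = 1 := by norm_num [eps]
theorem eps_two_one_zero : eps 2 1 0 = -1 := by norm_num [eps]

theorem crossVec_apply (ρ : Vec → ℝ) (K₀ : Vec → Ten) (K : Vec → Vec) (x : Vec) :
    crossVec ρ K₀ K x = ρ x * ((K₀ x 1 2 - K₀ x 2 1) * K x 0 + (K₀ x 2 0 - K₀ x 0 2) * K x 1 +
      (K₀ x 0 1 - K₀ x 1 0) * K x 2) := by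
  simp only [crossVec, Fin.sum_univ_three, eps_eq_zero_of_eq_left, eps_eq_zero_of_eq_right,
    eps_eq_zero_of_eq_outer, eps_zero_one_two, eps_zero_two_one, eps_one_zero_two,
    eps_one_two_zero, eps_two_zero_one, eps_two_one_zero]
  ring

theorem crossSkew_apply (ρ : Vec → ℝ) (K₀ K : Vec → Ten) (x : Vec) (i : Fin 3) :
    crossSkew ρ K₀ K x i = ρ x * (K₀ x i 0 * (K x 1 2 - K x 2 1) + K₀ x i 1 * (K x 2 0 - K x 0 2) +
      K₀ x i 2 * (K x 0 1 - K x 1 0)) := by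
  simp only [crossSkew, Fin.sum_univ_three, eps_eq_zero_of_eq_left, eps_eq_zero_of_eq_right,
    eps_eq_zero_of_eq_outer, eps_zero_one_two, eps_zero_two_one, eps_one_zero_two,
    eps_one_two_zero, eps_two_zero_one, eps_two_one_zero]
  ring

theorem gradVol_apply (ρ : Vec → ℝ) (K : Vec → ℝ) (x : Vec) :
    gradVol ρ K x = ![![0, 1 / ρ x * pd 2 K x, - (1 / ρ x * pd 1 K x)],
      ![- (1 / ρ x * pd 2 K x), 0, 1 / ρ x * pd 0 K x],
      ![1 / ρ x * pd 1 K x, - (1 / ρ x * pd 0 K x), 0]] := by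
  funext i j
  obtain rfl | rfl | rfl := fin_three_cases i <;> obtain rfl | rfl | rfl := fin_three_cases j <;>
  simp [gradVol, volTensor, Fin.sum_univ_three, eps_eq_zero_of_eq_left, eps_eq_zero_of_eq_right,
    eps_eq_zero_of_eq_outer, eps_zero_one_two, eps_zero_two_one, eps_one_zero_two,
    eps_one_two_zero, eps_two_zero_one, eps_two_one_zero]

theorem crossVec_invariant (hΩ : IsOpen Ω) (hf : IsFlowOn Ω u ρ) {K₀ : ℝ → Vec → Ten}
    {K : ℝ → Vec → Vec} (h₀ : IsInvariantOn .skew Ω u K₀) (hK : IsInvariantOn .vec Ω u K) :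
    IsInvariantOn .scalar Ω u (fun t => crossVec (ρ t) (K₀ t) (K t)) := by
  rw [isInvariantOn_skew_iff] at h₀
  rw [isInvariantOn_vec_iff] at hK
  obtain ⟨s₀, sk₀, a₀⟩ := h₀
  obtain ⟨s, a⟩ := hK
  have sρ : SmoothOn Ω ρ := hf.smooth_density
  have st : ∀ i j k, SmoothOn Ω (fun t x => (K₀ t x i j - K₀ t x j i) * K t x k) :=
    fun i j k => ((s₀ i j).sub (s₀ j i)).mul (s k)
  have ss : SmoothOn Ω (fun t x => (K₀ t x 1 2 - K₀ t x 2 1) * K t x 0 +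
      (K₀ t x 2 0 - K₀ t x 0 2) * K t x 1 + (K₀ t x 0 1 - K₀ t x 1 0) * K t x 2) :=
    ((st 1 2 0).add (st 2 0 1)).add (st 0 1 2)
  have e : (fun t => crossVec (ρ t) (K₀ t) (K t)) = fun t x =>
      ρ t x * ((K₀ t x 1 2 - K₀ t x 2 1) * K t x 0 + (K₀ t x 2 0 - K₀ t x 0 2) * K t x 1 +
      (K₀ t x 0 1 - K₀ t x 1 0) * K t x 2) := by
    funext t x; exact crossVec_apply _ _ _ _
  rw [e, isInvariantOn_scalar_iff]
  refine ⟨sρ.mul ss, fun p hp => ?_⟩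
  have ast : ∀ i j k, advScalar u (fun t x => (K₀ t x i j - K₀ t x j i) * K t x k) p.1 p.2 =
      (K₀ p.1 p.2 i j - K₀ p.1 p.2 j i) * advScalar u (fun t x => K t x k) p.1 p.2 +
      (advScalar u (fun t x => K₀ t x i j) p.1 p.2 - advScalar u (fun t x => K₀ t x j i) p.1 p.2) *
      K p.1 p.2 k := fun i j k => by
    rw [advScalar_mul (F := fun t x => K₀ t x i j - K₀ t x j i) (G := fun t x => K t x k)
      (((s₀ i j).sub (s₀ j i)).differentiableAt hΩ hp) ((s k).differentiableAt hΩ hp),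
      advScalar_sub ((s₀ i j).differentiableAt hΩ hp) ((s₀ j i).differentiableAt hΩ hp)]
  rw [advScalar_mul (sρ.differentiableAt hΩ hp) (ss.differentiableAt hΩ hp),
    advScalar_add (((st 1 2 0).add (st 2 0 1)).differentiableAt hΩ hp)
      ((st 0 1 2).differentiableAt hΩ hp),
    advScalar_add ((st 1 2 0).differentiableAt hΩ hp) ((st 2 0 1).differentiableAt hΩ hp),
    ast, ast, ast, hf.advScalar_density hΩ hp]
  simp only [a₀ p hp, a p hp, Fin.sum_univ_three]
  have k := sk₀ p hp
  have z0 : K₀ p.1 p.2 0 0 = 0 := by linarith [k 0 0]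
  have z1 : K₀ p.1 p.2 1 1 = 0 := by linarith [k 1 1]
  have z2 : K₀ p.1 p.2 2 2 = 0 := by linarith [k 2 2]
  rw [k 1 0, k 2 0, k 2 1, z0, z1, z2]
  ring

theorem crossSkew_invariant (hΩ : IsOpen Ω) (hf : IsFlowOn Ω u ρ) {K₀ K : ℝ → Vec → Ten}
    (h₀ : IsInvariantOn .skew Ω u K₀) (hK : IsInvariantOn .skew Ω u K) :
    IsInvariantOn .vec Ω u (fun t => crossSkew (ρ t) (K₀ t) (K t)) := by
  rw [isInvariantOn_skew_iff] at h₀ hK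
  obtain ⟨s₀, sk₀, a₀⟩ := h₀
  obtain ⟨s, sk, a⟩ := hK
  have sρ : SmoothOn Ω ρ := hf.smooth_density
  have st : ∀ i l j k, SmoothOn Ω (fun t x => K₀ t x i l * (K t x j k - K t x k j)) :=
    fun i l j k => (s₀ i l).mul ((s j k).sub (s k j))
  have ss : ∀ i, SmoothOn Ω (fun t x => K₀ t x i 0 * (K t x 1 2 - K t x 2 1) +
      K₀ t x i 1 * (K t x 2 0 - K t x 0 2) + K₀ t x i 2 * (K t x 0 1 - K t x 1 0)) :=
    fun i => ((st i 0 1 2).add (st i 1 2 0)).add (st i 2 0 1)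
  have e : ∀ i, (fun t x => crossSkew (ρ t) (K₀ t) (K t) x i) = fun t x =>
      ρ t x * (K₀ t x i 0 * (K t x 1 2 - K t x 2 1) + K₀ t x i 1 * (K t x 2 0 - K t x 0 2) +
      K₀ t x i 2 * (K t x 0 1 - K t x 1 0)) := by
    intro i; funext t x; exact crossSkew_apply _ _ _ _ _
  rw [isInvariantOn_vec_iff]
  refine ⟨fun i => (e i) ▸ (sρ.mul (ss i)), fun p hp i => ?_⟩
  have ast : ∀ i l j k, advScalar u (fun t x => K₀ t x i l * (K t x j k - K t x k j)) p.1 p.2 =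
      K₀ p.1 p.2 i l * (advScalar u (fun t x => K t x j k) p.1 p.2 -
        advScalar u (fun t x => K t x k j) p.1 p.2) +
      advScalar u (fun t x => K₀ t x i l) p.1 p.2 * (K p.1 p.2 j k - K p.1 p.2 k j) :=
    fun i l j k => by
    rw [advScalar_mul (F := fun t x => K₀ t x i l) (G := fun t x => K t x j k - K t x k j)
      ((s₀ i l).differentiableAt hΩ hp) (((s j k).sub (s k j)).differentiableAt hΩ hp),
      advScalar_sub ((s j k).differentiableAt hΩ hp) ((s k j).differentiableAt hΩ hp)]
  rw [e i, advScalar_mul (sρ.differentiableAt hΩ hp) ((ss i).differentiableAt hΩ hp),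
    advScalar_add (((st i 0 1 2).add (st i 1 2 0)).differentiableAt hΩ hp)
      ((st i 2 0 1).differentiableAt hΩ hp),
    advScalar_add ((st i 0 1 2).differentiableAt hΩ hp) ((st i 1 2 0).differentiableAt hΩ hp),
    ast, ast, ast, hf.advScalar_density hΩ hp]
  simp only [a₀ p hp, a p hp, crossSkew_apply, Fin.sum_univ_three]
  have k := sk p hp
  have z0 : K p.1 p.2 0 0 = 0 := by linarith [k 0 0]
  have z1 : K p.1 p.2 1 1 = 0 := by linarith [k 1 1]
  have z2 : K p.1 p.2 2 2 = 0 := by linarith [k 2 2]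
  rw [k 1 0, k 2 0, k 2 1, z0, z1, z2]
  ring

/-- Differentiation commutes with the divergence of the velocity. -/
theorem pd_sum_pd (hΩ : IsOpen Ω) (hu : ∀ j, SmoothOn Ω (fun t x => u t x j)) (hp : p ∈ Ω)
    (i : Fin 3) : pd i (fun y => ∑ j, pd j (fun y => u p.1 y j) y) p.2 =
      ∑ j, pd j (fun y => pd i (fun y => u p.1 y j) y) p.2 := by
  rw [pd_sum _ fun j _ => ((hu j).pd hΩ j).slice hΩ hp]
  exact Finset.sum_congr rfl fun j _ => pd_pd_comm (hu j) hΩ hp i j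

theorem divVec_invariant (hΩ : IsOpen Ω) (hf : IsFlowOn Ω u ρ) {K : ℝ → Vec → Vec}
    (hK : IsInvariantOn .vec Ω u K) :
    IsInvariantOn .scalar Ω u (fun t => divVec (ρ t) (K t)) := by
  rw [isInvariantOn_vec_iff] at hK
  obtain ⟨s, a⟩ := hK
  have sρ : SmoothOn Ω ρ := hf.smooth_density
  have hu := hf.smooth_u
  have hinv : SmoothOn Ω (fun t x => 1 / ρ t x) := SmoothOn.inv hf.smooth_density hf.density_ne_zero
  have sm : ∀ i, SmoothOn Ω (fun t x => ρ t x * K t x i) := fun i => sρ.mul (s i)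
  have sd : SmoothOn Ω (fun t x => ∑ j, pd j (fun y => u t y j) x) :=
    SmoothOn.sum _ fun j _ => (hu j).pd hΩ j
  have am : ∀ i, ∀ p ∈ Ω, advScalar u (fun t x => ρ t x * K t x i) p.1 p.2 =
      ∑ j, ρ p.1 p.2 * K p.1 p.2 j * pd j (fun y => u p.1 y i) p.2 -
        ρ p.1 p.2 * K p.1 p.2 i * ∑ j, pd j (fun y => u p.1 y j) p.2 := fun i p hp => by
    rw [advScalar_mul (sρ.differentiableAt hΩ hp) ((s i).differentiableAt hΩ hp), a p hp,
      hf.advScalar_density hΩ hp]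
    simp only [Fin.sum_univ_three]; ring
  rw [isInvariantOn_scalar_iff]
  have ssum : SmoothOn Ω (fun t x => ∑ i, pd i (fun y => ρ t y * K t y i) x) :=
    SmoothOn.sum _ fun i _ => (sm i).pd hΩ i
  refine ⟨hinv.mul ssum, fun p hp => ?_⟩
  have apm : ∀ i, advScalar u (fun t => pd i (fun y => ρ t y * K t y i)) p.1 p.2 =
      ∑ j, (ρ p.1 p.2 * K p.1 p.2 j * pd i (fun y => pd j (fun y => u p.1 y i) y) p.2 +
        pd i (fun y => ρ p.1 y * K p.1 y j) p.2 * pd j (fun y => u p.1 y i) p.2) -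
      (ρ p.1 p.2 * K p.1 p.2 i * (∑ j, pd j (fun y => pd i (fun y => u p.1 y j) y) p.2) +
        pd i (fun y => ρ p.1 y * K p.1 y i) p.2 * ∑ j, pd j (fun y => u p.1 y j) p.2) -
      ∑ j, pd i (fun y => u p.1 y j) p.2 * pd j (fun y => ρ p.1 y * K p.1 y i) p.2 := fun i => by
    rw [advScalar_pd (F := fun t y => ρ t y * K t y i) (sm i) hΩ hu hp,
      pd_congr_of_isOpen (G := fun t x => ∑ j, ρ t x * K t x j * pd j (fun y => u t y i) x -
        ρ t x * K t x i * ∑ j, pd j (fun y => u t y j) x) hΩ (am i) hp,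
      pd_sub (DifferentiableAt.fun_sum fun j _ => ((sm j).mul ((hu i).pd hΩ j)).slice hΩ hp)
        (((sm i).mul sd).slice hΩ hp),
      pd_sum _ fun j _ => ((sm j).mul ((hu i).pd hΩ j)).slice hΩ hp,
      pd_mul ((sm i).slice hΩ hp) (sd.slice hΩ hp), pd_sum_pd hΩ hu hp]
    congr 2
    exact Finset.sum_congr rfl fun j _ => pd_mul ((sm j).slice hΩ hp) (((hu i).pd hΩ j).slice hΩ hp) i
  have e : (fun t => divVec (ρ t) (K t)) =
      fun t x => 1 / ρ t x * ∑ i, pd i (fun y => ρ t y * K t y i) x := rfl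
  rw [e, advScalar_mul (F := fun t x => 1 / ρ t x)
    (G := fun t x => ∑ i, pd i (fun y => ρ t y * K t y i) x)
    (hinv.differentiableAt hΩ hp) (ssum.differentiableAt hΩ hp),
    hf.advScalar_inv_density hΩ hp,
    advScalar_sum _ fun i _ => ((sm i).pd hΩ i).differentiableAt hΩ hp]
  simp only [apm, Fin.sum_univ_three]
  ring

theorem divSkew_invariant (hΩ : IsOpen Ω) (hf : IsFlowOn Ω u ρ) {K : ℝ → Vec → Ten}
    (hK : IsInvariantOn .skew Ω u K) :
    IsInvariantOn .vec Ω u (fun t => divSkew (ρ t) (K t)) := by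
  rw [isInvariantOn_skew_iff] at hK
  obtain ⟨s, sk, a⟩ := hK
  have sρ : SmoothOn Ω ρ := hf.smooth_density
  have hu := hf.smooth_u
  have hinv : SmoothOn Ω (fun t x => 1 / ρ t x) := SmoothOn.inv hf.smooth_density hf.density_ne_zero
  have sm : ∀ i j, SmoothOn Ω (fun t x => ρ t x * K t x i j) := fun i j => sρ.mul (s i j)
  have sd : SmoothOn Ω (fun t x => ∑ j, pd j (fun y => u t y j) x) :=
    SmoothOn.sum _ fun j _ => (hu j).pd hΩ j
  have am : ∀ j i, ∀ p ∈ Ω, advScalar u (fun t x => ρ t x * K t x j i) p.1 p.2 =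
      ∑ k, ρ p.1 p.2 * K p.1 p.2 k i * pd k (fun y => u p.1 y j) p.2 +
      ∑ k, ρ p.1 p.2 * K p.1 p.2 j k * pd k (fun y => u p.1 y i) p.2 -
        ρ p.1 p.2 * K p.1 p.2 j i * ∑ k, pd k (fun y => u p.1 y k) p.2 := fun j i p hp => by
    rw [advScalar_mul (sρ.differentiableAt hΩ hp) ((s j i).differentiableAt hΩ hp), a p hp,
      hf.advScalar_density hΩ hp]
    simp only [Fin.sum_univ_three]; ring
  have ssum : ∀ i, SmoothOn Ω (fun t x => ∑ j, pd j (fun y => ρ t y * K t y j i) x) :=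
    fun i => SmoothOn.sum _ fun j _ => (sm j i).pd hΩ j
  rw [isInvariantOn_vec_iff]
  refine ⟨fun i => hinv.mul (ssum i), fun p hp i => ?_⟩
  have apm : ∀ j, advScalar u (fun t => pd j (fun y => ρ t y * K t y j i)) p.1 p.2 =
      ∑ k, (ρ p.1 p.2 * K p.1 p.2 k i * pd j (fun y => pd k (fun y => u p.1 y j) y) p.2 +
        pd j (fun y => ρ p.1 y * K p.1 y k i) p.2 * pd k (fun y => u p.1 y j) p.2) +
      ∑ k, (ρ p.1 p.2 * K p.1 p.2 j k * pd j (fun y => pd k (fun y => u p.1 y i) y) p.2 +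
        pd j (fun y => ρ p.1 y * K p.1 y j k) p.2 * pd k (fun y => u p.1 y i) p.2) -
      (ρ p.1 p.2 * K p.1 p.2 j i * (∑ k, pd k (fun y => pd j (fun y => u p.1 y k) y) p.2) +
        pd j (fun y => ρ p.1 y * K p.1 y j i) p.2 * ∑ k, pd k (fun y => u p.1 y k) p.2) -
      ∑ k, pd j (fun y => u p.1 y k) p.2 * pd k (fun y => ρ p.1 y * K p.1 y j i) p.2 := fun j => by
    have d1 : ∀ k ∈ Finset.univ, DifferentiableAt ℝ
        (fun x => ρ p.1 x * K p.1 x k i * pd k (fun y => u p.1 y j) x) p.2 :=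
      fun k _ => ((sm k i).mul ((hu j).pd hΩ k)).slice hΩ hp
    have d2 : ∀ k ∈ Finset.univ, DifferentiableAt ℝ
        (fun x => ρ p.1 x * K p.1 x j k * pd k (fun y => u p.1 y i) x) p.2 :=
      fun k _ => ((sm j k).mul ((hu i).pd hΩ k)).slice hΩ hp
    rw [advScalar_pd (F := fun t y => ρ t y * K t y j i) (sm j i) hΩ hu hp,
      pd_congr_of_isOpen (G := fun t x => ∑ k, ρ t x * K t x k i * pd k (fun y => u t y j) x +
        ∑ k, ρ t x * K t x j k * pd k (fun y => u t y i) x -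
        ρ t x * K t x j i * ∑ k, pd k (fun y => u t y k) x) hΩ (am j i) hp,
      pd_sub ((DifferentiableAt.fun_sum d1).fun_add (DifferentiableAt.fun_sum d2))
        (((sm j i).mul sd).slice hΩ hp),
      pd_add (DifferentiableAt.fun_sum d1) (DifferentiableAt.fun_sum d2), pd_sum _ d1, pd_sum _ d2,
      pd_mul ((sm j i).slice hΩ hp) (sd.slice hΩ hp), pd_sum_pd hΩ hu hp]
    congr 2
    congr 1
    · exact Finset.sum_congr rfl fun k _ =>
        pd_mul ((sm k i).slice hΩ hp) (((hu j).pd hΩ k).slice hΩ hp) j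
    · exact Finset.sum_congr rfl fun k _ =>
        pd_mul ((sm j k).slice hΩ hp) (((hu i).pd hΩ k).slice hΩ hp) j
  have e : (fun t x => divSkew (ρ t) (K t) x i) =
      fun t x => 1 / ρ t x * ∑ j, pd j (fun y => ρ t y * K t y j i) x := rfl
  rw [e, advScalar_mul (F := fun t x => 1 / ρ t x)
    (G := fun t x => ∑ j, pd j (fun y => ρ t y * K t y j i) x)
    (hinv.differentiableAt hΩ hp) ((ssum i).differentiableAt hΩ hp),
    hf.advScalar_inv_density hΩ hp,
    advScalar_sum _ fun j _ => ((sm j i).pd hΩ j).differentiableAt hΩ hp]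
  simp only [apm, divSkew, Fin.sum_univ_three]
  have c := fun j k => pd_pd_comm (hu i) hΩ hp j k
  have k := sk p hp
  have z0 : K p.1 p.2 0 0 = 0 := by linarith [k 0 0]
  have z1 : K p.1 p.2 1 1 = 0 := by linarith [k 1 1]
  have z2 : K p.1 p.2 2 2 = 0 := by linarith [k 2 2]
  rw [c 1 0, c 2 0, c 2 1]
  rw [z0, z1, z2, k 1 0, k 2 0, k 2 1]
  ring

/-- The generating operations map invariants to invariants. -/
theorem generatorsMaterialOn (hΩ : IsOpen Ω) (hf : IsFlowOn Ω u ρ) :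
    GeneratorsMaterialOn Ω u ρ where
  func_advected _ _ _ _ := func_advected
  func _ _ _ _ := func_invariant hΩ
  gradVec _ _ := gradVec_invariant hΩ hf.smooth_u
  gradSkew _ _ := gradSkew_invariant hΩ hf.smooth_u
  volTensor := volTensor_invariant hΩ hf
  gradVol _ := gradVol_invariant hΩ hf
  mulVec_advected _ _ := mulVec_advected
  mulSkew_advected _ _ := mulSkew_advected
  mulVec _ _ := mulVec_invariant hΩ
  mulSkew _ _ := mulSkew_invariant hΩ
  addVec _ _ := addVec_invariant hΩ
  addSkew _ _ := addSkew_invariant hΩ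
  wedgeVec _ _ := wedgeVec_invariant hΩ
  wedgeSkew _ _ := wedgeSkew_invariant hΩ
  crossVec _ _ := crossVec_invariant hΩ hf
  crossSkew _ _ := crossSkew_invariant hΩ hf
  divVec _ := divVec_invariant hΩ hf
  divSkew _ := divSkew_invariant hΩ hf

end Densitized

end

section

/-! ### Push-forward of tensors by a matrix -/

/-- The Jacobian matrix `∂ψ^i/∂x^j`. -/
noncomputable def jac (ψ : Vec → Vec) (x : Vec) : Matrix (Fin 3) (Fin 3) ℝ :=
  Matrix.of fun i j => pd j (fun y => ψ y i) x

/-- The action `v^i ↦ M^i_j v^j` of a matrix on vectors. -/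
def pushVec (M : Matrix (Fin 3) (Fin 3) ℝ) (v : Vec) : Vec := M.mulVec v

/-- The action `A^{ij} ↦ M^i_k M^j_l A^{kl}` of a matrix on tensors of rank two. -/
def pushSkew (M : Matrix (Fin 3) (Fin 3) ℝ) (A : Ten) : Ten :=
  fun i j => ∑ k, ∑ l, M i k * M j l * A k l

/-- The natural action of a matrix on contravariant tensors of each type. -/
def Kind.push : (κ : Kind) → Matrix (Fin 3) (Fin 3) ℝ → κ.Val → κ.Val
  | .scalar, _ => fun s => s
  | .vec, M => pushVec M
  | .skew, M => pushSkew M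

/-- The natural action of a matrix on input values. -/
def pushInputs {a b c : ℕ} (M : Matrix (Fin 3) (Fin 3) ℝ) (D : Inputs a b c) : Inputs a b c :=
  (D.1, fun i => pushVec M (D.2.1 i), fun i => pushSkew M (D.2.2 i))

theorem pushVec_apply (M : Matrix (Fin 3) (Fin 3) ℝ) (v : Vec) (i : Fin 3) :
    pushVec M v i = ∑ j, M i j * v j := rfl

theorem pushSkew_eq_mul (M : Matrix (Fin 3) (Fin 3) ℝ) (A : Ten) :
    Matrix.of (pushSkew M A) = M * Matrix.of A * M.transpose := by
  ext i j
  simp only [pushSkew, Matrix.mul_apply, Matrix.transpose_apply, Matrix.of_apply, Finset.sum_mul]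
  rw [Finset.sum_comm]
  exact Finset.sum_congr rfl fun k _ => Finset.sum_congr rfl fun l _ => by ring

theorem pushVec_one (v : Vec) : pushVec 1 v = v := Matrix.one_mulVec v

theorem pushVec_mul (M N : Matrix (Fin 3) (Fin 3) ℝ) (v : Vec) :
    pushVec (M * N) v = pushVec M (pushVec N v) := (Matrix.mulVec_mulVec v M N).symm

theorem pushSkew_one (A : Ten) : pushSkew 1 A = A := by
  apply Matrix.of.injective
  rw [pushSkew_eq_mul, Matrix.one_mul, Matrix.transpose_one, Matrix.mul_one]

theorem pushSkew_mul (M N : Matrix (Fin 3) (Fin 3) ℝ) (A : Ten) :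
    pushSkew (M * N) A = pushSkew M (pushSkew N A) := by
  apply Matrix.of.injective
  simp only [pushSkew_eq_mul, Matrix.transpose_mul, Matrix.mul_assoc]

theorem Kind.push_one (κ : Kind) (v : κ.Val) : κ.push 1 v = v := by
  cases κ
  · rfl
  · exact pushVec_one v
  · exact pushSkew_one v

theorem Kind.push_mul (κ : Kind) (M N : Matrix (Fin 3) (Fin 3) ℝ) (v : κ.Val) :
    κ.push (M * N) v = κ.push M (κ.push N v) := by
  cases κ
  · rfl
  · exact pushVec_mul M N v
  · exact pushSkew_mul M N v

theorem pushSkew_isSkew (M : Matrix (Fin 3) (Fin 3) ℝ) {A : Ten} (hA : IsSkew A) :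
    IsSkew (pushSkew M A) := by
  intro i j
  rw [pushSkew, pushSkew, Finset.sum_comm, ← Finset.sum_neg_distrib]
  refine Finset.sum_congr rfl fun k _ => ?_
  rw [← Finset.sum_neg_distrib]
  refine Finset.sum_congr rfl fun l _ => ?_
  rw [hA l k]; ring

theorem pushVec_zero (M : Matrix (Fin 3) (Fin 3) ℝ) : pushVec M 0 = 0 := Matrix.mulVec_zero M

theorem pushSkew_zero (M : Matrix (Fin 3) (Fin 3) ℝ) : pushSkew M 0 = 0 := by
  funext i j; simp [pushSkew]

theorem pushInputs_one {a b c : ℕ} (D : Inputs a b c) : pushInputs 1 D = D := by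
  simp [pushInputs, pushVec_one, pushSkew_one]

theorem pushInputs_mul {a b c : ℕ} (M N : Matrix (Fin 3) (Fin 3) ℝ) (D : Inputs a b c) :
    pushInputs (M * N) D = pushInputs M (pushInputs N D) := by
  simp [pushInputs, pushVec_mul, pushSkew_mul]

theorem jac_apply (ψ : Vec → Vec) (x : Vec) (i j : Fin 3) :
    jac ψ x i j = pd j (fun y => ψ y i) x := rfl

theorem pd_comp {ψ : Vec → Vec} {g : Vec → ℝ} {x : Vec} (hg : DifferentiableAt ℝ g (ψ x))
    (hψ : DifferentiableAt ℝ ψ x) (j : Fin 3) :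
    pd j (fun y => g (ψ y)) x = ∑ i, pd i g (ψ x) * jac ψ x i j := by
  have h : fderiv ℝ (fun y => g (ψ y)) x = (fderiv ℝ g (ψ x)).comp (fderiv ℝ ψ x) :=
    fderiv_comp x hg hψ
  rw [pd, h, ContinuousLinearMap.comp_apply, fderiv_eq_sum_pd]
  refine Finset.sum_congr rfl fun i _ => ?_
  rw [mul_comm, jac_apply, pd, pd, fderiv_apply hψ]
  rfl

theorem jac_comp {f g : Vec → Vec} {x : Vec} (hf : DifferentiableAt ℝ f (g x))
    (hg : DifferentiableAt ℝ g x) : jac (fun y => f (g y)) x = jac f (g x) * jac g x := by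
  ext i j
  rw [jac_apply, Matrix.mul_apply]
  exact pd_comp (g := fun z => f z i) (differentiableAt_pi.1 hf i) hg j

theorem jac_id (x : Vec) : jac (fun y => y) x = 1 := by
  ext i j
  rw [jac_apply, pd, fderiv_apply (Φ := fun y : Vec => y) differentiableAt_id]
  simp [Matrix.one_apply, Pi.single_apply]

theorem jac_congr {f g : Vec → Vec} {x : Vec} (h : f =ᶠ[𝓝 x] g) : jac f x = jac g x := by
  ext i j
  exact pd_congr (h.mono fun y hy => by rw [hy]) j

theorem fderiv_eq_jac_mulVec {ψ : Vec → Vec} {x : Vec} (hψ : DifferentiableAt ℝ ψ x) (v : Vec) :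
    fderiv ℝ ψ x v = (jac ψ x).mulVec v := by
  ext i
  have : fderiv ℝ ψ x v i = fderiv ℝ (fun y => ψ y i) x v := by
    rw [fderiv_apply hψ]; rfl
  rw [this, fderiv_eq_sum_pd]
  exact Finset.sum_congr rfl fun j _ => mul_comm _ _

/-! ### Isotopies of space and the flows that they generate -/

/-- A smooth family of diffeomorphisms of space, with its family of inverses. -/
structure Isotopy where
  toFun : ℝ → Vec → Vec
  inv : ℝ → Vec → Vec
  smooth : ContDiff ℝ ∞ (fun q : ℝ × Vec => toFun q.1 q.2)
  smooth_inv : ContDiff ℝ ∞ (fun q : ℝ × Vec => inv q.1 q.2)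
  left_inv : ∀ t x, inv t (toFun t x) = x
  right_inv : ∀ t x, toFun t (inv t x) = x

theorem SmoothOn.comp_right {F : ℝ → Vec → ℝ} (hF : SmoothOn univ F) {X : ℝ → Vec → Vec}
    (hX : ContDiff ℝ ∞ (fun q : ℝ × Vec => X q.1 q.2)) : SmoothOn univ (fun t x => F t (X t x)) :=
  ContDiff.contDiffOn ((contDiffOn_univ.1 hF).comp (contDiff_fst.prodMk hX))

theorem SmoothOn.deriv_time {Ω : Set (ℝ × Vec)} {F : ℝ → Vec → ℝ} (hF : SmoothOn Ω F)
    (hΩ : IsOpen Ω) : SmoothOn Ω (fun t x => deriv (fun s => F s x) t) :=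
  (hF.fderiv_apply hΩ (1, 0)).congr fun _ hp => deriv_slice (hF.differentiableAt hΩ hp)

theorem advScalar_alternating_sum {u : ℝ → Vec → Vec} {A B C D E F : ℝ → Vec → ℝ}
    (hA : SmoothOn univ A) (hB : SmoothOn univ B) (hC : SmoothOn univ C) (hD : SmoothOn univ D)
    (hE : SmoothOn univ E) (hF : SmoothOn univ F) (p : ℝ × Vec) :
    advScalar u (fun t x => A t x - B t x - C t x + D t x + E t x - F t x) p.1 p.2 =
      advScalar u A p.1 p.2 - advScalar u B p.1 p.2 - advScalar u C p.1 p.2 +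
      advScalar u D p.1 p.2 + advScalar u E p.1 p.2 - advScalar u F p.1 p.2 := by
  have dd := fun {F : ℝ → Vec → ℝ} (h : SmoothOn univ F) =>
    h.differentiableAt isOpen_univ (mem_univ p)
  have h1 := hA.sub hB
  have h2 := h1.sub hC
  have h3 := h2.add hD
  have h4 := h3.add hE
  rw [advScalar_sub (dd h4) (dd hF), advScalar_add (dd h3) (dd hE), advScalar_add (dd h2) (dd hD),
    advScalar_sub (dd h1) (dd hC), advScalar_sub (dd hA) (dd hB)]

namespace Isotopy

variable (φ : Isotopy)

theorem smoothOn_toFun (i : Fin 3) : SmoothOn univ (fun t x => φ.toFun t x i) :=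
  smoothOn_vec_iff.1 φ.smooth.contDiffOn i

theorem smoothOn_inv (i : Fin 3) : SmoothOn univ (fun t x => φ.inv t x i) :=
  smoothOn_vec_iff.1 φ.smooth_inv.contDiffOn i

theorem smooth_slice (t : ℝ) : ContDiff ℝ ∞ (φ.toFun t) :=
  φ.smooth.comp (contDiff_const.prodMk contDiff_id)

theorem smooth_inv_slice (t : ℝ) : ContDiff ℝ ∞ (φ.inv t) :=
  φ.smooth_inv.comp (contDiff_const.prodMk contDiff_id)

/-- The velocity field whose particle paths are `t ↦ φ t x`. -/
noncomputable def velocity (t : ℝ) (x : Vec) : Vec :=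
  fun i => deriv (fun s => φ.toFun s (φ.inv t x) i) t

theorem smoothOn_velocity (j : Fin 3) : SmoothOn univ (fun t x => φ.velocity t x j) :=
  ((φ.smoothOn_toFun j).deriv_time isOpen_univ).comp_right φ.smooth_inv

/-- The rate of change along a particle path is the advective derivative. -/
theorem hasDerivAt_path {F : ℝ → Vec → ℝ} (hF : SmoothOn univ F) (t : ℝ) (x : Vec) :
    HasDerivAt (fun s => F s (φ.toFun s x)) (advScalar φ.velocity F t (φ.toFun t x)) t := by
  have h1 := advScalar_eq_fderiv (u := φ.velocity) (p := (t, φ.toFun t x))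
    (hF.differentiableAt isOpen_univ (mem_univ _))
  have h2 := (hF.differentiableAt isOpen_univ (mem_univ (t, φ.toFun t x))).hasFDerivAt
  have h3 : HasDerivAt (fun s => (s, φ.toFun s x)) (1, φ.velocity t (φ.toFun t x)) t := by
    refine (hasDerivAt_id t).prodMk (hasDerivAt_pi.2 fun i => ?_)
    have h4 : DifferentiableAt ℝ (fun s => φ.toFun s x i) t := by
      have := (contDiff_pi.1 φ.smooth i).comp
        (contDiff_id.prodMk (contDiff_const (c := x)) : ContDiff ℝ ∞ fun s : ℝ => (s, x))
      exact (this.differentiable (by simp)) t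
    have : φ.velocity t (φ.toFun t x) i = deriv (fun s => φ.toFun s x i) t := by
      simp only [velocity, φ.left_inv]
    rw [this]
    exact h4.hasDerivAt
  have h5 := HasFDerivAt.comp_hasDerivAt (f := fun s => (s, φ.toFun s x)) t h2 h3
  change HasDerivAt _ (advScalar φ.velocity F (t, φ.toFun t x).1 (t, φ.toFun t x).2) t
  rw [h1]
  exact h5

/-- The labels of the particles are invariants. -/
theorem advScalar_inv (i : Fin 3) (p : ℝ × Vec) :
    advScalar φ.velocity (fun t x => φ.inv t x i) p.1 p.2 = 0 := by
  have h := φ.hasDerivAt_path (φ.smoothOn_inv i) p.1 (φ.inv p.1 p.2)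
  simp only [φ.left_inv, φ.right_inv] at h
  exact h.unique (hasDerivAt_const p.1 _)

theorem label_invariant (i : Fin 3) :
    IsInvariantOn .scalar univ φ.velocity (fun t x => φ.inv t x i) :=
  isInvariantOn_scalar_iff.2 ⟨φ.smoothOn_inv i, fun p _ => φ.advScalar_inv i p⟩

/-- Functions of the labels are invariants. -/
theorem comp_inv_invariant {f : Vec → ℝ} (hf : ContDiff ℝ ∞ f) :
    IsInvariantOn .scalar univ φ.velocity (fun t x => f (φ.inv t x)) :=
  func_invariant (K := fun i t x => φ.inv t x i) isOpen_univ isOpen_univ hf.contDiffOn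
    φ.label_invariant fun _ _ => mem_univ _

theorem eq_of_invariant {F : ℝ → Vec → ℝ} (hF : IsInvariantOn .scalar univ φ.velocity F)
    (s t : ℝ) (x : Vec) : F s (φ.toFun s x) = F t (φ.toFun t x) := by
  have h := fun r => φ.hasDerivAt_path (F := F) hF.smooth r x
  refine is_const_of_deriv_eq_zero (f := fun s => F s (φ.toFun s x))
    (fun r => (h r).differentiableAt) (fun r => ?_) s t
  rw [(h r).deriv]
  exact hF.advected (r, φ.toFun r x) (mem_univ _)

theorem jac_inv_mul_jac (t : ℝ) (x : Vec) : jac (φ.inv t) (φ.toFun t x) * jac (φ.toFun t) x = 1 := by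
  rw [← jac_comp ((φ.smooth_inv_slice t).differentiable (by simp) _)
    ((φ.smooth_slice t).differentiable (by simp) _)]
  simp only [φ.left_inv]
  exact jac_id x

theorem jac_inv_mul_jac' (t : ℝ) (x : Vec) : jac (φ.inv t) x * jac (φ.toFun t) (φ.inv t x) = 1 := by
  have := φ.jac_inv_mul_jac t (φ.inv t x)
  rwa [φ.right_inv] at this

theorem push_vec_jac_inv (v : Vec → Vec) (t : ℝ) (x : Vec) (i : Fin 3) :
    pushVec (jac (φ.inv t) x) (v x) i = gradVec v (fun y => φ.inv t y i) x := by
  rw [pushVec_apply, gradVec]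
  exact Finset.sum_congr rfl fun j _ => by rw [jac_apply]; ring

theorem push_skew_jac_inv (A : Vec → Ten) (t : ℝ) (x : Vec) (i j : Fin 3) :
    pushSkew (jac (φ.inv t) x) (A x) i j =
      gradVec (gradSkew A fun y => φ.inv t y j) (fun y => φ.inv t y i) x := by
  simp only [pushSkew, gradVec, gradSkew, Finset.sum_mul]
  exact Finset.sum_congr rfl fun k _ => Finset.sum_congr rfl fun l _ => by
    rw [jac_apply, jac_apply]; ring

/-- An invariant is carried along the particle paths by the Jacobian of the flow. -/
theorem push_jac_inv_eq {κ : Kind} {R : ℝ → Vec → κ.Val} (hR : IsInvariantOn κ univ φ.velocity R)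
    (s t : ℝ) (x : Vec) :
    κ.push (jac (φ.inv s) (φ.toFun s x)) (R s (φ.toFun s x)) =
      κ.push (jac (φ.inv t) (φ.toFun t x)) (R t (φ.toFun t x)) := by
  have hl := φ.label_invariant
  cases κ
  · exact φ.eq_of_invariant hR s t x
  · refine funext fun i => ?_
    have h := φ.eq_of_invariant (gradVec_invariant isOpen_univ φ.smoothOn_velocity hR (hl i)) s t x
    exact (φ.push_vec_jac_inv (R s) s _ i).trans (h.trans (φ.push_vec_jac_inv (R t) t _ i).symm)
  · refine funext fun i => funext fun j => ?_
    have h := φ.eq_of_invariant (gradVec_invariant isOpen_univ φ.smoothOn_velocity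
      (gradSkew_invariant isOpen_univ φ.smoothOn_velocity hR (hl j)) (hl i)) s t x
    exact (φ.push_skew_jac_inv (R s) s _ i j).trans
      (h.trans (φ.push_skew_jac_inv (R t) t _ i j).symm)

/-- The density carried by the isotopy. -/
noncomputable def density (ρ : Vec → ℝ) (t : ℝ) (x : Vec) : ℝ :=
  ρ (φ.inv t x) * (jac (φ.inv t) x).det

/-- The inputs carried by the isotopy. -/
noncomputable def inputs {a b c : ℕ} (D : Vec → Inputs a b c) (t : ℝ) (x : Vec) : Inputs a b c :=
  pushInputs (jac (φ.toFun t) (φ.inv t x)) (D (φ.inv t x))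

theorem smoothOn_jac_inv (i j : Fin 3) : SmoothOn univ (fun t x => jac (φ.inv t) x i j) :=
  (φ.smoothOn_inv i).pd isOpen_univ j

theorem smoothOn_jac (i j : Fin 3) : SmoothOn univ (fun t x => jac (φ.toFun t) (φ.inv t x) i j) :=
  ((φ.smoothOn_toFun i).pd isOpen_univ j).comp_right φ.smooth_inv

theorem smoothOn_comp_inv {f : Vec → ℝ} (hf : ContDiff ℝ ∞ f) :
    SmoothOn univ (fun t x => f (φ.inv t x)) :=
  (φ.comp_inv_invariant hf).smooth

theorem push_vec_invariant {v : Vec → Vec} (hv : ContDiff ℝ ∞ v) :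
    IsInvariantOn .vec univ φ.velocity
      (fun t x => pushVec (jac (φ.toFun t) (φ.inv t x)) (v (φ.inv t x))) := by
  have hvc := fun i => contDiff_pi.1 hv i
  set K : ℝ → Vec → Vec :=
    fun t x => pushVec (jac (φ.toFun t) (φ.inv t x)) (v (φ.inv t x)) with hK
  have s : ∀ i, SmoothOn univ (fun t x => K t x i) := fun i =>
    show SmoothOn univ (fun t x => ∑ j, jac (φ.toFun t) (φ.inv t x) i j * v (φ.inv t x) j) from
    SmoothOn.sum _ fun j _ => (φ.smoothOn_jac i j).mul (φ.smoothOn_comp_inv (hvc j))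
  refine ⟨smoothOn_vec_iff.2 s, fun _ _ => trivial, fun p _ => ?_⟩
  suffices h : pushVec (jac (φ.inv p.1) p.2) (advVec φ.velocity K p.1 p.2) = 0 by
    have h2 := pushVec_mul (jac (φ.toFun p.1) (φ.inv p.1 p.2)) (jac (φ.inv p.1) p.2)
      (advVec φ.velocity K p.1 p.2)
    rw [mul_eq_one_comm.1 (φ.jac_inv_mul_jac' p.1 p.2), h, pushVec_one, pushVec_zero] at h2
    exact h2
  refine funext fun i => ?_
  have e : (fun t => gradVec (K t) (fun y => φ.inv t y i)) = fun t x => v (φ.inv t x) i := by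
    funext t x
    rw [← φ.push_vec_jac_inv (K t) t x i]
    have := pushVec_mul (jac (φ.inv t) x) (jac (φ.toFun t) (φ.inv t x)) (v (φ.inv t x))
    rw [φ.jac_inv_mul_jac', pushVec_one] at this
    exact (congrFun this i).symm
  have h := advScalar_gradVec isOpen_univ φ.smoothOn_velocity s (φ.smoothOn_inv i) (mem_univ p)
  rw [e] at h
  have h0 : advScalar φ.velocity (fun t x => v (φ.inv t x) i) p.1 p.2 = 0 :=
    (φ.comp_inv_invariant (hvc i)).advected p (mem_univ p)
  have h1 : gradVec (K p.1) (advScalar φ.velocity (fun t y => φ.inv t y i) p.1) p.2 = 0 := by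
    simp [gradVec, pd_eq_zero_of_isOpen isOpen_univ (fun p _ => φ.advScalar_inv i p) (mem_univ p)]
  rw [h0, h1, add_zero, ← φ.push_vec_jac_inv] at h
  exact h.symm

theorem push_skew_invariant {A : Vec → Ten} (hA : ContDiff ℝ ∞ A) (hs : ∀ x, IsSkew (A x)) :
    IsInvariantOn .skew univ φ.velocity
      (fun t x => pushSkew (jac (φ.toFun t) (φ.inv t x)) (A (φ.inv t x))) := by
  have hAc := fun i j => contDiff_pi.1 (contDiff_pi.1 hA i) j
  set K : ℝ → Vec → Ten :=
    fun t x => pushSkew (jac (φ.toFun t) (φ.inv t x)) (A (φ.inv t x)) with hK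
  have s : ∀ i j, SmoothOn univ (fun t x => K t x i j) := fun i j => by
    have e : (fun t x => K t x i j) = fun t x => ∑ k, ∑ l, jac (φ.toFun t) (φ.inv t x) i k *
      jac (φ.toFun t) (φ.inv t x) j l * A (φ.inv t x) k l := by
      funext t x; rfl
    rw [e]
    exact SmoothOn.sum _ fun k _ => SmoothOn.sum _ fun l _ =>
      ((φ.smoothOn_jac i k).mul (φ.smoothOn_jac j l)).mul (φ.smoothOn_comp_inv (hAc k l))
  refine ⟨smoothOn_ten_iff.2 s, fun p _ => pushSkew_isSkew _ (hs _), fun p _ => ?_⟩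
  suffices h : pushSkew (jac (φ.inv p.1) p.2) (advTen φ.velocity K p.1 p.2) = 0 by
    have h2 := pushSkew_mul (jac (φ.toFun p.1) (φ.inv p.1 p.2)) (jac (φ.inv p.1) p.2)
      (advTen φ.velocity K p.1 p.2)
    rw [mul_eq_one_comm.1 (φ.jac_inv_mul_jac' p.1 p.2), h, pushSkew_one, pushSkew_zero] at h2
    exact h2
  refine funext fun i => funext fun j => ?_
  have e : (fun t => gradVec (gradSkew (K t) fun y => φ.inv t y j) (fun y => φ.inv t y i)) =
      fun t x => A (φ.inv t x) i j := by
    funext t x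
    rw [← φ.push_skew_jac_inv (K t) t x i j]
    have := pushSkew_mul (jac (φ.inv t) x) (jac (φ.toFun t) (φ.inv t x)) (A (φ.inv t x))
    rw [φ.jac_inv_mul_jac', pushSkew_one] at this
    exact (congrFun (congrFun this i) j).symm
  have z : ∀ i, ∀ k, pd k (advScalar φ.velocity (fun t y => φ.inv t y i) p.1) p.2 = 0 := fun i k =>
    pd_eq_zero_of_isOpen isOpen_univ (fun p _ => φ.advScalar_inv i p) (mem_univ p) k
  have h := advScalar_gradVec isOpen_univ φ.smoothOn_velocity
    (smoothOn_gradSkew isOpen_univ s (φ.smoothOn_inv j)) (φ.smoothOn_inv i) (mem_univ p)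
  rw [e] at h
  have h0 : advScalar φ.velocity (fun t x => A (φ.inv t x) i j) p.1 p.2 = 0 :=
    (φ.comp_inv_invariant (hAc i j)).advected p (mem_univ p)
  have h2 : advVec φ.velocity (fun t => gradSkew (K t) fun y => φ.inv t y j) p.1 p.2 =
      gradSkew (advTen φ.velocity K p.1) (fun y => φ.inv p.1 y j) p.2 := by
    rw [advVec_gradSkew isOpen_univ φ.smoothOn_velocity s (φ.smoothOn_inv j) (mem_univ p)]
    have : gradSkew (K p.1) (advScalar φ.velocity (fun t y => φ.inv t y j) p.1) p.2 = 0 := by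
      funext l; simp [gradSkew, z]
    rw [this, add_zero]
  rw [h0] at h
  refine (φ.push_skew_jac_inv (advTen φ.velocity K p.1) p.1 p.2 i j).trans ?_
  change _ = (0 : ℝ)
  rw [h]
  simp only [gradVec, z, mul_zero, Finset.sum_const_zero, add_zero, h2]

theorem advScalar_det_jac_inv (p : ℝ × Vec) :
    advScalar φ.velocity (fun t x => (jac (φ.inv t) x).det) p.1 p.2 =
      - ((jac (φ.inv p.1) p.2).det * ∑ j, pd j (fun y => φ.velocity p.1 y j) p.2) := by
  have s := φ.smoothOn_jac_inv
  have d3 : ∀ i j k l m n, SmoothOn univ (fun t x => jac (φ.inv t) x i j * jac (φ.inv t) x k l *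
      jac (φ.inv t) x m n) := fun i j k l m n => ((s i j).mul (s k l)).mul (s m n)
  have dd := fun {F : ℝ → Vec → ℝ} (h : SmoothOn univ F) =>
    h.differentiableAt isOpen_univ (mem_univ p)
  have a : ∀ i j, advScalar φ.velocity (fun t x => jac (φ.inv t) x i j) p.1 p.2 =
      - ∑ k, pd j (fun y => φ.velocity p.1 y k) p.2 * jac (φ.inv p.1) p.2 i k := fun i j => by
    have := advScalar_pd (φ.smoothOn_inv i) isOpen_univ φ.smoothOn_velocity (mem_univ p) j
    rw [pd_eq_zero_of_isOpen isOpen_univ (fun p _ => φ.advScalar_inv i p) (mem_univ p),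
      zero_sub] at this
    exact this
  have a3 : ∀ i j k l m n, advScalar φ.velocity (fun t x => jac (φ.inv t) x i j *
      jac (φ.inv t) x k l * jac (φ.inv t) x m n) p.1 p.2 = _ := fun i j k l m n => by
    rw [advScalar_mul (F := fun t x => jac (φ.inv t) x i j * jac (φ.inv t) x k l)
      (G := fun t x => jac (φ.inv t) x m n) (dd ((s i j).mul (s k l))) (dd (s m n)),
      advScalar_mul (F := fun t x => jac (φ.inv t) x i j) (G := fun t x => jac (φ.inv t) x k l)
        (dd (s i j)) (dd (s k l)), a, a, a]
  simp only [Matrix.det_fin_three]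
  rw [advScalar_alternating_sum (d3 0 0 1 1 2 2) (d3 0 0 1 2 2 1) (d3 0 1 1 0 2 2)
    (d3 0 1 1 2 2 0) (d3 0 2 1 0 2 1) (d3 0 2 1 1 2 0) p]
  simp only [a3, Fin.sum_univ_three]
  ring

theorem det_jac_inv_pos {t₀ : ℝ} (h₀ : ∀ x, φ.toFun t₀ x = x) (t : ℝ) (x : Vec) :
    0 < (jac (φ.inv t) x).det := by
  by_contra hneg
  have hc : Continuous fun s => (jac (φ.inv s) x).det := by
    refine Continuous.matrix_det (continuous_matrix fun i j => ?_)
    have h : ContDiff ℝ ∞ (fun q : ℝ × Vec => jac (φ.inv q.1) q.2 i j) :=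
      contDiffOn_univ.1 (φ.smoothOn_jac_inv i j)
    exact h.continuous.comp (Continuous.prodMk_left x)
  have h1 : (jac (φ.inv t₀) x).det = 1 := by
    have : φ.inv t₀ = fun y => y := by
      funext y
      have := φ.left_inv t₀ y
      rwa [h₀] at this
    rw [this, jac_id, Matrix.det_one]
  obtain ⟨s, hs⟩ := mem_range_of_exists_le_of_exists_ge hc ⟨t, not_lt.1 hneg⟩
    ⟨t₀, h1 ▸ zero_le_one⟩
  have h2 := congrArg Matrix.det (φ.jac_inv_mul_jac' s x)
  rw [Matrix.det_mul, Matrix.det_one] at h2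
  simp only at hs
  rw [hs, zero_mul] at h2
  exact zero_ne_one h2

theorem isFlowOn {t₀ : ℝ} (h₀ : ∀ x, φ.toFun t₀ x = x) {ρ : Vec → ℝ} (hρ : ContDiff ℝ ∞ ρ)
    (hpos : ∀ y, 0 < ρ y) : IsFlowOn univ φ.velocity (φ.density ρ) := by
  have sdet : SmoothOn univ (fun t x => (jac (φ.inv t) x).det) := by
    simp only [Matrix.det_fin_three]
    have s := φ.smoothOn_jac_inv
    have d3 : ∀ i j k l m n, SmoothOn univ (fun t x => jac (φ.inv t) x i j * jac (φ.inv t) x k l *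
      jac (φ.inv t) x m n) := fun i j k l m n => ((s i j).mul (s k l)).mul (s m n)
    exact (((((d3 0 0 1 1 2 2).sub (d3 0 0 1 2 2 1)).sub (d3 0 1 1 0 2 2)).add
      (d3 0 1 1 2 2 0)).add (d3 0 2 1 0 2 1)).sub (d3 0 2 1 1 2 0)
  have sρ : SmoothOn univ (φ.density ρ) := (φ.smoothOn_comp_inv hρ).mul sdet
  refine ⟨smoothOn_vec_iff.2 φ.smoothOn_velocity, sρ,
    fun p _ => mul_pos (hpos _) (φ.det_jac_inv_pos h₀ _ _), fun p hp => ?_⟩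
  have h1 : advScalar φ.velocity (φ.density ρ) p.1 p.2 =
      - (φ.density ρ p.1 p.2 * ∑ j, pd j (fun y => φ.velocity p.1 y j) p.2) := by
    have e : φ.density ρ = fun t x => ρ (φ.inv t x) * (jac (φ.inv t) x).det := rfl
    have h0 : advScalar φ.velocity (fun t x => ρ (φ.inv t x)) p.1 p.2 = 0 :=
      (φ.comp_inv_invariant hρ).advected p hp
    rw [e, advScalar_mul (F := fun t x => ρ (φ.inv t x)) (G := fun t x => (jac (φ.inv t) x).det)
      ((φ.smoothOn_comp_inv hρ).differentiableAt isOpen_univ hp)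
      (sdet.differentiableAt isOpen_univ hp), h0, advScalar_det_jac_inv]
    ring
  have h2 : ∀ j, pd j (fun y => φ.density ρ p.1 y * φ.velocity p.1 y j) p.2 =
      φ.density ρ p.1 p.2 * pd j (fun y => φ.velocity p.1 y j) p.2
      + pd j (φ.density ρ p.1) p.2 * φ.velocity p.1 p.2 j := fun j =>
    pd_mul (sρ.slice isOpen_univ hp) ((φ.smoothOn_velocity j).slice isOpen_univ hp) j
  simp only [h2, Fin.sum_univ_three, advScalar] at h1 ⊢
  linarith

theorem inputsInvariantOn {a b c : ℕ} {D : Vec → Inputs a b c} (hD : SmoothInputs D) :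
    InputsInvariantOn univ φ.velocity (φ.inputs D) := by
  refine ⟨fun i => ?_, fun i => ?_, fun i => ?_⟩
  · exact φ.comp_inv_invariant (f := fun x => (D x).1 i)
      (contDiff_pi.1 (contDiff_fst.comp hD.smooth) i)
  · exact φ.push_vec_invariant (v := fun x => (D x).2.1 i)
      (contDiff_pi.1 (contDiff_fst.comp (contDiff_snd.comp hD.smooth)) i)
  · exact φ.push_skew_invariant (A := fun x => (D x).2.2 i)
      (contDiff_pi.1 (contDiff_snd.comp (contDiff_snd.comp hD.smooth)) i) fun x => hD.skew x i

/-- The value of a material operation is carried along the particle paths. -/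
theorem push_apply_eq {a b c : ℕ} {κ : Kind} {Φ : LocalOperator a b c κ} (hΦ : Φ.IsMaterial)
    {t₀ : ℝ} (h₀ : ∀ x, φ.toFun t₀ x = x) {ρ : Vec → ℝ} (hρ : ContDiff ℝ ∞ ρ)
    (hpos : ∀ y, 0 < ρ y) {D : Vec → Inputs a b c} (hD : SmoothInputs D) (s t : ℝ) (x : Vec) :
    κ.push (jac (φ.inv s) (φ.toFun s x))
      (Φ.apply s (φ.velocity s) (φ.density ρ s) (φ.inputs D s) (φ.toFun s x)) =
    κ.push (jac (φ.inv t) (φ.toFun t x))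
      (Φ.apply t (φ.velocity t) (φ.density ρ t) (φ.inputs D t) (φ.toFun t x)) :=
  φ.push_jac_inv_eq (hΦ _ _ _ (φ.isFlowOn h₀ hρ hpos) (φ.inputsInvariantOn hD)) s t x

/-- At an instant at which the isotopy is the identity, the carried fields are the given ones. -/
theorem push_apply_of_eq_id {a b c : ℕ} {κ : Kind} (Φ : LocalOperator a b c κ) {t : ℝ}
    (h : ∀ x, φ.toFun t x = x) (ρ : Vec → ℝ) (D : Vec → Inputs a b c) (x : Vec) :
    κ.push (jac (φ.inv t) (φ.toFun t x))
      (Φ.apply t (φ.velocity t) (φ.density ρ t) (φ.inputs D t) (φ.toFun t x)) =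
    Φ.apply t (φ.velocity t) ρ D x := by
  have e : φ.toFun t = fun y => y := funext h
  have e' : φ.inv t = fun y => y := by
    funext y
    have := φ.left_inv t y
    rwa [h] at this
  have e1 : φ.density ρ t = ρ := by funext y; simp [density, e', jac_id]
  have e2 : φ.inputs D t = D := by funext y; simp [inputs, e, e', jac_id, pushInputs_one]
  rw [e1, e2, e, e', jac_id, Kind.push_one]

end Isotopy

end

section

/-! ### Construction of isotopies -/

/-- An injective endomorphism of a finite-dimensional space is a linear equivalence. -/
theorem exists_continuousLinearEquiv {E : Type*} [NormedAddCommGroup E] [NormedSpace ℝ E]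
    [FiniteDimensional ℝ E] (L : E →L[ℝ] E) (h : Function.Injective L) :
    ∃ e : E ≃L[ℝ] E, (e : E →L[ℝ] E) = L :=
  ⟨(LinearEquiv.ofInjectiveEndo (L : E →ₗ[ℝ] E) h).toContinuousLinearEquiv, by ext v; rfl⟩

theorem contDiffAt_of_leftInverse {E : Type*} [NormedAddCommGroup E] [NormedSpace ℝ E]
    [FiniteDimensional ℝ E] {f g : E → E} {x : E} (hf : ContDiffAt ℝ ∞ f x)
    (hinj : Function.Injective (fderiv ℝ f x)) (hg : ∀ y, g (f y) = y) :
    ContDiffAt ℝ ∞ g (f x) := by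
  have : CompleteSpace E := FiniteDimensional.complete ℝ E
  obtain ⟨e, he⟩ := exists_continuousLinearEquiv _ hinj
  have hd : HasFDerivAt f (e : E →L[ℝ] E) x := by
    rw [he]; exact (hf.differentiableAt (by simp)).hasFDerivAt
  have h1 := hf.to_localInverse hd (by simp)
  refine h1.congr_of_eventuallyEq ?_
  have hs := hf.hasStrictFDerivAt' hd (by simp)
  filter_upwards [hs.eventually_right_inverse] with y hy
  rw [← hy, hg]
  exact congrArg _ hy.symm

/-- A smooth family of bijective immersions of space is an isotopy. -/
noncomputable def Isotopy.ofBijective (φ : ℝ → Vec → Vec)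
    (hs : ContDiff ℝ ∞ (fun q : ℝ × Vec => φ q.1 q.2)) (hb : ∀ t, Function.Bijective (φ t))
    (hi : ∀ t x v, fderiv ℝ (φ t) x v = 0 → v = 0) : Isotopy where
  toFun := φ
  inv t := Function.surjInv (hb t).2
  smooth := hs
  left_inv t := Function.leftInverse_surjInv (hb t)
  right_inv t := Function.rightInverse_surjInv (hb t).2
  smooth_inv := by
    -- The inverse is read off from that of the map `(t, x) ↦ (t, φ t x)` of space-time.
    set G : ℝ × Vec → ℝ × Vec := fun q => (q.1, φ q.1 q.2)
    set H : ℝ × Vec → ℝ × Vec := fun q => (q.1, Function.surjInv (hb q.1).2 q.2)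
    have hG : ContDiff ℝ ∞ G := contDiff_fst.prodMk hs
    have hHG : ∀ q, H (G q) = q := fun q =>
      Prod.ext rfl (Function.leftInverse_surjInv (hb q.1) q.2)
    have hH : ContDiff ℝ ∞ H := by
      rw [contDiff_iff_contDiffAt]
      intro q
      obtain ⟨r, rfl⟩ : ∃ r, G r = q :=
        ⟨H q, Prod.ext rfl (Function.rightInverse_surjInv (hb q.1).2 q.2)⟩
      refine contDiffAt_of_leftInverse hG.contDiffAt ?_ hHG
      rw [injective_iff_map_eq_zero]
      intro w hw
      have hd : DifferentiableAt ℝ (fun q : ℝ × Vec => φ q.1 q.2) r := hs.differentiable (by simp) r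
      have e : fderiv ℝ G r = (ContinuousLinearMap.fst ℝ ℝ Vec).prod
          (fderiv ℝ (fun q : ℝ × Vec => φ q.1 q.2) r) :=
        (hasFDerivAt_fst.prodMk hd.hasFDerivAt).fderiv
      rw [e] at hw
      obtain ⟨h1, h2⟩ := Prod.mk.inj hw
      have h1 : w.1 = 0 := h1
      have h3 : HasFDerivAt (φ r.1) ((fderiv ℝ (fun q : ℝ × Vec => φ q.1 q.2) r).comp
          (ContinuousLinearMap.inr ℝ ℝ Vec)) r.2 := by
        have h : HasFDerivAt (fun q : ℝ × Vec => φ q.1 q.2) _ ((fun y => (r.1, y)) r.2) :=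
          hd.hasFDerivAt
        exact h.comp r.2 (hasFDerivAt_prodMk_right r.1 r.2)
      refine Prod.ext h1 (hi r.1 r.2 w.2 ?_)
      rw [h3.fderiv]
      have : ((0 : ℝ), w.2) = w := Prod.ext h1.symm rfl
      change fderiv ℝ (fun q : ℝ × Vec => φ q.1 q.2) r ((0 : ℝ), w.2) = 0
      rw [this]
      exact h2
    exact contDiff_snd.comp hH

/-- The isotopy `x ↦ x + τ(t) h(x)` of small displacements. -/
noncomputable def Isotopy.displacement (τ : ℝ → ℝ) (h : Vec → Vec) (C : NNReal)
    (hτ : ContDiff ℝ ∞ τ) (hh : ContDiff ℝ ∞ h) (hC : LipschitzWith C h)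
    (hτC : ∀ t, |τ t| * C < 1) : Isotopy :=
  Isotopy.ofBijective (fun t x => x + τ t • h x)
    (contDiff_snd.add ((hτ.comp contDiff_fst).smul (hh.comp contDiff_snd)))
    (by
      intro t
      have ha : ApproximatesLinearOn (fun x => x + τ t • h x)
          ((ContinuousLinearEquiv.refl ℝ Vec : Vec ≃L[ℝ] Vec) : Vec →L[ℝ] Vec) univ
          (‖τ t‖₊ * C) := by
        intro x _ y _
        have e : x + τ t • h x - (y + τ t • h y) -
            ((ContinuousLinearEquiv.refl ℝ Vec : Vec ≃L[ℝ] Vec) : Vec →L[ℝ] Vec) (x - y) =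
            τ t • (h x - h y) := by
          simp only [ContinuousLinearEquiv.coe_refl, ContinuousLinearMap.id_apply, smul_sub]
          abel
        rw [e, norm_smul, NNReal.coe_mul, coe_nnnorm, mul_assoc]
        have := hC.dist_le_mul x y
        rw [dist_eq_norm, dist_eq_norm] at this
        gcongr
      have hc : Subsingleton Vec ∨ ‖τ t‖₊ * C <
          ‖((ContinuousLinearEquiv.refl ℝ Vec).symm : Vec →L[ℝ] Vec)‖₊⁻¹ := by
        right
        have h1 : ‖((ContinuousLinearEquiv.refl ℝ Vec).symm : Vec →L[ℝ] Vec)‖₊ = 1 := by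
          rw [ContinuousLinearEquiv.refl_symm, ContinuousLinearEquiv.coe_refl]
          exact ContinuousLinearMap.nnnorm_id
        rw [h1, inv_one, ← NNReal.coe_lt_coe]
        simpa using hτC t
      refine ⟨?_, ha.surjective hc⟩
      have := ha.injOn hc
      exact Set.injOn_univ.1 this)
    (by
      intro t x v hv
      have hd : HasFDerivAt (fun x => x + τ t • h x)
          (ContinuousLinearMap.id ℝ Vec + τ t • fderiv ℝ h x) x :=
        (hasFDerivAt_id x).add ((hh.differentiable (by simp) x).hasFDerivAt.const_smul (τ t))
      rw [hd.fderiv] at hv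
      have hv' : v + τ t • fderiv ℝ h x v = 0 := hv
      have h1 : ‖v‖ ≤ |τ t| * C * ‖v‖ := by
        have h2 : v = - (τ t • fderiv ℝ h x v) := eq_neg_of_add_eq_zero_left hv'
        have h3 : ‖fderiv ℝ h x v‖ ≤ C * ‖v‖ :=
          (ContinuousLinearMap.le_opNorm _ _).trans
            (mul_le_mul_of_nonneg_right (norm_fderiv_le_of_lipschitz ℝ hC) (norm_nonneg _))
        calc ‖v‖ = |τ t| * ‖fderiv ℝ h x v‖ := by
              conv_lhs => rw [h2, norm_neg, norm_smul, Real.norm_eq_abs]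
          _ ≤ |τ t| * (C * ‖v‖) := mul_le_mul_of_nonneg_left h3 (abs_nonneg _)
          _ = _ := by ring
      by_contra hne
      have := norm_pos_iff.2 hne
      nlinarith [hτC t])

/-- The isotopy given by a path of invertible matrices. -/
noncomputable def Isotopy.linear (M : ℝ → Matrix (Fin 3) (Fin 3) ℝ)
    (hM : ∀ i j, ContDiff ℝ ∞ (fun t => M t i j)) (hdet : ∀ t, (M t).det ≠ 0) : Isotopy :=
  Isotopy.ofBijective (fun t x => (M t).mulVec x)
    (by
      refine contDiff_pi.2 fun i => ?_
      change ContDiff ℝ ∞ (fun q : ℝ × Vec => ∑ j, M q.1 i j * q.2 j)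
      refine ContDiff.sum fun j _ => ?_
      exact ((hM i j).comp contDiff_fst).mul ((contDiff_apply ℝ ℝ j).comp contDiff_snd))
    (by
      intro t
      have hu : IsUnit (M t).det := (hdet t).isUnit
      refine Function.bijective_iff_has_inverse.2 ⟨fun x => (M t)⁻¹.mulVec x, fun x => ?_, fun x => ?_⟩
      · simp only [Matrix.mulVec_mulVec, Matrix.nonsing_inv_mul _ hu, Matrix.one_mulVec]
      · simp only [Matrix.mulVec_mulVec, Matrix.mul_nonsing_inv _ hu, Matrix.one_mulVec])
    (by
      intro t x v hv
      have hu : IsUnit (M t).det := (hdet t).isUnit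
      have e : (fun x => (M t).mulVec x) = (Matrix.mulVecLin (M t)).toContinuousLinearMap := rfl
      rw [e, ContinuousLinearMap.fderiv] at hv
      have hv' : (M t).mulVec v = 0 := hv
      have : (M t)⁻¹.mulVec ((M t).mulVec v) = 0 := by rw [hv', Matrix.mulVec_zero]
      rwa [Matrix.mulVec_mulVec, Matrix.nonsing_inv_mul _ hu, Matrix.one_mulVec] at this)

end

section

/-! ### Material operations see neither the time nor the velocity -/

section Natural

variable {a b c : ℕ} {κ : Kind}

/-- A local operator depends on the germs of its arguments only. -/
theorem LocalOperator.apply_congr (Φ : LocalOperator a b c κ) (t : ℝ) {u u' : Vec → Vec}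
    {ρ ρ' : Vec → ℝ} {D D' : Vec → Inputs a b c} {x : Vec} (hu : u =ᶠ[𝓝 x] u')
    (hρ : ρ =ᶠ[𝓝 x] ρ') (hD : D =ᶠ[𝓝 x] D') : Φ.apply t u ρ D x = Φ.apply t u' ρ' D' x := by
  have h : (fun y => ((u y, ρ y, D y) : Config a b c)) =ᶠ[𝓝 x] fun y => (u' y, ρ' y, D' y) := by
    filter_upwards [hu, hρ, hD] with y h1 h2 h3
    rw [h1, h2, h3]
  have hj : jet Φ.order u ρ D x = jet Φ.order u' ρ' D' x :=
    funext fun i => (h.iteratedFDeriv ℝ (i : ℕ)).eq_of_nhds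
  rw [apply, apply, hj]

/-- At two different instants, a material operation takes the same value whatever the velocity
at the first, and with the fluid at rest at the second. -/
theorem LocalOperator.IsMaterial.apply_eq_of_ne {Φ : LocalOperator a b c κ} (hΦ : Φ.IsMaterial)
    {t t' : ℝ} (htt' : t ≠ t') {u : Vec → Vec} (hu : ContDiff ℝ ∞ u) {ρ : Vec → ℝ}
    (hρ : ContDiff ℝ ∞ ρ) (hpos : ∀ y, 0 < ρ y) {D : Vec → Inputs a b c} (hD : SmoothInputs D)
    (x : Vec) : Φ.apply t u ρ D x = Φ.apply t' 0 ρ D x := by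
  -- The displacement `τ(s) h(y)`, where `h` is the velocity cut off around `x`, and `τ` is `s - t` near
  -- `t`, zero near `t'`, and small enough for the displacement to be contracting.
  let χ : ContDiffBump x := default
  set h : Vec → Vec := fun y => χ y • u y with hh
  have sh : ContDiff ℝ ∞ h := χ.contDiff.smul hu
  have ch : HasCompactSupport h := χ.hasCompactSupport.smul_right
  obtain ⟨C, hC⟩ := sh.lipschitzWith_of_hasCompactSupport ch (by simp)
  obtain ⟨δ, hδ, hδt, hδC⟩ : ∃ δ : ℝ, 0 < δ ∧ δ < dist t' t ∧ δ * C < 1 := by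
    have h1 := dist_pos.2 htt'.symm
    refine ⟨min (dist t' t / 2) (1 / (C + 1) / 2), by positivity, ?_, ?_⟩
    · exact (min_le_left _ _).trans_lt (by linarith)
    · have h2 : min (dist t' t / 2) (1 / ((C : ℝ) + 1) / 2) * C ≤ 1 / ((C : ℝ) + 1) / 2 * C :=
        mul_le_mul_of_nonneg_right (min_le_right _ _) C.coe_nonneg
      have h3 : 1 / ((C : ℝ) + 1) / 2 * C < 1 := by
        have : (0 : ℝ) < C + 1 := by positivity
        rw [div_div, div_mul_eq_mul_div, div_lt_one (by positivity)]
        linarith [C.coe_nonneg]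
      exact h2.trans_lt h3
  let f : ContDiffBump t := ⟨δ / 2, δ, by linarith, by linarith⟩
  set τ : ℝ → ℝ := fun s => (s - t) * f s with hτ
  have sτ : ContDiff ℝ ∞ τ := (contDiff_id.sub contDiff_const).mul f.contDiff
  have bτ : ∀ s, |τ s| ≤ δ := fun s => by
    by_cases hs : dist s t < δ
    · rw [hτ, abs_mul, abs_of_nonneg f.nonneg]
      have : |s - t| ≤ δ := by rw [← Real.dist_eq]; exact hs.le
      calc |s - t| * f s ≤ |s - t| * 1 := mul_le_mul_of_nonneg_left f.le_one (abs_nonneg _)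
        _ ≤ δ := by rwa [mul_one]
    · have : f s = 0 := f.zero_of_le_dist (not_lt.1 hs)
      simp only [hτ, this, mul_zero, abs_zero]; exact hδ.le
  have τt : τ t = 0 := by simp [hτ]
  have τ' : τ =ᶠ[𝓝 t'] fun _ => 0 := by
    have : ∀ᶠ s in 𝓝 t', δ < dist s t :=
      (continuous_id.dist continuous_const).continuousAt.eventually (lt_mem_nhds hδt)
    filter_upwards [this] with s hs
    have : f s = 0 := f.zero_of_le_dist hs.le
    simp [hτ, this]
  have dτ : HasDerivAt τ 1 t := by
    have e : τ =ᶠ[𝓝 t] fun s => s - t := by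
      filter_upwards [f.eventuallyEq_one] with s hs
      rw [hτ]; simp only [hs, Pi.one_apply, mul_one]
    exact ((hasDerivAt_id t).sub_const t).congr_of_eventuallyEq e
  let φ : Isotopy := Isotopy.displacement τ h C sτ sh hC fun s =>
    (mul_le_mul_of_nonneg_right (bτ s) C.coe_nonneg).trans_lt hδC
  have hφ : ∀ s y, φ.toFun s y = y + τ s • h y := fun _ _ => rfl
  have i1 : ∀ y, φ.toFun t y = y := fun y => by rw [hφ, τt, zero_smul, add_zero]
  have i2 : ∀ y, φ.toFun t' y = y := fun y => by
    rw [hφ, τ'.eq_of_nhds, zero_smul, add_zero]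
  have inv1 : ∀ y, φ.inv t y = y := fun y => by
    have := φ.left_inv t y; rwa [i1] at this
  have key := φ.push_apply_eq hΦ i1 hρ hpos hD t t' x
  rw [φ.push_apply_of_eq_id Φ i1, φ.push_apply_of_eq_id Φ i2] at key
  have v1 : φ.velocity t = h := by
    funext y i
    have hd : HasDerivAt (fun s => φ.toFun s y i) (h y i) t := by
      have : (fun s => φ.toFun s y i) = fun s => y i + τ s * h y i := rfl
      rw [this]
      simpa using (dτ.mul_const (h y i)).const_add (y i)
    simp only [Isotopy.velocity, inv1]
    exact hd.deriv
  have v2 : φ.velocity t' = 0 := by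
    funext y i
    have hd : (fun s => φ.toFun s (φ.inv t' y) i) =ᶠ[𝓝 t'] fun _ => φ.inv t' y i := by
      filter_upwards [τ'] with s hs
      rw [hφ, hs, zero_smul, add_zero]
    simp only [Isotopy.velocity]
    rw [hd.deriv_eq]; simp
  rw [v1, v2] at key
  rw [← key]
  refine Φ.apply_congr t ?_ EventuallyEq.rfl EventuallyEq.rfl
  filter_upwards [χ.eventuallyEq_one] with y hy
  rw [hh]; simp only [hy, Pi.one_apply, one_smul]

/-- The value of a material operation on the density and the inputs, with the time and the velocity
set to zero. -/
noncomputable def LocalOperator.rest (Φ : LocalOperator a b c κ) (ρ : Vec → ℝ)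
    (D : Vec → Inputs a b c) (x : Vec) : κ.Val := Φ.apply 0 0 ρ D x

theorem LocalOperator.IsMaterial.apply_eq_rest {Φ : LocalOperator a b c κ} (hΦ : Φ.IsMaterial)
    (t : ℝ) {u : Vec → Vec} (hu : ContDiff ℝ ∞ u) {ρ : Vec → ℝ}
    (hρ : ContDiff ℝ ∞ ρ) (hpos : ∀ y, 0 < ρ y) {D : Vec → Inputs a b c} (hD : SmoothInputs D)
    (x : Vec) : Φ.apply t u ρ D x = Φ.rest ρ D x := by
  have z : ContDiff ℝ ∞ (0 : Vec → Vec) := contDiff_const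
  by_cases h : t = 0
  · subst h
    rw [hΦ.apply_eq_of_ne (zero_ne_one' ℝ) hu hρ hpos hD x, rest,
      hΦ.apply_eq_of_ne (zero_ne_one' ℝ).symm z hρ hpos hD x]
  · exact hΦ.apply_eq_of_ne h hu hρ hpos hD x

theorem LocalOperator.rest_congr (Φ : LocalOperator a b c κ) {ρ ρ' : Vec → ℝ}
    {D D' : Vec → Inputs a b c} {x : Vec} (hρ : ρ =ᶠ[𝓝 x] ρ') (hD : D =ᶠ[𝓝 x] D') :
    Φ.rest ρ D x = Φ.rest ρ' D' x :=
  Φ.apply_congr 0 EventuallyEq.rfl hρ hD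

/-! ### Naturality under linear maps -/

/-- Near `x`, the map `ψ` carries the density `ρ` and the inputs `D` to `ρ'` and `D'`. -/
def Carries (ψ : Vec → Vec) (x : Vec) (ρ : Vec → ℝ) (D : Vec → Inputs a b c) (ρ' : Vec → ℝ)
    (D' : Vec → Inputs a b c) : Prop :=
  ∀ᶠ y in 𝓝 x, ρ y = ρ' (ψ y) * (jac ψ y).det ∧ D' (ψ y) = pushInputs (jac ψ y) (D y)

/-- The operator commutes at `x` with the action of `ψ`. -/
def LocalOperator.NaturalAt (Φ : LocalOperator a b c κ) (ψ : Vec → Vec) (x : Vec) : Prop :=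
  ∀ (ρ : Vec → ℝ) (D : Vec → Inputs a b c) (ρ' : Vec → ℝ) (D' : Vec → Inputs a b c),
    ContDiff ℝ ∞ ρ → (∀ y, 0 < ρ y) → SmoothInputs D →
    ContDiff ℝ ∞ ρ' → (∀ y, 0 < ρ' y) → SmoothInputs D' → Carries ψ x ρ D ρ' D' →
      Φ.rest ρ' D' (ψ x) = κ.push (jac ψ x) (Φ.rest ρ D x)

theorem LocalOperator.naturalAt_id (Φ : LocalOperator a b c κ) (x : Vec) :
    Φ.NaturalAt (fun y => y) x := by
  intro ρ D ρ' D' _ _ _ _ _ _ h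
  rw [jac_id, Kind.push_one]
  refine Φ.rest_congr ?_ ?_
  · exact h.mono fun y hy => by rw [hy.1, jac_id, Matrix.det_one, mul_one]
  · exact h.mono fun y hy => by rw [hy.2, jac_id, pushInputs_one]

theorem LocalOperator.NaturalAt.congr {Φ : LocalOperator a b c κ} {ψ ψ' : Vec → Vec} {x : Vec}
    (h : Φ.NaturalAt ψ x) (e : ψ =ᶠ[𝓝 x] ψ') : Φ.NaturalAt ψ' x := by
  intro ρ D ρ' D' h1 h2 h3 h4 h5 h6 h7
  rw [← jac_congr e, ← e.eq_of_nhds]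
  refine h ρ D ρ' D' h1 h2 h3 h4 h5 h6 ?_
  filter_upwards [h7, e.eventuallyEq_nhds] with y hy hy'
  rwa [jac_congr hy', hy'.eq_of_nhds]

theorem Isotopy.det_jac_inv_mul_det_jac (φ : Isotopy) (t : ℝ) (x : Vec) :
    (jac (φ.inv t) (φ.toFun t x)).det * (jac (φ.toFun t) x).det = 1 := by
  rw [← Matrix.det_mul, φ.jac_inv_mul_jac, Matrix.det_one]

theorem Isotopy.smooth_density (φ : Isotopy) {t₀ : ℝ} (h₀ : ∀ x, φ.toFun t₀ x = x)
    {ρ : Vec → ℝ} (hρ : ContDiff ℝ ∞ ρ) (hpos : ∀ y, 0 < ρ y) (t : ℝ) :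
    ContDiff ℝ ∞ (φ.density ρ t) :=
  (contDiffOn_univ.1 (φ.isFlowOn h₀ hρ hpos).smooth_density).comp
    (contDiff_const.prodMk contDiff_id : ContDiff ℝ ∞ fun x : Vec => (t, x))

theorem Isotopy.density_pos (φ : Isotopy) {t₀ : ℝ} (h₀ : ∀ x, φ.toFun t₀ x = x)
    {ρ : Vec → ℝ} (hpos : ∀ y, 0 < ρ y) (t : ℝ) (x : Vec) : 0 < φ.density ρ t x :=
  mul_pos (hpos _) (φ.det_jac_inv_pos h₀ _ _)

theorem Isotopy.smoothInputs (φ : Isotopy) {D : Vec → Inputs a b c} (hD : SmoothInputs D) (t : ℝ) :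
    SmoothInputs (φ.inputs D t) := by
  have h := φ.inputsInvariantOn hD
  have hs : ContDiff ℝ ∞ fun x : Vec => (t, x) := contDiff_const.prodMk contDiff_id
  refine ⟨ContDiff.prodMk ?_ (ContDiff.prodMk ?_ ?_), fun x i => (h.skews i).symm (t, x) trivial⟩
  · exact contDiff_pi.2 fun i => (contDiffOn_univ.1 (h.scalars i).smooth).comp hs
  · exact contDiff_pi.2 fun i => (contDiffOn_univ.1 (h.vectors i).smooth).comp hs
  · exact contDiff_pi.2 fun i => (contDiffOn_univ.1 (h.skews i).smooth).comp hs

theorem LocalOperator.IsMaterial.rest_isotopy {Φ : LocalOperator a b c κ} (hΦ : Φ.IsMaterial)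
    (φ : Isotopy) (h₀ : ∀ x, φ.toFun 0 x = x) {ρ : Vec → ℝ}
    (hρ : ContDiff ℝ ∞ ρ) (hpos : ∀ y, 0 < ρ y) {D : Vec → Inputs a b c} (hD : SmoothInputs D)
    (x : Vec) : Φ.rest (φ.density ρ 1) (φ.inputs D 1) (φ.toFun 1 x) =
      κ.push (jac (φ.toFun 1) x) (Φ.rest ρ D x) := by
  have hv : ∀ t, ContDiff ℝ ∞ (φ.velocity t) := fun t => contDiff_pi.2 fun i =>
    (contDiffOn_univ.1 (φ.smoothOn_velocity i)).comp
      (contDiff_const.prodMk contDiff_id : ContDiff ℝ ∞ fun x : Vec => (t, x))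
  have key := φ.push_apply_eq hΦ h₀ hρ hpos hD 1 0 x
  rw [φ.push_apply_of_eq_id Φ h₀, hΦ.apply_eq_rest 0 (hv 0) hρ hpos hD,
    hΦ.apply_eq_rest 1 (hv 1) (φ.smooth_density h₀ hρ hpos 1) (φ.density_pos h₀ hpos 1)
      (φ.smoothInputs hD 1)] at key
  rw [← key, ← Kind.push_mul, mul_eq_one_comm.1 (φ.jac_inv_mul_jac 1 x), Kind.push_one]

/-- Naturality under a map extends to its composition with the final map of an isotopy. -/
theorem LocalOperator.IsMaterial.naturalAt_comp_isotopy {Φ : LocalOperator a b c κ}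
    (hΦ : Φ.IsMaterial) (φ : Isotopy) (h₀ : ∀ x, φ.toFun 0 x = x) {ψ : Vec → Vec} {x : Vec}
    (hd : ∀ᶠ z in 𝓝 (φ.toFun 1 x), DifferentiableAt ℝ ψ z)
    (hψ : Φ.NaturalAt ψ (φ.toFun 1 x)) : Φ.NaturalAt (fun y => ψ (φ.toFun 1 y)) x := by
  intro ρ D ρ' D' h1 h2 h3 h4 h5 h6 h7
  have dφ : ∀ y, DifferentiableAt ℝ (φ.toFun 1) y := (φ.smooth_slice 1).differentiable (by simp)
  rw [jac_comp hd.self_of_nhds (dφ x), Kind.push_mul, ← hΦ.rest_isotopy φ h₀ h1 h2 h3]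
  refine hψ _ _ ρ' D' (φ.smooth_density h₀ h1 h2 1) (φ.density_pos h₀ h2 1) (φ.smoothInputs h3 1)
    h4 h5 h6 ?_
  have hc : Tendsto (φ.inv 1) (𝓝 (φ.toFun 1 x)) (𝓝 x) := by
    have := ((φ.smooth_inv_slice 1).continuous.tendsto (φ.toFun 1 x))
    rwa [φ.left_inv] at this
  filter_upwards [hc.eventually h7, hd] with z hz hdz
  have hdz' : DifferentiableAt ℝ ψ (φ.toFun 1 (φ.inv 1 z)) := by rwa [φ.right_inv]
  rw [jac_comp hdz' (dφ _), φ.right_inv, Matrix.det_mul, pushInputs_mul] at hz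
  refine ⟨?_, hz.2⟩
  have := φ.det_jac_inv_mul_det_jac 1 (φ.inv 1 z)
  rw [φ.right_inv] at this
  rw [Isotopy.density, hz.1]
  linear_combination (ρ' (ψ z) * (jac ψ z).det) * this

/-- The operator may be composed with the linear map of matrix `A` without losing naturality. -/
def LocalOperator.NaturalLinear (Φ : LocalOperator a b c κ) (A : Matrix (Fin 3) (Fin 3) ℝ) : Prop :=
  ∀ (ψ : Vec → Vec) (x : Vec), Differentiable ℝ ψ → Φ.NaturalAt ψ (A.mulVec x) →
    Φ.NaturalAt (fun y => ψ (A.mulVec y)) x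

theorem differentiable_mulVec (A : Matrix (Fin 3) (Fin 3) ℝ) :
    Differentiable ℝ (fun x : Vec => A.mulVec x) :=
  (Matrix.mulVecLin A).toContinuousLinearMap.differentiable

theorem LocalOperator.NaturalLinear.mul {Φ : LocalOperator a b c κ}
    {A B : Matrix (Fin 3) (Fin 3) ℝ} (hA : Φ.NaturalLinear A) (hB : Φ.NaturalLinear B) :
    Φ.NaturalLinear (A * B) := by
  intro ψ x hψ h
  rw [← Matrix.mulVec_mulVec] at h
  have := hB (fun y => ψ (A.mulVec y)) x (hψ.comp (differentiable_mulVec A)) (hA ψ _ hψ h)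
  simpa only [Matrix.mulVec_mulVec] using this

theorem LocalOperator.IsMaterial.naturalLinear_of_path {Φ : LocalOperator a b c κ}
    (hΦ : Φ.IsMaterial) (M : ℝ → Matrix (Fin 3) (Fin 3) ℝ)
    (hM : ∀ i j, ContDiff ℝ ∞ (fun t => M t i j)) (hdet : ∀ t, (M t).det ≠ 0) (h0 : M 0 = 1) :
    Φ.NaturalLinear (M 1) := by
  intro ψ x hψ h
  refine hΦ.naturalAt_comp_isotopy (Isotopy.linear M hM hdet) (fun y => ?_)
    (Eventually.of_forall fun z => hψ z) h
  change (M 0).mulVec y = y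
  rw [h0, Matrix.one_mulVec]

theorem LocalOperator.IsMaterial.naturalLinear_transvection {Φ : LocalOperator a b c κ}
    (hΦ : Φ.IsMaterial) {i j : Fin 3} (hij : i ≠ j) (r : ℝ) :
    Φ.NaturalLinear (Matrix.transvection i j r) := by
  have := hΦ.naturalLinear_of_path (fun t => Matrix.transvection i j (t * r)) (fun k l => ?_)
    (fun t => ?_) (by simp)
  · simpa using this
  · simp only [Matrix.transvection, Matrix.add_apply, Matrix.single_apply]
    refine contDiff_const.add ?_
    split_ifs
    · exact contDiff_id.mul contDiff_const
    · exact contDiff_const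
  · rw [Matrix.det_transvection_of_ne _ _ hij]; exact one_ne_zero

theorem LocalOperator.IsMaterial.naturalLinear_diagonal_of_pos {Φ : LocalOperator a b c κ}
    (hΦ : Φ.IsMaterial) {d : Fin 3 → ℝ} (hd : ∀ i, 0 < d i) :
    Φ.NaturalLinear (Matrix.diagonal d) := by
  have := hΦ.naturalLinear_of_path
    (fun t => Matrix.diagonal fun i => Real.exp (t * Real.log (d i))) (fun k l => ?_)
    (fun t => ?_) (by simp)
  · simpa [Real.exp_log (hd _)] using this
  · by_cases hkl : k = l
    · subst hkl
      simp only [Matrix.diagonal_apply_eq]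
      exact (contDiff_id.mul contDiff_const).exp
    · simp only [Matrix.diagonal_apply_ne _ hkl]
      exact contDiff_const
  · rw [Matrix.det_diagonal]
    exact Finset.prod_ne_zero_iff.2 fun i _ => (Real.exp_pos _).ne'

/-- The rotation by a straight angle in a coordinate plane is a product of transvections. -/
theorem LocalOperator.IsMaterial.naturalLinear_flip {Φ : LocalOperator a b c κ}
    (hΦ : Φ.IsMaterial) {i j : Fin 3} (hij : i ≠ j) :
    Φ.NaturalLinear (Matrix.diagonal fun k => if k = i ∨ k = j then -1 else 1) := by
  set R : Matrix (Fin 3) (Fin 3) ℝ := Matrix.transvection i j 1 * Matrix.transvection j i (-1) *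
    Matrix.transvection i j 1 with hR
  have hN : Φ.NaturalLinear R := ((hΦ.naturalLinear_transvection hij 1).mul
    (hΦ.naturalLinear_transvection hij.symm (-1))).mul (hΦ.naturalLinear_transvection hij 1)
  have e : Matrix.diagonal (fun k => if k = i ∨ k = j then (-1 : ℝ) else 1) = R * R := by
    rw [hR]
    obtain rfl | rfl | rfl := fin_three_cases i <;> obtain rfl | rfl | rfl := fin_three_cases j <;>
    first
    | exact absurd rfl hij
    | (ext k l
       obtain rfl | rfl | rfl := fin_three_cases k <;>
         obtain rfl | rfl | rfl := fin_three_cases l <;>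
       simp [Matrix.transvection, Matrix.mul_apply, Fin.sum_univ_three, Matrix.one_apply,
         Matrix.single_apply])
  rw [e]
  exact hN.mul hN

theorem LocalOperator.IsMaterial.naturalLinear_diagonal {Φ : LocalOperator a b c κ}
    (hΦ : Φ.IsMaterial) {d : Fin 3 → ℝ} (hd : 0 < d 0 * d 1 * d 2) :
    Φ.NaturalLinear (Matrix.diagonal d) := by
  have h0 : d 0 ≠ 0 := by rintro h; simp [h] at hd
  have h1 : d 1 ≠ 0 := by rintro h; simp [h] at hd
  have h2 : d 2 ≠ 0 := by rintro h; simp [h] at hd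
  have hne : ∀ i, 0 < |d i| := fun i => abs_pos.2 (by
    obtain rfl | rfl | rfl := fin_three_cases i <;> assumption)
  have habs := hΦ.naturalLinear_diagonal_of_pos hne
  have key : ∀ i j : Fin 3, i ≠ j →
      (∀ k, d k = (if k = i ∨ k = j then (-1 : ℝ) else 1) * |d k|) →
      Φ.NaturalLinear (Matrix.diagonal d) := by
    intro i j hij hk
    have := (hΦ.naturalLinear_flip hij).mul habs
    rw [Matrix.diagonal_mul_diagonal] at this
    rwa [← funext hk] at this
  have neg : ∀ k, d k < 0 → d k = -1 * |d k| := fun k hk => by rw [abs_of_neg hk]; ring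
  have pos : ∀ k, 0 < d k → d k = 1 * |d k| := fun k hk => by rw [abs_of_pos hk]; ring
  rcases lt_or_gt_of_ne h0 with n0 | p0 <;> rcases lt_or_gt_of_ne h1 with n1 | p1 <;>
    rcases lt_or_gt_of_ne h2 with n2 | p2
  · exact absurd hd (by have := mul_pos_of_neg_of_neg n0 n1; nlinarith)
  · refine key 0 1 (by decide) fun k => ?_
    obtain rfl | rfl | rfl := fin_three_cases k
    · simpa using neg 0 n0
    · simpa using neg 1 n1
    · simpa using pos 2 p2
  · refine key 0 2 (by decide) fun k => ?_
    obtain rfl | rfl | rfl := fin_three_cases k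
    · simpa using neg 0 n0
    · simpa using pos 1 p1
    · simpa using neg 2 n2
  · exact absurd hd (by have := mul_neg_of_neg_of_pos n0 p1; nlinarith)
  · refine key 1 2 (by decide) fun k => ?_
    obtain rfl | rfl | rfl := fin_three_cases k
    · simpa using pos 0 p0
    · simpa using neg 1 n1
    · simpa using neg 2 n2
  · exact absurd hd (by have := mul_neg_of_pos_of_neg p0 n1; nlinarith)
  · exact absurd hd (by have := mul_pos p0 p1; nlinarith)
  · have e : (fun k => |d k|) = d := funext fun k => by
      obtain rfl | rfl | rfl := fin_three_cases k <;> exact abs_of_pos ‹_›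
    rwa [e] at habs

/-- Naturality under linear maps of positive determinant, which are products of transvections and
of a diagonal matrix. -/
theorem LocalOperator.IsMaterial.naturalLinear {Φ : LocalOperator a b c κ}
    (hΦ : Φ.IsMaterial) {A : Matrix (Fin 3) (Fin 3) ℝ} (hA : 0 < A.det) : Φ.NaturalLinear A := by
  refine Matrix.diagonal_transvection_induction _ A (fun d hd => ?_) (fun t => ?_) fun B C => ?_
  · refine hΦ.naturalLinear_diagonal ?_
    rw [← hd, Matrix.det_diagonal, Fin.prod_univ_three] at hA
    exact hA
  · exact hΦ.naturalLinear_transvection t.hij t.c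
  · exact fun hB hC => hB.mul hC

end Natural

end

section

/-! ### Extension of germs -/

/-- A germ of a smooth map is that of a smooth map which takes, elsewhere, values between
those of the germ and a constant. -/
theorem exists_contDiff_eventuallyEq {E F : Type*} [NormedAddCommGroup E] [NormedSpace ℝ E]
    [FiniteDimensional ℝ E] [NormedAddCommGroup F] [NormedSpace ℝ F] {f : E → F} {x : E}
    {P : E → Prop} (hf : ∀ᶠ y in 𝓝 x, ContDiffAt ℝ ∞ f y ∧ P y) (e : F) :
    ∃ g : E → F, ContDiff ℝ ∞ g ∧ g =ᶠ[𝓝 x] f ∧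
      ∀ y, ∃ s ∈ Set.Icc (0 : ℝ) 1, g y = s • f y + (1 - s) • e ∧ (s ≠ 0 → P y) := by
  obtain ⟨R, hR, hb⟩ := Metric.eventually_nhds_iff_ball.1 hf
  let χ : ContDiffBump x := ⟨R / 3, R / 2, by positivity, by linarith⟩
  refine ⟨fun y => χ y • f y + (1 - χ y) • e, ?_, ?_, fun y => ⟨χ y, ⟨χ.nonneg, χ.le_one⟩, rfl, ?_⟩⟩
  · rw [contDiff_iff_contDiffAt]
    intro y
    by_cases hy : dist y x < R
    · exact (χ.contDiff.contDiffAt.smul (hb y hy).1).add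
        ((contDiffAt_const.sub χ.contDiff.contDiffAt).smul contDiffAt_const)
    · have : ∀ᶠ z in 𝓝 y, R / 2 < dist z x :=
        (continuous_id.dist continuous_const).continuousAt.eventually
          (lt_mem_nhds (by simp only [id]; linarith))
      have h0 : (fun z => χ z • f z + (1 - χ z) • e) =ᶠ[𝓝 y] fun _ => e := by
        filter_upwards [this] with z hz
        rw [χ.zero_of_le_dist hz.le, zero_smul, zero_add, sub_zero, one_smul]
      exact contDiffAt_const.congr_of_eventuallyEq h0
  · filter_upwards [χ.eventuallyEq_one] with y hy
    rw [hy]; simp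
  · intro hs
    by_cases hy : dist y x < R
    · exact (hb y hy).2
    · exact absurd (χ.zero_of_le_dist (by change R / 2 ≤ _; linarith)) hs

/-- A germ that vanishes to first order extends to a smooth map of small Lipschitz constant. -/
theorem exists_small_lipschitz_extension {g : Vec → Vec} {x : Vec}
    (hg : ∀ᶠ y in 𝓝 x, ContDiffAt ℝ ∞ g y) (h0 : g x = 0) (h1 : fderiv ℝ g x = 0) :
    ∃ h : Vec → Vec, ContDiff ℝ ∞ h ∧ LipschitzWith (1 / 2) h ∧ h =ᶠ[𝓝 x] g := by
  let b : ContDiffBump (0 : Vec) := ⟨1, 2, one_pos, one_lt_two⟩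
  have sb : ContDiff ℝ ∞ b := b.contDiff
  obtain ⟨K, hK⟩ := sb.lipschitzWith_of_hasCompactSupport b.hasCompactSupport (by simp)
  set ε : NNReal := 1 / (2 * (1 + 2 * K)) with hε
  have εpos : 0 < ε := by positivity
  have hst : HasStrictFDerivAt g (0 : Vec →L[ℝ] Vec) x := by
    rw [← h1]; exact hg.self_of_nhds.hasStrictFDerivAt (by simp)
  obtain ⟨s, hs, hlip⟩ := hst.exists_lipschitzOnWith_of_nnnorm_lt ε (by simpa using εpos)
  obtain ⟨R, hR, hball⟩ := Metric.eventually_nhds_iff_ball.1 (hg.and hs)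
  set r : ℝ := R / 3 with hr
  have rpos : 0 < r := by positivity
  set χ : Vec → ℝ := fun y => b (r⁻¹ • (y - x)) with hχ
  have sχ : ContDiff ℝ ∞ χ := sb.comp ((contDiff_id.sub contDiff_const).const_smul r⁻¹)
  have χ0 : ∀ y, 2 * r ≤ dist y x → χ y = 0 := fun y hy => by
    apply b.zero_of_le_dist
    rw [dist_zero_right, norm_smul, norm_inv, Real.norm_of_nonneg rpos.le, ← dist_eq_norm,
      ← div_eq_inv_mul]
    exact (le_div_iff₀ rpos).2 hy
  have χlip : ∀ y z, |χ y - χ z| ≤ K / r * dist y z := fun y z => by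
    have := hK.dist_le_mul (r⁻¹ • (y - x)) (r⁻¹ • (z - x))
    rw [Real.dist_eq, dist_smul₀, dist_sub_right, norm_inv, Real.norm_of_nonneg rpos.le] at this
    calc _ ≤ _ := this
      _ = _ := by ring
  have gball : ∀ y, dist y x < R → ‖g y‖ ≤ ε * dist y x := fun y hy => by
    have := hlip.dist_le_mul y (hball y hy).2 x (mem_of_mem_nhds hs)
    rwa [h0, dist_zero_right] at this
  refine ⟨fun y => χ y • g y, ?_, ?_, ?_⟩
  · rw [contDiff_iff_contDiffAt]
    intro y
    by_cases hy : dist y x < R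
    · exact sχ.contDiffAt.smul (hball y hy).1
    · have : ∀ᶠ z in 𝓝 y, 2 * r < dist z x :=
        (continuous_id.dist continuous_const).continuousAt.eventually
          (lt_mem_nhds (by simp only [id]; linarith))
      refine (contDiffAt_const (c := (0 : Vec))).congr_of_eventuallyEq ?_
      filter_upwards [this] with z hz
      rw [χ0 z hz.le, zero_smul]
  · have hε2 : (ε : ℝ) * (1 + 2 * K) = 1 / 2 := by
      rw [hε]; push_cast
      have : (1 + 2 * (K : ℝ)) ≠ 0 := by positivity
      field_simp
    -- It suffices to estimate the difference when one of the points is in the support.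
    have key : ∀ y z, dist z x < 2 * r → ‖χ y • g y - χ z • g z‖ ≤ 1 / 2 * dist y z := by
      intro y z hz
      have hgz := gball z (by linarith)
      have h2 : ‖(χ y - χ z) • g z‖ ≤ ε * (2 * K) * dist y z := by
        rw [norm_smul, Real.norm_eq_abs]
        calc |χ y - χ z| * ‖g z‖ ≤ (K / r * dist y z) * (ε * (2 * r)) :=
              mul_le_mul (χlip y z) (hgz.trans (mul_le_mul_of_nonneg_left hz.le ε.coe_nonneg))
                (norm_nonneg _) (by positivity)
          _ = _ := by field_simp
      by_cases hy : dist y x < 2 * r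
      · have h3 : ‖χ y • (g y - g z)‖ ≤ ε * dist y z := by
          have := hlip.dist_le_mul y (hball y (by rw [Metric.mem_ball]; linarith)).2 z
            (hball z (by rw [Metric.mem_ball]; linarith)).2
          rw [dist_eq_norm] at this
          rw [norm_smul, Real.norm_of_nonneg b.nonneg]
          calc χ y * ‖g y - g z‖ ≤ 1 * ‖g y - g z‖ :=
                mul_le_mul_of_nonneg_right b.le_one (norm_nonneg _)
            _ ≤ _ := by rwa [one_mul]
        have e : χ y • g y - χ z • g z = χ y • (g y - g z) + (χ y - χ z) • g z := by
          rw [smul_sub, sub_smul]; abel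
        rw [e]
        calc _ ≤ _ := norm_add_le _ _
          _ ≤ ε * dist y z + ε * (2 * K) * dist y z := add_le_add h3 h2
          _ = ε * (1 + 2 * K) * dist y z := by ring
          _ = _ := by rw [hε2]
      · have e : χ y • g y - χ z • g z = (χ y - χ z) • g z := by
          rw [χ0 y (not_lt.1 hy), zero_smul, sub_smul, zero_smul]
        rw [e, ← hε2]
        refine h2.trans (mul_le_mul_of_nonneg_right ?_ dist_nonneg)
        exact mul_le_mul_of_nonneg_left (by linarith) ε.coe_nonneg
    refine LipschitzWith.of_dist_le_mul fun y z => ?_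
    have e12 : (((1 / 2 : NNReal)) : ℝ) = 1 / 2 := by norm_num
    rw [e12, dist_eq_norm]
    by_cases hz : dist z x < 2 * r
    · exact key y z hz
    · by_cases hy : dist y x < 2 * r
      · rw [norm_sub_rev, dist_comm]; exact key z y hy
      · rw [χ0 y (not_lt.1 hy), χ0 z (not_lt.1 hz)]
        simp only [zero_smul, sub_zero, norm_zero]; positivity
  · have : ∀ᶠ y in 𝓝 x, dist y x < r := Metric.ball_mem_nhds x rpos
    filter_upwards [this] with y hy
    have : χ y = 1 := by
      apply b.one_of_mem_closedBall
      rw [mem_closedBall_zero_iff, norm_smul, norm_inv, Real.norm_of_nonneg rpos.le,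
        ← dist_eq_norm, ← div_eq_inv_mul]
      exact (div_le_one rpos).2 hy.le
    rw [this, one_smul]

section Natural

variable {a b c : ℕ} {κ : Kind}

/-! ### Naturality under local diffeomorphisms -/

theorem LocalOperator.IsMaterial.naturalAt_translation {Φ : LocalOperator a b c κ}
    (hΦ : Φ.IsMaterial) (v x : Vec) : Φ.NaturalAt (fun y => y + v) x := by
  let φ : Isotopy := Isotopy.displacement (fun t => t) (fun _ => v) 0 contDiff_id contDiff_const
    (LipschitzWith.const v) (by simp)
  have hφ : ∀ t y, φ.toFun t y = y + t • v := fun _ _ => rfl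
  have := hΦ.naturalAt_comp_isotopy φ (fun y => by rw [hφ]; simp) (ψ := fun y => y) (x := x)
    (Eventually.of_forall fun z => differentiableAt_id) (Φ.naturalAt_id _)
  simpa [hφ] using this

/-- A material operation commutes with orientation-preserving local diffeomorphisms. Such a map is,
near a point, the composition of a map close to the identity, a linear map and a translation. -/
theorem LocalOperator.IsMaterial.naturalAt {Φ : LocalOperator a b c κ} (hΦ : Φ.IsMaterial)
    {ψ : Vec → Vec} {x : Vec} (hψ : ∀ᶠ y in 𝓝 x, ContDiffAt ℝ ∞ ψ y) (hdet : 0 < (jac ψ x).det) :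
    Φ.NaturalAt ψ x := by
  set A := jac ψ x with hA
  have hu : IsUnit A.det := hdet.ne'.isUnit
  have dx : DifferentiableAt ℝ ψ x := hψ.self_of_nhds.differentiableAt (by simp)
  set L : Vec →L[ℝ] Vec := (Matrix.mulVecLin A⁻¹).toContinuousLinearMap with hL
  have hLa : ∀ v, L v = A⁻¹.mulVec v := fun _ => rfl
  -- After composition with the inverse of its linear part, `ψ` is the identity to first order.
  set g : Vec → Vec := fun y => L (ψ y - ψ x) - (y - x) with hg
  have sg : ∀ᶠ y in 𝓝 x, ContDiffAt ℝ ∞ g y := hψ.mono fun y hy =>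
    (L.contDiff.contDiffAt.comp y (hy.sub contDiffAt_const)).sub
      (contDiffAt_id.sub contDiffAt_const)
  have g0 : g x = 0 := by simp [hg]
  have g1 : fderiv ℝ g x = 0 := by
    have h1 : HasFDerivAt g (L.comp (fderiv ℝ ψ x) - ContinuousLinearMap.id ℝ Vec) x :=
      (L.hasFDerivAt.comp x (dx.hasFDerivAt.sub_const (ψ x))).sub
        ((hasFDerivAt_id x).sub_const x)
    rw [h1.fderiv]
    ext1 v
    simp only [sub_apply, ContinuousLinearMap.comp_apply, ContinuousLinearMap.id_apply,
      fderiv_eq_jac_mulVec dx, hLa, Matrix.mulVec_mulVec, ← hA, Matrix.nonsing_inv_mul _ hu,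
      Matrix.one_mulVec, sub_self]
    rfl
  obtain ⟨h, sh, lh, eh⟩ := exists_small_lipschitz_extension sg g0 g1
  let φ : Isotopy := Isotopy.displacement Real.smoothTransition h (1 / 2)
    Real.smoothTransition.contDiff sh lh (fun t => by
      rw [abs_of_nonneg (Real.smoothTransition.nonneg t)]
      have h1 := Real.smoothTransition.le_one t
      have h2 : (((1 / 2 : NNReal)) : ℝ) = 1 / 2 := by norm_num
      rw [h2]; linarith)
  have hφ : ∀ t y, φ.toFun t y = y + Real.smoothTransition t • h y := fun _ _ => rfl
  set T : Vec → Vec := fun y => y + (ψ x - A.mulVec x) with hT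
  have hTd : Differentiable ℝ T := differentiable_id.add_const _
  have hlin := hΦ.naturalLinear hdet T (φ.toFun 1 x) hTd (hΦ.naturalAt_translation _ _)
  have hcomp := hΦ.naturalAt_comp_isotopy φ (fun y => by simp [hφ])
    (Eventually.of_forall fun z => (hTd.comp (differentiable_mulVec A)) z) hlin
  refine hcomp.congr (eh.mono fun y hy => ?_)
  have e : φ.toFun 1 y = x + A⁻¹.mulVec (ψ y - ψ x) := by
    rw [hφ, Real.smoothTransition.one, one_smul, hy]
    simp only [hg, hLa]; abel
  simp only [hT, Function.comp_apply, e, Matrix.mulVec_add, Matrix.mulVec_mulVec,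
    Matrix.mul_nonsing_inv _ hu, Matrix.one_mulVec]
  abel

/-- Fields near a point are carried by an orientation-preserving local diffeomorphism to the germs
of fields on all of space. -/
theorem exists_carries {ψ : Vec → Vec} {x : Vec} (hψ : ∀ᶠ y in 𝓝 x, ContDiffAt ℝ ∞ ψ y)
    (hdet : 0 < (jac ψ x).det) {ρ : Vec → ℝ} {D : Vec → Inputs a b c} (hρ : ContDiff ℝ ∞ ρ)
    (hpos : ∀ y, 0 < ρ y) (hD : SmoothInputs D) :
    ∃ (ρ' : Vec → ℝ) (D' : Vec → Inputs a b c), ContDiff ℝ ∞ ρ' ∧ (∀ y, 0 < ρ' y) ∧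
      SmoothInputs D' ∧ Carries ψ x ρ D ρ' D' := by
  have sx := hψ.self_of_nhds
  have dx : DifferentiableAt ℝ ψ x := sx.differentiableAt (by simp)
  have inj : ∀ y, DifferentiableAt ℝ ψ y → 0 < (jac ψ y).det →
      Function.Injective (fderiv ℝ ψ y) := by
    intro y dy hy
    rw [injective_iff_map_eq_zero]
    intro v hv
    rw [fderiv_eq_jac_mulVec dy] at hv
    exact Matrix.eq_zero_of_mulVec_eq_zero hy.ne' hv
  obtain ⟨e₀, he₀⟩ := exists_continuousLinearEquiv _ (inj x dx hdet)
  have hd : HasFDerivAt ψ (e₀ : Vec →L[ℝ] Vec) x := by rw [he₀]; exact dx.hasFDerivAt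
  set e := sx.toOpenPartialHomeomorph ψ hd (by simp) with he
  have hcoe : ∀ y, e y = ψ y := fun _ => rfl
  have hxs : x ∈ e.source := sx.mem_toOpenPartialHomeomorph_source hd (by simp)
  have hxt : ψ x ∈ e.target := sx.image_mem_toOpenPartialHomeomorph_target hd (by simp)
  have sjac : ∀ y, ContDiffAt ℝ ∞ ψ y → ∀ i j, ContDiffAt ℝ ∞ (fun z => jac ψ z i j) y := by
    intro y hy i j
    have h1 : ContDiffAt ℝ ∞ (fun z => ψ z i) y := contDiffAt_pi.1 hy i
    have h2 : ContDiffAt ℝ ∞ (fderiv ℝ fun z => ψ z i) y := h1.fderiv_right (m := ∞) (by simp)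
    exact h2.clm_apply contDiffAt_const
  have sdet : ∀ y, ContDiffAt ℝ ∞ ψ y → ContDiffAt ℝ ∞ (fun z => (jac ψ z).det) y := by
    intro y hy
    have s := sjac y hy
    simp only [Matrix.det_fin_three]
    exact (((((((s 0 0).mul (s 1 1)).mul (s 2 2)).sub (((s 0 0).mul (s 1 2)).mul (s 2 1))).sub
      (((s 0 1).mul (s 1 0)).mul (s 2 2))).add (((s 0 1).mul (s 1 2)).mul (s 2 0))).add
      (((s 0 2).mul (s 1 0)).mul (s 2 1))).sub (((s 0 2).mul (s 1 1)).mul (s 2 0))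
  have hdet' : ∀ᶠ y in 𝓝 x, 0 < (jac ψ y).det :=
    (sdet x sx).continuousAt.eventually (lt_mem_nhds hdet)
  have hsymm : Tendsto e.symm (𝓝 (ψ x)) (𝓝 x) := e.tendsto_symm hxs
  have good : ∀ᶠ z in 𝓝 (ψ x), ContDiffAt ℝ ∞ ψ (e.symm z) ∧ 0 < (jac ψ (e.symm z)).det ∧
      ContDiffAt ℝ ∞ e.symm z := by
    filter_upwards [hsymm.eventually hψ, hsymm.eventually hdet', e.open_target.mem_nhds hxt]
      with z h1 h2 h3
    refine ⟨h1, h2, ?_⟩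
    have dz := h1.differentiableAt (by simp)
    obtain ⟨e₁, he₁⟩ := exists_continuousLinearEquiv _ (inj _ dz h2)
    refine e.contDiffAt_symm (f₀' := e₁) h3 ?_ h1
    rw [he₁]; exact dz.hasFDerivAt
  -- The carried fields near `ψ x`.
  set ρ₁ : Vec → ℝ := fun z => ρ (e.symm z) / (jac ψ (e.symm z)).det with hρ₁
  set D₁ : Vec → Inputs a b c := fun z => pushInputs (jac ψ (e.symm z)) (D (e.symm z)) with hD₁
  have sρ₁ : ∀ᶠ z in 𝓝 (ψ x), ContDiffAt ℝ ∞ ρ₁ z ∧ 0 < ρ₁ z := good.mono fun z hz =>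
    ⟨(hρ.contDiffAt.comp z hz.2.2).div ((sdet _ hz.1).comp z hz.2.2) hz.2.1.ne',
      div_pos (hpos _) hz.2.1⟩
  have sD₁ : ∀ᶠ z in 𝓝 (ψ x), ContDiffAt ℝ ∞ D₁ z ∧ True := good.mono fun z hz => by
    refine ⟨?_, trivial⟩
    have hj : ∀ i j, ContDiffAt ℝ ∞ (fun z => jac ψ (e.symm z) i j) z := fun i j =>
      (sjac _ hz.1 i j).comp z hz.2.2
    have hDs : ContDiffAt ℝ ∞ (fun z => D (e.symm z)) z := hD.smooth.contDiffAt.comp z hz.2.2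
    have hv : ∀ i j, ContDiffAt ℝ ∞ (fun z => (D (e.symm z)).2.1 i j) z := fun i j =>
      contDiffAt_pi.1 (contDiffAt_pi.1 (hDs.snd.fst) i) j
    have hA : ∀ i j k, ContDiffAt ℝ ∞ (fun z => (D (e.symm z)).2.2 i j k) z := fun i j k =>
      contDiffAt_pi.1 (contDiffAt_pi.1 (contDiffAt_pi.1 (hDs.snd.snd) i) j) k
    refine ContDiffAt.prodMk hDs.fst (ContDiffAt.prodMk ?_ ?_)
    · refine contDiffAt_pi.2 fun i => contDiffAt_pi.2 fun j => ?_
      change ContDiffAt ℝ ∞ (fun z => ∑ k, jac ψ (e.symm z) j k * (D (e.symm z)).2.1 i k) z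
      exact ContDiffAt.sum fun k _ => (hj j k).mul (hv i k)
    · refine contDiffAt_pi.2 fun i => contDiffAt_pi.2 fun j => contDiffAt_pi.2 fun k => ?_
      exact ContDiffAt.sum fun l _ => ContDiffAt.sum fun m _ =>
        ((hj j l).mul (hj k m)).mul (hA i l m)
  obtain ⟨ρ', sρ', eρ', hρ'⟩ := exists_contDiff_eventuallyEq sρ₁ (1 : ℝ)
  obtain ⟨D', sD', eD', hD'⟩ := exists_contDiff_eventuallyEq sD₁ (0 : Inputs a b c)
  refine ⟨ρ', D', sρ', fun y => ?_, ⟨sD', fun y i j k => ?_⟩, ?_⟩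
  · obtain ⟨s, ⟨hs0, hs1⟩, hy, hP⟩ := hρ' y
    rw [hy, smul_eq_mul, smul_eq_mul, mul_one]
    rcases hs0.eq_or_lt with h | h
    · rw [← h]; norm_num
    · exact add_pos_of_pos_of_nonneg (mul_pos h (hP h.ne')) (by linarith)
  · obtain ⟨s, _, hy, _⟩ := hD' y
    have h1 := pushSkew_isSkew (jac ψ (e.symm y)) (hD.skew (e.symm y) i) j k
    rw [hy]
    change s * pushSkew _ _ j k + (1 - s) * 0 = - (s * pushSkew _ _ k j + (1 - s) * 0)
    rw [h1]; ring
  · have hc : Tendsto ψ (𝓝 x) (𝓝 (ψ x)) := sx.continuousAt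
    filter_upwards [hc.eventually eρ', hc.eventually eD', hdet', e.open_source.mem_nhds hxs]
      with y h1 h2 h3 h4
    have hl : e.symm (ψ y) = y := e.left_inv h4
    rw [h1, h2]
    simp only [hρ₁, hD₁, hl]
    exact ⟨(div_mul_cancel₀ _ h3.ne').symm, trivial⟩

end Natural

end

section

/-! ### Compositions of smooth fields -/

theorem contDiffAt_ten_iff {K : Vec → Ten} {x : Vec} :
    ContDiffAt ℝ ∞ K x ↔ ∀ i j, ContDiffAt ℝ ∞ (fun y => K y i j) x := by
  rw [contDiffAt_pi]
  exact forall_congr' fun i => contDiffAt_pi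

theorem contDiffAt_pd {g : Vec → ℝ} {x : Vec} (hg : ContDiffAt ℝ ∞ g x) (i : Fin 3) :
    ContDiffAt ℝ ∞ (pd i g) x :=
  (hg.fderiv_right (m := ∞) (by simp)).clm_apply contDiffAt_const

theorem contDiffAt_gradVec {K₀ : Vec → Vec} {K : Vec → ℝ} {x : Vec} (h₀ : ContDiffAt ℝ ∞ K₀ x)
    (h : ContDiffAt ℝ ∞ K x) : ContDiffAt ℝ ∞ (gradVec K₀ K) x :=
  ContDiffAt.sum fun i _ => (contDiffAt_pi.1 h₀ i).mul (contDiffAt_pd h i)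

theorem contDiffAt_gradSkew {K₀ : Vec → Ten} {K : Vec → ℝ} {x : Vec} (h₀ : ContDiffAt ℝ ∞ K₀ x)
    (h : ContDiffAt ℝ ∞ K x) : ContDiffAt ℝ ∞ (gradSkew K₀ K) x :=
  contDiffAt_pi.2 fun i => ContDiffAt.sum fun j _ =>
    (contDiffAt_ten_iff.1 h₀ i j).mul (contDiffAt_pd h j)

theorem contDiffAt_gradVol {ρ K : Vec → ℝ} {x : Vec} (hρ : ContDiffAt ℝ ∞ ρ x) (h0 : ρ x ≠ 0)
    (h : ContDiffAt ℝ ∞ K x) : ContDiffAt ℝ ∞ (gradVol ρ K) x :=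
  contDiffAt_ten_iff.2 fun _ _ => ContDiffAt.sum fun k _ =>
    (((contDiffAt_const (c := (1 : ℝ))).div hρ h0).mul contDiffAt_const).mul (contDiffAt_pd h k)

variable {a b c : ℕ}

namespace Composition

/-- A composition is defined on an open set of points, and its value is smooth there. -/
theorem DefinedAt.eventually_and_contDiffAt {ρ : Vec → ℝ} (hρ : ContDiff ℝ ∞ ρ)
    (hpos : ∀ y, 0 < ρ y) {D : Vec → Inputs a b c} (hD : SmoothInputs D) {κ : Kind}
    (T : Composition a b c κ) {x : Vec} (hT : T.DefinedAt ρ D x) :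
    (∀ᶠ y in 𝓝 x, T.DefinedAt ρ D y) ∧ ContDiffAt ℝ ∞ (T.eval ρ D) x := by
  have hρx : ContDiffAt ℝ ∞ ρ x := hρ.contDiffAt
  have hne : ρ x ≠ 0 := (hpos x).ne'
  have hinv : ContDiffAt ℝ ∞ (fun y => 1 / ρ y) x := contDiffAt_const.div hρx hne
  induction T with
  | inputScalar i =>
    exact ⟨Eventually.of_forall fun _ => trivial,
      contDiffAt_pi.1 (contDiff_fst.contDiffAt.comp x hD.smooth.contDiffAt) i⟩
  | inputVec i =>
    exact ⟨Eventually.of_forall fun _ => trivial,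
      contDiffAt_pi.1 ((contDiff_fst.comp contDiff_snd).contDiffAt.comp x
        hD.smooth.contDiffAt) i⟩
  | inputSkew i =>
    exact ⟨Eventually.of_forall fun _ => trivial,
      contDiffAt_pi.1 ((contDiff_snd.comp contDiff_snd).contDiffAt.comp x
        hD.smooth.contDiffAt) i⟩
  | func f O hO hf K ih =>
    have hK := fun i => ih i (hT.1 i)
    have hKi : ∀ i, @ContDiffAt ℝ _ Vec _ _ ℝ _ _ ∞ (fun y => (K i).eval ρ D y) x :=
      fun i => (hK i).2
    have hKs := contDiffAt_pi.2 hKi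
    refine ⟨?_, (hf.contDiffAt (hO.mem_nhds hT.2)).comp x hKs⟩
    filter_upwards [eventually_all.2 fun i => (hK i).1,
      hKs.continuousAt.preimage_mem_nhds (hO.mem_nhds hT.2)] with y h1 h2
    exact ⟨h1, h2⟩
  | gradVec K₀ K ih₀ ih =>
    obtain ⟨⟨d₀, s₀⟩, ⟨d, s⟩⟩ := And.intro (ih₀ hT.1) (ih hT.2)
    exact ⟨d₀.and d, contDiffAt_gradVec s₀ s⟩
  | gradSkew K₀ K ih₀ ih =>
    obtain ⟨⟨d₀, s₀⟩, ⟨d, s⟩⟩ := And.intro (ih₀ hT.1) (ih hT.2)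
    exact ⟨d₀.and d, contDiffAt_gradSkew s₀ s⟩
  | gradVol K ih =>
    obtain ⟨d, s⟩ := ih hT
    exact ⟨d, contDiffAt_gradVol hρx hne s⟩
  | mulVec K₀ K ih₀ ih =>
    obtain ⟨⟨d₀, s₀⟩, ⟨d, s⟩⟩ := And.intro (ih₀ hT.1) (ih hT.2)
    have e₀ : @ContDiffAt ℝ _ Vec _ _ ℝ _ _ ∞ (K₀.eval ρ D) x := s₀
    have e : @ContDiffAt ℝ _ Vec _ _ Vec _ _ ∞ (K.eval ρ D) x := s
    exact ⟨d₀.and d, e₀.smul e⟩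
  | mulSkew K₀ K ih₀ ih =>
    obtain ⟨⟨d₀, s₀⟩, ⟨d, s⟩⟩ := And.intro (ih₀ hT.1) (ih hT.2)
    have e₀ : @ContDiffAt ℝ _ Vec _ _ ℝ _ _ ∞ (K₀.eval ρ D) x := s₀
    have e : @ContDiffAt ℝ _ Vec _ _ Ten _ _ ∞ (K.eval ρ D) x := s
    exact ⟨d₀.and d, e₀.smul e⟩
  | addVec K L ih₀ ih =>
    obtain ⟨⟨d₀, s₀⟩, ⟨d, s⟩⟩ := And.intro (ih₀ hT.1) (ih hT.2)
    exact ⟨d₀.and d, ContDiffAt.add (f := (K.eval ρ D : Vec → Vec))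
      (g := (L.eval ρ D : Vec → Vec)) s₀ s⟩
  | addSkew K L ih₀ ih =>
    obtain ⟨⟨d₀, s₀⟩, ⟨d, s⟩⟩ := And.intro (ih₀ hT.1) (ih hT.2)
    exact ⟨d₀.and d, ContDiffAt.add (f := (K.eval ρ D : Vec → Ten))
      (g := (L.eval ρ D : Vec → Ten)) s₀ s⟩
  | wedgeVec K₀ K ih₀ ih =>
    obtain ⟨⟨d₀, s₀⟩, ⟨d, s⟩⟩ := And.intro (ih₀ hT.1) (ih hT.2)
    have e₀ := contDiffAt_pi.1 (show ContDiffAt ℝ ∞ (K₀.eval ρ D : Vec → Vec) x from s₀)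
    have e := contDiffAt_pi.1 (show ContDiffAt ℝ ∞ (K.eval ρ D : Vec → Vec) x from s)
    exact ⟨d₀.and d, contDiffAt_ten_iff.2 fun i j =>
      ((e₀ i).mul (e j)).sub ((e i).mul (e₀ j))⟩
  | crossVec K₀ K ih₀ ih =>
    obtain ⟨⟨d₀, s₀⟩, ⟨d, s⟩⟩ := And.intro (ih₀ hT.1) (ih hT.2)
    have e₀ := contDiffAt_ten_iff.1 (show ContDiffAt ℝ ∞ (K₀.eval ρ D : Vec → Ten) x from s₀)
    have e := contDiffAt_pi.1 (show ContDiffAt ℝ ∞ (K.eval ρ D : Vec → Vec) x from s)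
    exact ⟨d₀.and d, hρx.mul <| ContDiffAt.sum fun i _ => ContDiffAt.sum fun j _ =>
      ContDiffAt.sum fun k _ => (contDiffAt_const.mul (e₀ i j)).mul (e k)⟩
  | crossSkew K₀ K ih₀ ih =>
    obtain ⟨⟨d₀, s₀⟩, ⟨d, s⟩⟩ := And.intro (ih₀ hT.1) (ih hT.2)
    have e₀ := contDiffAt_ten_iff.1 (show ContDiffAt ℝ ∞ (K₀.eval ρ D : Vec → Ten) x from s₀)
    have e := contDiffAt_ten_iff.1 (show ContDiffAt ℝ ∞ (K.eval ρ D : Vec → Ten) x from s)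
    exact ⟨d₀.and d, contDiffAt_pi.2 fun i => hρx.mul <| ContDiffAt.sum fun j _ =>
      ContDiffAt.sum fun k _ => ContDiffAt.sum fun l _ =>
        (contDiffAt_const.mul (e₀ i j)).mul (e k l)⟩
  | divVec K ih =>
    obtain ⟨d, s⟩ := ih hT
    have e := contDiffAt_pi.1 (show ContDiffAt ℝ ∞ (K.eval ρ D : Vec → Vec) x from s)
    exact ⟨d, hinv.mul <| ContDiffAt.sum fun i _ => contDiffAt_pd (hρx.mul (e i)) i⟩
  | divSkew K ih =>
    obtain ⟨d, s⟩ := ih hT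
    have e := contDiffAt_ten_iff.1 (show ContDiffAt ℝ ∞ (K.eval ρ D : Vec → Ten) x from s)
    exact ⟨d, contDiffAt_pi.2 fun i => hinv.mul <| ContDiffAt.sum fun j _ =>
      contDiffAt_pd (hρx.mul (e j i)) j⟩

/-! ### Brackets and functions of scalars -/

/-- The value of a scalar composition, as a function with values in `ℝ`. -/
noncomputable def scalarEval (T : Composition a b c .scalar) (ρ : Vec → ℝ)
    (D : Vec → Inputs a b c) : Vec → ℝ := T.eval ρ D

/-- A smooth function of scalars that are indexed by a finite type. -/
noncomputable def funcOf {ι : Type} [Fintype ι] (f : (ι → ℝ) → ℝ) (O : Set (ι → ℝ)) (hO : IsOpen O)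
    (hf : ContDiffOn ℝ ∞ f O) (K : ι → Composition a b c .scalar) : Composition a b c .scalar :=
  .func (fun z => f (fun i => z (Fintype.equivFin ι i)))
    ((fun z (i : ι) => z (Fintype.equivFin ι i)) ⁻¹' O)
    (hO.preimage (by fun_prop))
    (hf.comp (ContDiff.contDiffOn (by fun_prop)) fun _ h => h)
    (fun i => K ((Fintype.equivFin ι).symm i))

section funcOf

variable {ι : Type} [Fintype ι] {f : (ι → ℝ) → ℝ} {O : Set (ι → ℝ)} {hO : IsOpen O}
  {hf : ContDiffOn ℝ ∞ f O} {K : ι → Composition a b c .scalar} {ρ : Vec → ℝ}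
  {D : Vec → Inputs a b c} {x : Vec}

theorem eval_funcOf : (funcOf f O hO hf K).scalarEval ρ D x = f (fun i => (K i).scalarEval ρ D x) := by
  change f (fun i => (K ((Fintype.equivFin ι).symm (Fintype.equivFin ι i))).scalarEval ρ D x) = _
  simp

theorem definedAt_funcOf : (funcOf f O hO hf K).DefinedAt ρ D x ↔
    (∀ i, (K i).DefinedAt ρ D x) ∧ (fun i => (K i).scalarEval ρ D x) ∈ O := by
  change (∀ i, (K ((Fintype.equivFin ι).symm i)).DefinedAt ρ D x) ∧
    (fun i => (K ((Fintype.equivFin ι).symm (Fintype.equivFin ι i))).scalarEval ρ D x) ∈ O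
    ↔ _
  simp [(Fintype.equivFin ι).symm.forall_congr_left]

theorem onlyScalarOps_funcOf (h : ∀ i, (K i).OnlyScalarOps) :
    (funcOf f O hO hf K).OnlyScalarOps := fun _ => h _

end funcOf

/-- The quotient of two scalars, defined where the denominator does not vanish. -/
noncomputable def quotient (A B : Composition a b c .scalar) : Composition a b c .scalar :=
  funcOf (fun z : Bool → ℝ => z false / z true) {z | z true ≠ 0}
    (isOpen_ne.preimage (continuous_apply true))
    (fun _ hz => ((contDiff_apply ℝ ℝ false).contDiffAt.div
      (contDiff_apply ℝ ℝ true).contDiffAt hz).contDiffWithinAt)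
    (fun i => bif i then B else A)

/-- The product of a scalar with the sign of another one, defined where the latter does not
vanish. -/
noncomputable def mulSign (A B : Composition a b c .scalar) : Composition a b c .scalar :=
  funcOf (fun z : Bool → ℝ => z false * (z true / |z true|)) {z | z true ≠ 0}
    (isOpen_ne.preimage (continuous_apply true))
    (fun z hz => (((contDiff_apply ℝ ℝ false).contDiffAt).mul
      ((contDiff_apply ℝ ℝ true).contDiffAt.div (ContDiffAt.comp (g := fun r : ℝ => |r|) z
      (contDiffAt_abs (show z true ≠ 0 from hz)) (contDiff_apply ℝ ℝ true).contDiffAt)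
      (abs_ne_zero.2 hz))).contDiffWithinAt)
    (fun i => bif i then B else A)

/-- The vector `(1/ρ) ∇A × ∇B`. -/
def cross (A B : Composition a b c .scalar) : Composition a b c .vec :=
  .gradSkew (.gradVol B) A

/-- The scalar `(1/ρ) ∇A · (∇B × ∇C)`. -/
def bracket (A B C : Composition a b c .scalar) : Composition a b c .scalar :=
  .gradVec (cross B C) A

section

variable {ρ : Vec → ℝ} {D : Vec → Inputs a b c} {x : Vec} {A B C : Composition a b c .scalar}

theorem eval_quotient : (quotient A B).scalarEval ρ D x =
    A.scalarEval ρ D x / B.scalarEval ρ D x := eval_funcOf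

theorem definedAt_quotient : (quotient A B).DefinedAt ρ D x ↔
    A.DefinedAt ρ D x ∧ B.DefinedAt ρ D x ∧ B.scalarEval ρ D x ≠ 0 := by
  refine definedAt_funcOf.trans ?_
  rw [Bool.forall_bool, and_assoc]
  rfl

theorem eval_mulSign : (mulSign A B).scalarEval ρ D x = A.scalarEval ρ D x *
    (B.scalarEval ρ D x / |B.scalarEval ρ D x|) := eval_funcOf

theorem definedAt_mulSign : (mulSign A B).DefinedAt ρ D x ↔
    A.DefinedAt ρ D x ∧ B.DefinedAt ρ D x ∧ B.scalarEval ρ D x ≠ 0 := by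
  refine definedAt_funcOf.trans ?_
  rw [Bool.forall_bool, and_assoc]
  rfl

theorem onlyScalarOps_quotient (hA : A.OnlyScalarOps) (hB : B.OnlyScalarOps) :
    (quotient A B).OnlyScalarOps :=
  onlyScalarOps_funcOf (Bool.forall_bool.2 ⟨hA, hB⟩)

theorem onlyScalarOps_mulSign (hA : A.OnlyScalarOps) (hB : B.OnlyScalarOps) :
    (mulSign A B).OnlyScalarOps :=
  onlyScalarOps_funcOf (Bool.forall_bool.2 ⟨hA, hB⟩)

theorem definedAt_cross : (cross A B).DefinedAt ρ D x ↔ A.DefinedAt ρ D x ∧ B.DefinedAt ρ D x :=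
  and_comm

theorem definedAt_bracket : (bracket A B C).DefinedAt ρ D x ↔
    A.DefinedAt ρ D x ∧ B.DefinedAt ρ D x ∧ C.DefinedAt ρ D x :=
  (and_congr definedAt_cross Iff.rfl).trans and_comm

theorem onlyScalarOps_bracket (hA : A.OnlyScalarOps) (hB : B.OnlyScalarOps)
    (hC : C.OnlyScalarOps) : (bracket A B C).OnlyScalarOps := ⟨⟨hC, hB⟩, hA⟩

end

end Composition

theorem gradSkew_gradVol (ρ A B : Vec → ℝ) (x : Vec) :
    gradSkew (gradVol ρ B) A x =
      ![(pd 1 A x * pd 2 B x - pd 2 A x * pd 1 B x) / ρ x,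
        (pd 2 A x * pd 0 B x - pd 0 A x * pd 2 B x) / ρ x,
        (pd 0 A x * pd 1 B x - pd 1 A x * pd 0 B x) / ρ x] := by
  funext i
  obtain rfl | rfl | rfl := fin_three_cases i <;>
  · simp [gradSkew, gradVol_apply, Fin.sum_univ_three]
    ring

theorem gradVec_gradSkew_gradVol (ρ A B C : Vec → ℝ) (x : Vec) :
    gradVec (gradSkew (gradVol ρ C) B) A x = (jac (fun y => ![A y, B y, C y]) x).det / ρ x := by
  simp [gradVec, gradSkew_gradVol, jac_apply, Fin.sum_univ_three, Matrix.det_fin_three]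
  ring

end

section

/-! ### Jets in terms of iterated partial derivatives -/

/-- The iterated partial derivative `∂_{w 0} ∂_{w 1} ⋯ g`. -/
noncomputable def pdWord (w : List (Fin 3)) (g : Vec → ℝ) : Vec → ℝ :=
  w.foldr pd g

theorem contDiff_pd {g : Vec → ℝ} (hg : ContDiff ℝ ∞ g) (i : Fin 3) : ContDiff ℝ ∞ (pd i g) :=
  contDiff_iff_contDiffAt.2 fun _ => contDiffAt_pd hg.contDiffAt i

theorem contDiff_pdWord {g : Vec → ℝ} (hg : ContDiff ℝ ∞ g) (w : List (Fin 3)) :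
    ContDiff ℝ ∞ (pdWord w g) := by
  induction w with
  | nil => exact hg
  | cons i w ih => exact contDiff_pd ih i

theorem iteratedFDeriv_single {g : Vec → ℝ} (hg : ContDiff ℝ ∞ g) {n : ℕ} (w : Fin n → Fin 3)
    (x : Vec) : iteratedFDeriv ℝ n g x (fun j => Pi.single (w j) 1) = pdWord (List.ofFn w) g x := by
  induction n generalizing x with
  | zero => simp [pdWord]
  | succ n ih =>
    rw [iteratedFDeriv_succ_apply_left, List.ofFn_succ]
    have hd : DifferentiableAt ℝ (iteratedFDeriv ℝ n g) x :=
      hg.differentiable_iteratedFDeriv (by exact_mod_cast WithTop.coe_lt_coe.2 (ENat.natCast_lt_top n)) x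
    have e : (fun y => iteratedFDeriv ℝ n g y (fun j : Fin n => Pi.single (w j.succ) 1)) =
        pdWord (List.ofFn fun j : Fin n => w j.succ) g := funext fun y => ih _ y
    change _ = pd (w 0) (pdWord (List.ofFn fun j : Fin n => w j.succ) g) x
    rw [← e, pd, fderiv_continuousMultilinear_apply_const_apply hd]
    rfl

/-- The scalar components of the density and of the inputs. -/
abbrev FieldIndex (a b c : ℕ) : Type := Unit ⊕ Fin a ⊕ (Fin b × Fin 3) ⊕ (Fin c × Fin 3 × Fin 3)

variable {a b c : ℕ}

/-- The scalar component fields of a density and of inputs. -/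
def fieldComponent (ρ : Vec → ℝ) (D : Vec → Inputs a b c) : FieldIndex a b c → Vec → ℝ
  | .inl _ => ρ
  | .inr (.inl i) => fun y => (D y).1 i
  | .inr (.inr (.inl q)) => fun y => (D y).2.1 q.1 q.2
  | .inr (.inr (.inr q)) => fun y => (D y).2.2 q.1 q.2.1 q.2.2

theorem contDiff_fieldComponent {ρ : Vec → ℝ} (hρ : ContDiff ℝ ∞ ρ) {D : Vec → Inputs a b c}
    (hD : ContDiff ℝ ∞ D) (r : FieldIndex a b c) : ContDiff ℝ ∞ (fieldComponent ρ D r) := by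
  match r with
  | .inl _ => exact hρ
  | .inr (.inl i) => exact contDiff_pi.1 hD.fst i
  | .inr (.inr (.inl q)) => exact contDiff_pi.1 (contDiff_pi.1 hD.snd.fst q.1) q.2
  | .inr (.inr (.inr q)) =>
    exact contDiff_pi.1 (contDiff_pi.1 (contDiff_pi.1 hD.snd.snd q.1) q.2.1) q.2.2

/-- The configuration at rest with given scalar components of the density and of the inputs. -/
noncomputable def restConfig : (FieldIndex a b c → ℝ) →L[ℝ] Config a b c :=
  LinearMap.toContinuousLinearMap
    { toFun := fun z => (0, z (.inl ()), fun i => z (.inr (.inl i)),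
        fun i j => z (.inr (.inr (.inl (i, j)))), fun i j k => z (.inr (.inr (.inr (i, j, k)))))
      map_add' := fun z z' => by ext <;> simp
      map_smul' := fun r z => by ext <;> simp }

theorem restConfig_apply (z : FieldIndex a b c → ℝ) :
    restConfig z = (0, z (.inl ()), fun i => z (.inr (.inl i)),
      fun i j => z (.inr (.inr (.inl (i, j)))), fun i j k => z (.inr (.inr (.inr (i, j, k))))) :=
  rfl

/-- The indices of the derivatives of the scalar components, of orders up to `k`. -/
abbrev JetIndex (k a b c : ℕ) : Type :=
  (Σ n : Fin (k + 1), (Fin (n : ℕ) → Fin 3)) × FieldIndex a b c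

/-- The product of the coordinates `w j` of the arguments, as a multilinear form. -/
noncomputable def coordProduct {n : ℕ} (w : Fin n → Fin 3) :
    ContinuousMultilinearMap ℝ (fun _ : Fin n => Vec) ℝ :=
  (ContinuousMultilinearMap.mkPiAlgebra ℝ (Fin n) ℝ).compContinuousLinearMap
    fun j => ContinuousLinearMap.proj (w j)

theorem coordProduct_apply {n : ℕ} (w : Fin n → Fin 3) (v : Fin n → Vec) :
    coordProduct w v = ∏ j, v j (w j) := by
  simp [coordProduct]

/-- A multilinear map is determined by its values on the coordinate vectors. -/
theorem multilinear_eq_sum {n : ℕ} {E : Type*} [NormedAddCommGroup E] [NormedSpace ℝ E]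
    (M : ContinuousMultilinearMap ℝ (fun _ : Fin n => Vec) E) :
    M = ∑ w : Fin n → Fin 3, (coordProduct w).smulRight (M fun j => Pi.single (w j) 1) := by
  refine ContinuousMultilinearMap.ext fun v => ?_
  have hv : v = fun j => ∑ i, v j i • (Pi.single i 1 : Vec) := by
    funext j
    exact (sum_mul_single (v j)).symm
  conv_lhs => rw [hv]
  rw [ContinuousMultilinearMap.map_sum, sum_apply]
  refine Finset.sum_congr rfl fun w _ => ?_
  rw [ContinuousMultilinearMap.map_smul_univ, ContinuousMultilinearMap.smulRight_apply,
    coordProduct_apply]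

/-- The jet of a configuration at rest with given derivatives of the scalar components. -/
noncomputable def restJet (k : ℕ) (z : JetIndex k a b c → ℝ) : Jet k a b c :=
  fun n => ∑ w : Fin (n : ℕ) → Fin 3,
    (coordProduct w).smulRight (restConfig fun r => z (⟨n, w⟩, r))

theorem contDiff_restJet (k : ℕ) : ContDiff ℝ ∞ (restJet k : (JetIndex k a b c → ℝ) → _) := by
  refine contDiff_pi.2 fun n => ContDiff.sum fun w _ => ?_
  exact (ContinuousMultilinearMap.smulRightL ℝ (fun _ : Fin (n : ℕ) => Vec) (Config a b c)
    (coordProduct w)).contDiff.comp (restConfig.contDiff.comp (by fun_prop))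

theorem density_restJet (k : ℕ) (z : JetIndex k a b c → ℝ) :
    (restJet k z).density = z (⟨0, Fin.elim0⟩, .inl ()) := by
  have h : restJet k z 0 = (coordProduct (n := 0) Fin.elim0).smulRight
      (restConfig fun r => z (⟨0, Fin.elim0⟩, r)) :=
    Fintype.sum_eq_single (α := Fin 0 → Fin 3) Fin.elim0
      fun w hw => (hw (Subsingleton.elim _ _)).elim
  rw [Jet.density, h]
  change ((coordProduct (n := 0) Fin.elim0 fun _ => 0) • restConfig _).2.1 = _
  simp [coordProduct_apply, restConfig_apply]

theorem jet_eq_restJet (k : ℕ) {ρ : Vec → ℝ} (hρ : ContDiff ℝ ∞ ρ) {D : Vec → Inputs a b c}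
    (hD : ContDiff ℝ ∞ D) (x : Vec) :
    jet k 0 ρ D x = restJet k fun q => pdWord (List.ofFn q.1.2) (fieldComponent ρ D q.2) x := by
  funext n
  have hs := contDiff_fieldComponent hρ hD
  have e : (fun y => (((0 : Vec → Vec) y, ρ y, D y) : Config a b c)) =
      restConfig ∘ fun y r => fieldComponent ρ D r y := rfl
  have hn : ((n : ℕ) : WithTop ℕ∞) ≤ ∞ := by exact_mod_cast le_top
  refine (multilinear_eq_sum _).trans (Finset.sum_congr rfl fun w _ => ?_)
  rw [jet, e, ContinuousLinearMap.iteratedFDeriv_comp_left restConfig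
    (contDiff_pi.2 hs).contDiffAt hn]
  refine congrArg _ (congrArg restConfig ?_)
  funext r
  have h := ContinuousLinearMap.iteratedFDeriv_comp_left
    (ContinuousLinearMap.proj r : (FieldIndex a b c → ℝ) →L[ℝ] ℝ)
    (contDiff_pi.2 hs).contDiffAt (x := x) hn
  refine Eq.trans ?_ (iteratedFDeriv_single (hs r) w x)
  exact (congrArg (fun M => M fun j => Pi.single (w j) 1) h).symm

end

section

variable {a b c : ℕ}

/-! ### Coordinates generated by compositions -/

theorem gradVec_gradSkew (K : Vec → Ten) (A B : Vec → ℝ) (x : Vec) :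
    gradVec (gradSkew K B) A x = ∑ k, ∑ l, pd k A x * pd l B x * K x k l := by
  simp only [gradVec, gradSkew, Finset.sum_mul]
  exact Finset.sum_congr rfl fun i _ => Finset.sum_congr rfl fun j _ => by ring

namespace Composition

/-- The densitized Jacobian determinant `(1/ρ) det (∂Sᵢ/∂xʲ)` of three scalars. -/
def jacobian (S : Fin 3 → Composition a b c .scalar) : Composition a b c .scalar :=
  bracket (S 0) (S 1) (S 2)

/-- The values of three scalars, as a map of space. -/
noncomputable def toMap (S : Fin 3 → Composition a b c .scalar) (ρ : Vec → ℝ)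
    (D : Vec → Inputs a b c) (y : Vec) : Vec := fun i => (S i).scalarEval ρ D y

section

variable {S : Fin 3 → Composition a b c .scalar} {ρ : Vec → ℝ} {D : Vec → Inputs a b c} {x : Vec}

theorem eval_jacobian : (jacobian S).scalarEval ρ D x = (jac (toMap S ρ D) x).det / ρ x := by
  refine (gradVec_gradSkew_gradVol ρ ((S 0).scalarEval ρ D) ((S 1).scalarEval ρ D)
    ((S 2).scalarEval ρ D) x).trans ?_
  congr 3
  funext y i
  obtain rfl | rfl | rfl := fin_three_cases i <;> rfl

theorem definedAt_jacobian : (jacobian S).DefinedAt ρ D x ↔ ∀ i, (S i).DefinedAt ρ D x := by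
  rw [jacobian, definedAt_bracket, Fin.forall_fin_succ, Fin.forall_fin_two]
  rfl

theorem onlyScalarOps_jacobian (h : ∀ i, (S i).OnlyScalarOps) : (jacobian S).OnlyScalarOps :=
  onlyScalarOps_bracket (h 0) (h 1) (h 2)

end

/-- Three scalars with positive Jacobian: the last of the given scalars is multiplied by the sign
of their Jacobian. They are defined where this Jacobian does not vanish. -/
noncomputable def oriented (S : Fin 3 → Composition a b c .scalar) :
    Fin 3 → Composition a b c .scalar :=
  Function.update S 2 (mulSign (S 2) (jacobian S))

/-- The derivative `∂F/∂yᵢ` with respect to the scalars `y = oriented S`, used as coordinates. -/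
noncomputable def partialDeriv (S : Fin 3 → Composition a b c .scalar) (i : Fin 3)
    (F : Composition a b c .scalar) : Composition a b c .scalar :=
  quotient (jacobian (Function.update (oriented S) i F)) (jacobian (oriented S))

/-- The constant scalar. -/
def const (r : ℝ) : Composition a b c .scalar :=
  .func (m := 0) (fun _ => r) univ isOpen_univ contDiffOn_const Fin.elim0

/-- The components in the coordinates `oriented S` of the density and of the inputs. -/
noncomputable def component (S : Fin 3 → Composition a b c .scalar) :
    FieldIndex a b c → Composition a b c .scalar
  | .inl _ => quotient (const 1) (jacobian (oriented S))
  | .inr (.inl i) => .inputScalar i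
  | .inr (.inr (.inl q)) => .gradVec (.inputVec q.1) (oriented S q.2)
  | .inr (.inr (.inr q)) =>
      .gradVec (.gradSkew (.inputSkew q.1) (oriented S q.2.2)) (oriented S q.2.1)

/-- The iterated derivatives in the coordinates `oriented S` of the components of the density and
of the inputs, preceded by the coordinates themselves. -/
noncomputable def jetScalar (S : Fin 3 → Composition a b c .scalar) (k : ℕ) :
    Fin 3 ⊕ JetIndex k a b c → Composition a b c .scalar
  | .inl i => oriented S i
  | .inr q => (List.ofFn q.1.2).foldr (partialDeriv S) (component S q.2)

section

variable {S : Fin 3 → Composition a b c .scalar} (hS : ∀ i ρ D x, (S i).DefinedAt ρ D x)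
  {ρ : Vec → ℝ} {D : Vec → Inputs a b c} {x : Vec}

theorem onlyScalarOps_oriented (h : ∀ i, (S i).OnlyScalarOps) (i : Fin 3) :
    (oriented S i).OnlyScalarOps := by
  obtain rfl | rfl | rfl := fin_three_cases i
  · exact h 0
  · exact h 1
  · exact onlyScalarOps_mulSign (h 2) (onlyScalarOps_jacobian h)

theorem onlyScalarOps_jetScalar (h : ∀ i, (S i).OnlyScalarOps) (k : ℕ)
    (q : Fin 3 ⊕ JetIndex k a b c) : (jetScalar S k q).OnlyScalarOps := by
  have ho := onlyScalarOps_oriented h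
  have hj := onlyScalarOps_jacobian ho
  match q with
  | .inl i => exact ho i
  | .inr (w, r) =>
    simp only [jetScalar]
    induction List.ofFn w.2 with
    | nil =>
      match r with
      | .inl _ => exact onlyScalarOps_quotient (fun i => i.elim0) hj
      | .inr (.inl i) => trivial
      | .inr (.inr (.inl q)) => exact ⟨trivial, ho _⟩
      | .inr (.inr (.inr q)) => exact ⟨⟨trivial, ho _⟩, ho _⟩
    | cons i l ih =>
      refine onlyScalarOps_quotient (onlyScalarOps_jacobian fun j => ?_) hj
      by_cases hj : j = i
      · subst hj; rw [Function.update_self]; exact ih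
      · rw [Function.update_of_ne hj]; exact ho j

include hS

theorem definedAt_oriented_two : (oriented S 2).DefinedAt ρ D x ↔
    (jacobian S).scalarEval ρ D x ≠ 0 := by
  refine definedAt_mulSign.trans ⟨fun h => h.2.2, fun h => ⟨hS _ _ _ _, ?_, h⟩⟩
  exact definedAt_jacobian.2 fun i => hS _ _ _ _

theorem definedAt_oriented (h : (jacobian S).scalarEval ρ D x ≠ 0) (i : Fin 3) :
    (oriented S i).DefinedAt ρ D x := by
  obtain rfl | rfl | rfl := fin_three_cases i
  · exact hS 0 _ _ _
  · exact hS 1 _ _ _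
  · exact (definedAt_oriented_two hS).2 h

section

variable (hρ : ContDiff ℝ ∞ ρ) (hpos : ∀ y, 0 < ρ y) (hD : SmoothInputs D)
  (h : (jacobian S).scalarEval ρ D x ≠ 0)

include hρ hpos hD h

theorem eventually_jacobian_ne_zero :
    ∀ᶠ y in 𝓝 x, (jacobian S).scalarEval ρ D y ≠ 0 := by
  have hs : ContDiffAt ℝ ∞ ((jacobian S).scalarEval ρ D) x :=
    (DefinedAt.eventually_and_contDiffAt hρ hpos hD (jacobian S)
      (definedAt_jacobian.2 fun i => hS _ _ _ _)).2
  exact hs.continuousAt.eventually_ne h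

theorem contDiffAt_toMap_oriented : ContDiffAt ℝ ∞ (toMap (oriented S) ρ D) x :=
  contDiffAt_pi.2 fun i =>
    (DefinedAt.eventually_and_contDiffAt hρ hpos hD _ (definedAt_oriented hS h i)).2

/-- The sign by which the last scalar is multiplied is locally constant, hence it multiplies the
Jacobian too. -/
theorem det_jac_toMap_oriented : 0 < (jac (toMap (oriented S) ρ D) x).det := by
  have hs : ContDiffAt ℝ ∞ ((jacobian S).scalarEval ρ D) x :=
    (DefinedAt.eventually_and_contDiffAt hρ hpos hD (jacobian S)
      (definedAt_jacobian.2 fun i => hS _ _ _ _)).2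
  have hs2 : DifferentiableAt ℝ (fun y => toMap S ρ D y 2) x :=
    (show ContDiffAt ℝ ∞ ((S 2).scalarEval ρ D) x from
      (DefinedAt.eventually_and_contDiffAt hρ hpos hD (S 2) (hS _ _ _ _)).2).differentiableAt
      (by simp)
  -- The sign of the Jacobian is locally constant.
  obtain ⟨s, hs0, hs1⟩ : ∃ s : ℝ, 0 < s * (jacobian S).scalarEval ρ D x ∧
      ∀ᶠ y in 𝓝 x, (jacobian S).scalarEval ρ D y /
        |(jacobian S).scalarEval ρ D y| = s := by
    rcases lt_or_gt_of_ne h with h | h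
    · exact ⟨-1, by linarith, (hs.continuousAt.eventually (gt_mem_nhds h)).mono fun y hy => by
        rw [abs_of_neg hy, div_neg, div_self (ne_of_lt hy)]⟩
    · exact ⟨1, by linarith, (hs.continuousAt.eventually (lt_mem_nhds h)).mono fun y hy => by
        rw [abs_of_pos hy, div_self (ne_of_gt hy)]⟩
  have h2 : ∀ j, pd j (fun y => toMap (oriented S) ρ D y 2) x =
      s * pd j (fun y => toMap S ρ D y 2) x := by
    intro j
    have e : (fun y => toMap (oriented S) ρ D y 2) =ᶠ[𝓝 x] fun y => s * toMap S ρ D y 2 :=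
      hs1.mono fun y hy => by
        refine (eval_mulSign (A := S 2) (B := jacobian S)).trans ?_
        rw [hy, mul_comm]
        rfl
    rw [pd_congr e, pd_mul (differentiableAt_const s) hs2, pd_const,
      zero_mul, add_zero]
  have e0 : ∀ j, pd j (fun y => toMap (oriented S) ρ D y 0) x =
    pd j (fun y => toMap S ρ D y 0) x := fun j => rfl
  have e1 : ∀ j, pd j (fun y => toMap (oriented S) ρ D y 1) x =
    pd j (fun y => toMap S ρ D y 1) x := fun j => rfl
  rw [eval_jacobian, mul_div_assoc', lt_div_iff₀ (hpos x), zero_mul] at hs0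
  have e : (jac (toMap (oriented S) ρ D) x).det = s * (jac (toMap S ρ D) x).det := by
    rw [Matrix.det_fin_three, Matrix.det_fin_three]
    simp only [jac_apply, h2, e0, e1]
    ring
  rwa [e]

theorem eval_jacobian_oriented_ne_zero :
    (jacobian (oriented S)).scalarEval ρ D x ≠ 0 := by
  rw [eval_jacobian]
  exact div_ne_zero (det_jac_toMap_oriented hS hρ hpos hD h).ne' (hpos x).ne'

end

/-- Near `x`, the composition `F` is defined and is the function `g` of the coordinates
`oriented S`. -/
def PullsBack (S : Fin 3 → Composition a b c .scalar) (ρ : Vec → ℝ) (D : Vec → Inputs a b c)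
    (x : Vec) (F : Composition a b c .scalar) (g : Vec → ℝ) : Prop :=
  ∀ᶠ y in 𝓝 x, F.DefinedAt ρ D y ∧ F.scalarEval ρ D y = g (toMap (oriented S) ρ D y)

section

variable (hρ : ContDiff ℝ ∞ ρ) (hpos : ∀ y, 0 < ρ y) (hD : SmoothInputs D)

include hρ hpos hD

/-- By the chain rule, a quotient of Jacobians is the partial derivative in the new coordinates. -/
theorem eval_partialDeriv (h : (jacobian S).scalarEval ρ D x ≠ 0)
    {F : Composition a b c .scalar} {g : Vec → ℝ}
    (hg : ContDiff ℝ ∞ g) (hF : PullsBack S ρ D x F g) (i : Fin 3) :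
    (partialDeriv S i F).DefinedAt ρ D x ∧
      (partialDeriv S i F).scalarEval ρ D x = pd i g (toMap (oriented S) ρ D x) := by
  have hne := eval_jacobian_oriented_ne_zero hS hρ hpos hD h
  constructor
  · refine definedAt_quotient.2 ⟨definedAt_jacobian.2 fun j => ?_,
      definedAt_jacobian.2 fun j => definedAt_oriented hS h j, hne⟩
    by_cases hj : j = i
    · subst hj; rw [Function.update_self]; exact hF.self_of_nhds.1
    · rw [Function.update_of_ne hj]; exact definedAt_oriented hS h j
  · have hdet := det_jac_toMap_oriented hS hρ hpos hD h
    refine eval_quotient.trans ?_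
    rw [eval_jacobian, eval_jacobian, div_div_div_cancel_right₀ (hpos x).ne', div_eq_iff hdet.ne']
    have hφ : DifferentiableAt ℝ (toMap (oriented S) ρ D) x :=
      (contDiffAt_toMap_oriented hS hρ hpos hD h).differentiableAt (by simp)
    have hF' : ∀ j, pd j (fun y => toMap (Function.update (oriented S) i F) ρ D y i) x =
        ∑ k, pd k g (toMap (oriented S) ρ D x) * jac (toMap (oriented S) ρ D) x k j := by
      intro j
      rw [← pd_comp ((hg.differentiable (by simp)) _) hφ]
      refine pd_congr (hF.mono fun y hy => ?_) j
      simp only [toMap, Function.update_self]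
      exact hy.2
    have hne : ∀ l j, l ≠ i →
        pd j (fun y => toMap (Function.update (oriented S) i F) ρ D y l) x =
          jac (toMap (oriented S) ρ D) x l j := by
      intro l j hl
      simp only [toMap, Function.update_of_ne hl]
      rfl
    obtain rfl | rfl | rfl := fin_three_cases i
    · rw [Matrix.det_fin_three, Matrix.det_fin_three]
      simp only [jac_apply _ _ (_ : Fin 3)] at hF' hne ⊢
      simp only [hF', hne 1 _ (by decide), hne 2 _ (by decide), Fin.sum_univ_three]
      ring
    · rw [Matrix.det_fin_three, Matrix.det_fin_three]
      simp only [jac_apply _ _ (_ : Fin 3)] at hF' hne ⊢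
      simp only [hF', hne 0 _ (by decide), hne 2 _ (by decide), Fin.sum_univ_three]
      ring
    · rw [Matrix.det_fin_three, Matrix.det_fin_three]
      simp only [jac_apply _ _ (_ : Fin 3)] at hF' hne ⊢
      simp only [hF', hne 0 _ (by decide), hne 1 _ (by decide), Fin.sum_univ_three]
      ring

theorem PullsBack.partialDeriv (h : (jacobian S).scalarEval ρ D x ≠ 0)
    {F : Composition a b c .scalar} {g : Vec → ℝ}
    (hg : ContDiff ℝ ∞ g) (hF : PullsBack S ρ D x F g) (i : Fin 3) :
    PullsBack S ρ D x (partialDeriv S i F) (pd i g) := by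
  filter_upwards [eventually_jacobian_ne_zero hS hρ hpos hD h, eventually_eventually_nhds.2 hF]
    with y hy hFy
  exact eval_partialDeriv hS hρ hpos hD hy hg hFy i

theorem PullsBack.pdWord (h : (jacobian S).scalarEval ρ D x ≠ 0)
    {F : Composition a b c .scalar} {g : Vec → ℝ}
    (hg : ContDiff ℝ ∞ g) (hF : PullsBack S ρ D x F g) (w : List (Fin 3)) :
    PullsBack S ρ D x (w.foldr (Composition.partialDeriv S) F) (pdWord w g) := by
  induction w with
  | nil => exact hF
  | cons i w ih => exact ih.partialDeriv hS hρ hpos hD h (contDiff_pdWord hg w) i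

theorem pullsBack_component (h : (jacobian S).scalarEval ρ D x ≠ 0)
    {ρ' : Vec → ℝ} {D' : Vec → Inputs a b c}
    (hc : Carries (toMap (oriented S) ρ D) x ρ D ρ' D') (r : FieldIndex a b c) :
    PullsBack S ρ D x (component S r) (fieldComponent ρ' D' r) := by
  filter_upwards [eventually_jacobian_ne_zero hS hρ hpos hD h, hc] with y hy hcy
  have ho := definedAt_oriented hS hy
  match r with
  | .inl _ =>
    refine ⟨definedAt_quotient.2 ⟨⟨fun i => i.elim0, trivial⟩, definedAt_jacobian.2 ho,
      eval_jacobian_oriented_ne_zero hS hρ hpos hD hy⟩, eval_quotient.trans ?_⟩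
    rw [eval_jacobian]
    change 1 / _ = ρ' _
    rw [one_div_div, hcy.1, mul_div_cancel_right₀ _ (det_jac_toMap_oriented hS hρ hpos hD hy).ne']
  | .inr (.inl i) =>
    refine ⟨trivial, ?_⟩
    change (D y).1 i = (D' _).1 i
    rw [hcy.2]
    rfl
  | .inr (.inr (.inl q)) =>
    refine ⟨⟨trivial, ho _⟩, ?_⟩
    change MaterialOps.gradVec _ _ _ = (D' _).2.1 q.1 q.2
    rw [hcy.2]
    change _ = pushVec _ _ _
    rw [pushVec_apply]
    exact Finset.sum_congr rfl fun j _ => mul_comm _ _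
  | .inr (.inr (.inr q)) =>
    refine ⟨⟨⟨trivial, ho _⟩, ho _⟩, ?_⟩
    change MaterialOps.gradVec _ _ _ = (D' _).2.2 q.1 q.2.1 q.2.2
    rw [hcy.2]
    exact gradVec_gradSkew _ _ _ _

end

end

end Composition

end

section

variable {a b c : ℕ} {κ : Kind}

/-! ### Smoothness and symmetry of the values at rest -/

/-- The constant isotopy. -/
noncomputable def Isotopy.refl : Isotopy where
  toFun := fun _ x => x
  inv := fun _ x => x
  smooth := contDiff_snd
  smooth_inv := contDiff_snd
  left_inv := fun _ _ => rfl
  right_inv := fun _ _ => rfl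

/-- In a fluid at rest, the value of a material operation is an invariant. -/
theorem LocalOperator.IsMaterial.isInvariantOn_rest {Φ : LocalOperator a b c κ}
    (hΦ : Φ.IsMaterial) {ρ : Vec → ℝ} (hρ : ContDiff ℝ ∞ ρ) (hpos : ∀ y, 0 < ρ y)
    {D : Vec → Inputs a b c} (hD : SmoothInputs D) :
    IsInvariantOn κ univ (fun _ => 0) (fun _ => Φ.rest ρ D) := by
  have h := hΦ _ _ _ (Isotopy.refl.isFlowOn (t₀ := 0) (fun _ => rfl) hρ hpos)
    (Isotopy.refl.inputsInvariantOn hD)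
  have e0 : Isotopy.refl.velocity = fun _ => 0 := by
    funext t y i
    exact deriv_const _ _
  have e1 : Isotopy.refl.density ρ = fun _ => ρ := by
    funext t y; simp [Isotopy.density, Isotopy.refl, jac_id]
  have e2 : Isotopy.refl.inputs D = fun _ => D := by
    funext t y; simp [Isotopy.inputs, Isotopy.refl, jac_id, pushInputs_one]
  rw [e0, e1, e2] at h
  convert h using 1
  funext t x
  exact (hΦ.apply_eq_rest t contDiff_const hρ hpos hD x).symm

theorem LocalOperator.IsMaterial.symm_rest {Φ : LocalOperator a b c κ} (hΦ : Φ.IsMaterial)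
    {ρ : Vec → ℝ} (hρ : ContDiff ℝ ∞ ρ) (hpos : ∀ y, 0 < ρ y) {D : Vec → Inputs a b c}
    (hD : SmoothInputs D) (x : Vec) : κ.Symm (Φ.rest ρ D x) :=
  (hΦ.isInvariantOn_rest hρ hpos hD).symm (0, x) trivial

theorem LocalOperator.IsMaterial.contDiff_rest {Φ : LocalOperator a b c κ} (hΦ : Φ.IsMaterial)
    {ρ : Vec → ℝ} (hρ : ContDiff ℝ ∞ ρ) (hpos : ∀ y, 0 < ρ y) {D : Vec → Inputs a b c}
    (hD : SmoothInputs D) : ContDiff ℝ ∞ (Φ.rest ρ D) :=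
  (contDiffOn_univ.1 (hΦ.isInvariantOn_rest hρ hpos hD).smooth).comp
    (contDiff_const.prodMk contDiff_id : ContDiff ℝ ∞ fun x : Vec => ((0 : ℝ), x))

theorem pushSkew_add (M : Matrix (Fin 3) (Fin 3) ℝ) (A B : Ten) :
    pushSkew M (A + B) = pushSkew M A + pushSkew M B := by
  funext i j
  simp [pushSkew, mul_add, Finset.sum_add_distrib]

theorem pushSkew_smul (M : Matrix (Fin 3) (Fin 3) ℝ) (r : ℝ) (A : Ten) :
    pushSkew M (r • A) = r • pushSkew M A := by
  funext i j
  simp [pushSkew, Finset.mul_sum, mul_left_comm]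

theorem pushSkew_wedge (M : Matrix (Fin 3) (Fin 3) ℝ) (v w : Vec) :
    pushSkew M (fun k l => v k * w l - w k * v l) =
      fun k l => pushVec M v k * pushVec M w l - pushVec M w k * pushVec M v l := by
  funext i j
  simp only [pushSkew, pushVec_apply, Fin.sum_univ_three]
  ring

namespace Composition

/-! ### Material operations in generated coordinates -/

theorem contDiffOn_toFun_restJet (Φ : LocalOperator a b c κ) :
    ContDiffOn ℝ ∞ (fun z : Fin 3 ⊕ JetIndex Φ.order a b c → ℝ =>
      Φ.toFun 0 (fun i => z (.inl i)) (restJet Φ.order fun q => z (.inr q)))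
      {z | 0 < z (.inr (⟨0, Fin.elim0⟩, .inl ()))} := by
  have h1 : ContDiff ℝ ∞ (fun z : Fin 3 ⊕ JetIndex Φ.order a b c → ℝ => fun i => z (.inl i)) :=
    contDiff_pi.2 fun i => contDiff_apply ℝ ℝ _
  have h2 : ContDiff ℝ ∞ (fun z : Fin 3 ⊕ JetIndex Φ.order a b c → ℝ => fun q => z (.inr q)) :=
    contDiff_pi.2 fun q => contDiff_apply ℝ ℝ _
  have h3 : ContDiff ℝ ∞ (fun z : Fin 3 ⊕ JetIndex Φ.order a b c → ℝ =>
      ((0, fun i => z (.inl i), restJet Φ.order fun q => z (.inr q)) :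
        ℝ × Vec × Jet Φ.order a b c)) := by
    have h := h1.prodMk ((contDiff_restJet (a := a) (b := b) (c := c) Φ.order).comp h2)
    exact contDiff_const.prodMk h
  have hm : MapsTo (fun z : Fin 3 ⊕ JetIndex Φ.order a b c → ℝ =>
      ((0, fun i => z (.inl i), restJet Φ.order fun q => z (.inr q)) :
        ℝ × Vec × Jet Φ.order a b c))
      {z | 0 < z (.inr (⟨0, Fin.elim0⟩, .inl ()))} {q | 0 < q.2.2.density} := by
    intro z hz
    change 0 < (restJet Φ.order fun q => z (.inr q)).density
    rw [density_restJet]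
    exact hz
  have h4 := h3.contDiffOn (s := {z | 0 < z (.inr (⟨0, Fin.elim0⟩, .inl ()))})
  exact Φ.smooth.comp h4 hm

/-- A smooth function `ℓ` of the value of a local operator, computed in the coordinates
`oriented S` from the jets of the density and of the inputs. -/
noncomputable def observable (S : Fin 3 → Composition a b c .scalar) (Φ : LocalOperator a b c κ)
    (ℓ : κ.Val → ℝ) (hℓ : ContDiff ℝ ∞ ℓ) : Composition a b c .scalar :=
  funcOf (ι := Fin 3 ⊕ JetIndex Φ.order a b c)
    (fun z => ℓ (Φ.toFun 0 (fun i => z (.inl i)) (restJet Φ.order fun q => z (.inr q))))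
    {z | 0 < z (.inr (⟨0, Fin.elim0⟩, .inl ()))}
    (isOpen_lt continuous_const (continuous_apply _))
    (hℓ.comp_contDiffOn (contDiffOn_toFun_restJet Φ))
    (jetScalar S Φ.order)

/-- The vector `∂x/∂yᵢ` of the coordinate frame of `oriented S`. -/
noncomputable def frame (S : Fin 3 → Composition a b c .scalar) (i : Fin 3) :
    Composition a b c .vec :=
  .mulVec (quotient (const 1) (jacobian (oriented S)))
    (cross (oriented S (i + 1)) (oriented S (i + 2)))

/-- The composition that computes a material operation from its components in the coordinates
`oriented S`. -/
noncomputable def representation (S : Fin 3 → Composition a b c .scalar) :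
    {κ : Kind} → LocalOperator a b c κ → Composition a b c κ
  | .scalar, Φ => observable S Φ (fun v : ℝ => v) contDiff_id
  | .vec, Φ =>
    let term : Fin 3 → Composition a b c .vec := fun i =>
      .mulVec (observable S Φ (fun v : Vec => v i) (contDiff_apply ℝ ℝ i)) (frame S i)
    .addVec (.addVec (term 0) (term 1)) (term 2)
  | .skew, Φ =>
    let term : Fin 3 → Fin 3 → Composition a b c .skew := fun i j =>
      .mulSkew (observable S Φ (fun A : Ten => A i j) (contDiff_apply_apply ℝ ℝ i j))
        (.wedgeVec (frame S i) (frame S j))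
    .addSkew (.addSkew (term 0 1) (term 0 2)) (term 1 2)

variable {S : Fin 3 → Composition a b c .scalar}

theorem representation_scalar (Φ : LocalOperator a b c .scalar) :
    representation S Φ = observable S Φ (fun v : ℝ => v) contDiff_id := rfl

theorem onlyScalarOps_representation (h : ∀ i, (S i).OnlyScalarOps)
    (Φ : LocalOperator a b c .scalar) : (representation S Φ).OnlyScalarOps := by
  rw [representation_scalar]
  exact onlyScalarOps_funcOf (onlyScalarOps_jetScalar h _)

variable (hS : ∀ i ρ D x, (S i).DefinedAt ρ D x) {Φ : LocalOperator a b c κ}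
  {ℓ : κ.Val → ℝ} {hℓ : ContDiff ℝ ∞ ℓ}
  {ρ : Vec → ℝ} (hρ : ContDiff ℝ ∞ ρ) (hpos : ∀ y, 0 < ρ y)
  {D : Vec → Inputs a b c} (hD : SmoothInputs D) {x : Vec}

include hS in
theorem jacobian_ne_zero_of_definedAt_observable (h : (observable S Φ ℓ hℓ).DefinedAt ρ D x) :
    (jacobian S).scalarEval ρ D x ≠ 0 :=
  (definedAt_oriented_two hS).1 ((definedAt_funcOf.1 h).1 (.inl 2))

include hS hρ hpos hD

theorem pullsBack_jetScalar (h : (jacobian S).scalarEval ρ D x ≠ 0) {ρ' : Vec → ℝ}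
    {D' : Vec → Inputs a b c} (hρ' : ContDiff ℝ ∞ ρ') (hD' : ContDiff ℝ ∞ D')
    (hc : Carries (toMap (oriented S) ρ D) x ρ D ρ' D') {k : ℕ} (q : JetIndex k a b c) :
    PullsBack S ρ D x (jetScalar S k (.inr q))
      (pdWord (List.ofFn q.1.2) (fieldComponent ρ' D' q.2)) :=
  PullsBack.pdWord hS hρ hpos hD h (contDiff_fieldComponent hρ' hD' _)
    (pullsBack_component hS hρ hpos hD h hc _) _

theorem exists_carries_oriented (h : (jacobian S).scalarEval ρ D x ≠ 0) :
    ∃ (ρ' : Vec → ℝ) (D' : Vec → Inputs a b c), ContDiff ℝ ∞ ρ' ∧ (∀ y, 0 < ρ' y) ∧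
      SmoothInputs D' ∧ Carries (toMap (oriented S) ρ D) x ρ D ρ' D' :=
  exists_carries ((eventually_jacobian_ne_zero hS hρ hpos hD h).mono fun _ hy =>
    contDiffAt_toMap_oriented hS hρ hpos hD hy)
    (det_jac_toMap_oriented hS hρ hpos hD h) hρ hpos hD

theorem definedAt_observable (h : (jacobian S).scalarEval ρ D x ≠ 0) :
    (observable S Φ ℓ hℓ).DefinedAt ρ D x := by
  obtain ⟨ρ', D', hρ', hpos', hD', hc⟩ := exists_carries_oriented hS hρ hpos hD h
  have hq := fun q => (pullsBack_jetScalar hS hρ hpos hD h hρ' hD'.smooth hc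
    (k := Φ.order) q).self_of_nhds
  refine definedAt_funcOf.2 ⟨?_, ?_⟩
  · rintro (i | q)
    · exact definedAt_oriented hS h i
    · exact (hq q).1
  · exact (hpos' _).trans_eq (hq (⟨0, Fin.elim0⟩, .inl ())).2.symm

/-- By naturality, the observable is a function of the value of the operation in the coordinates
`oriented S`, that is, of the value pushed forward by them. -/
theorem eval_observable (hΦ : Φ.IsMaterial) (h : (jacobian S).scalarEval ρ D x ≠ 0) :
    (observable S Φ ℓ hℓ).scalarEval ρ D x =
      ℓ (κ.push (jac (toMap (oriented S) ρ D) x) (Φ.rest ρ D x)) := by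
  obtain ⟨ρ', D', hρ', hpos', hD', hc⟩ := exists_carries_oriented hS hρ hpos hD h
  have hn := hΦ.naturalAt ((eventually_jacobian_ne_zero hS hρ hpos hD h).mono fun _ hy =>
    contDiffAt_toMap_oriented hS hρ hpos hD hy) (det_jac_toMap_oriented hS hρ hpos hD h)
    ρ D ρ' D' hρ hpos hD hρ' hpos' hD' hc
  refine eval_funcOf.trans (congrArg ℓ ?_)
  rw [← hn, LocalOperator.rest, LocalOperator.apply, jet_eq_restJet _ hρ' hD'.smooth]
  have hq : (fun q => (jetScalar S Φ.order (.inr q)).scalarEval ρ D x) =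
      fun q => pdWord (List.ofFn q.1.2) (fieldComponent ρ' D' q.2) (toMap (oriented S) ρ D x) :=
    funext fun q => (pullsBack_jetScalar hS hρ hpos hD h hρ' hD'.smooth hc q).self_of_nhds.2
  rw [← hq]
  rfl

theorem definedAt_frame (h : (jacobian S).scalarEval ρ D x ≠ 0) (i : Fin 3) :
    (frame S i).DefinedAt ρ D x :=
  have ho := definedAt_oriented hS h
  ⟨definedAt_quotient.2 ⟨⟨fun i => i.elim0, trivial⟩, definedAt_jacobian.2 ho,
    eval_jacobian_oriented_ne_zero hS hρ hpos hD h⟩, definedAt_cross.2 ⟨ho _, ho _⟩⟩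

theorem pushVec_frame (h : (jacobian S).scalarEval ρ D x ≠ 0) (i : Fin 3) :
    pushVec (jac (toMap (oriented S) ρ D) x) ((frame S i).eval ρ D x) = Pi.single i 1 := by
  have hdet := (det_jac_toMap_oriented hS hρ hpos hD h).ne'
  have e : (frame S i).eval ρ D x =
      (1 / ((jac (toMap (oriented S) ρ D) x).det / ρ x)) • MaterialOps.gradSkew
        (MaterialOps.gradVol ρ ((oriented S (i + 2)).scalarEval ρ D)) ((oriented S (i + 1)).scalarEval ρ D) x := by
    rw [← eval_jacobian]
    refine congrArg₂ (fun (r : ℝ) (v : Vec) => r • v) eval_quotient rfl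
  rw [e, gradSkew_gradVol]
  have hρx := (hpos x).ne'
  have hJ : ∀ i j, pd j ((oriented S i).scalarEval ρ D) x = jac (toMap (oriented S) ρ D) x i j :=
    fun _ _ => rfl
  simp only [hJ]
  generalize jac (toMap (oriented S) ρ D) x = M at hdet ⊢
  have hd := M.det_fin_three
  generalize M.det = d at hdet hd ⊢
  funext l
  rw [pushVec_apply, Fin.sum_univ_three]
  simp only [Pi.smul_apply, smul_eq_mul]
  obtain rfl | rfl | rfl := fin_three_cases i <;> obtain rfl | rfl | rfl := fin_three_cases l <;>
  · simp
    field_simp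
    first | ring1 | (rw [hd]; ring1)

theorem definedAt_representation (h : (jacobian S).scalarEval ρ D x ≠ 0) :
    (representation S Φ).DefinedAt ρ D x := by
  have hf := definedAt_frame hS hρ hpos hD h
  match κ, Φ with
  | .scalar, Φ => rw [representation_scalar]; exact definedAt_observable hS hρ hpos hD h
  | .vec, Φ =>
    have ht := fun i => And.intro (definedAt_observable (Φ := Φ) (hℓ := contDiff_apply ℝ ℝ i)
      hS hρ hpos hD h) (hf i)
    exact ⟨⟨ht 0, ht 1⟩, ht 2⟩
  | .skew, Φ =>
    have ht := fun i j => And.intro (definedAt_observable (Φ := Φ)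
      (hℓ := contDiff_apply_apply ℝ ℝ i j) hS hρ hpos hD h) (And.intro (hf i) (hf j))
    exact ⟨⟨ht 0 1, ht 0 2⟩, ht 1 2⟩

omit hρ hpos hD in
theorem jacobian_ne_zero_of_definedAt_representation (h : (representation S Φ).DefinedAt ρ D x) :
    (jacobian S).scalarEval ρ D x ≠ 0 := by
  match κ, Φ with
  | .scalar, Φ =>
    rw [representation_scalar] at h
    exact jacobian_ne_zero_of_definedAt_observable hS h
  | .vec, Φ => exact jacobian_ne_zero_of_definedAt_observable hS h.2.1
  | .skew, Φ => exact jacobian_ne_zero_of_definedAt_observable hS h.2.1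

theorem eval_representation (hΦ : Φ.IsMaterial) (h : (jacobian S).scalarEval ρ D x ≠ 0) :
    (representation S Φ).eval ρ D x = Φ.rest ρ D x := by
  have hdet := det_jac_toMap_oriented hS hρ hpos hD h
  have hu : IsUnit (jac (toMap (oriented S) ρ D) x).det := hdet.ne'.isUnit
  have inj : ∀ v w : κ.Val, κ.push (jac (toMap (oriented S) ρ D) x) v =
      κ.push (jac (toMap (oriented S) ρ D) x) w → v = w := by
    intro v w hvw
    rw [← κ.push_one v, ← κ.push_one w, ← Matrix.nonsing_inv_mul _ hu, κ.push_mul, hvw, κ.push_mul]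
  have hf := pushVec_frame hS hρ hpos hD h
  refine inj _ _ ?_
  match κ, Φ with
  | .scalar, Φ =>
    exact eval_observable (ℓ := fun v : ℝ => v) (hℓ := contDiff_id) hS hρ hpos hD hΦ h
  | .vec, Φ =>
    have hv := fun i => eval_observable (ℓ := fun v : Vec => v i) (hℓ := contDiff_apply ℝ ℝ i)
      hS hρ hpos hD hΦ h
    generalize (Kind.vec.push (jac (toMap (oriented S) ρ D) x) (Φ.rest ρ D x)) = w at hv ⊢
    let e : Fin 3 → Vec := fun i => (frame S i).eval ρ D x
    let s : Fin 3 → ℝ := fun i =>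
      (observable S Φ (fun v : Vec => v i) (contDiff_apply ℝ ℝ i)).scalarEval ρ D x
    change pushVec _ (s 0 • e 0 + s 1 • e 1 + s 2 • e 2) = w
    rw [pushVec, Matrix.mulVec_add, Matrix.mulVec_add, Matrix.mulVec_smul, Matrix.mulVec_smul,
      Matrix.mulVec_smul]
    change s 0 • pushVec _ (e 0) + s 1 • pushVec _ (e 1) + s 2 • pushVec _ (e 2) = w
    rw [hf 0, hf 1, hf 2]
    funext i
    obtain rfl | rfl | rfl := fin_three_cases i <;> simp [s, hv]
  | .skew, Φ =>
    have hskew : IsSkew (pushSkew (jac (toMap (oriented S) ρ D) x) (Φ.rest ρ D x)) :=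
      pushSkew_isSkew _ (hΦ.symm_rest hρ hpos hD x)
    have hv := fun i j => eval_observable (ℓ := fun A : Ten => A i j)
      (hℓ := contDiff_apply_apply ℝ ℝ i j) hS hρ hpos hD hΦ h
    change ∀ i j, _ = pushSkew (jac (toMap (oriented S) ρ D) x) (Φ.rest ρ D x) i j at hv
    change _ = pushSkew (jac (toMap (oriented S) ρ D) x) (Φ.rest ρ D x)
    generalize pushSkew (jac (toMap (oriented S) ρ D) x) (Φ.rest ρ D x) = w at hv hskew ⊢
    let e : Fin 3 → Vec := fun i => (frame S i).eval ρ D x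
    let s : Fin 3 → Fin 3 → ℝ := fun i j =>
      (observable S Φ (fun A : Ten => A i j) (contDiff_apply_apply ℝ ℝ i j)).scalarEval ρ D x
    change pushSkew _ (s 0 1 • (fun k l => e 0 k * e 1 l - e 1 k * e 0 l) +
      s 0 2 • (fun k l => e 0 k * e 2 l - e 2 k * e 0 l) +
      s 1 2 • (fun k l => e 1 k * e 2 l - e 2 k * e 1 l)) = w
    rw [pushSkew_add, pushSkew_add, pushSkew_smul, pushSkew_smul, pushSkew_smul,
      pushSkew_wedge, pushSkew_wedge, pushSkew_wedge, hf 0, hf 1, hf 2]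
    have h0 : ∀ i, w i i = 0 := fun i => by linarith [hskew i i]
    have h10 := hskew 1 0
    have h20 := hskew 2 0
    have h21 := hskew 2 1
    funext i j
    obtain rfl | rfl | rfl := fin_three_cases i <;> obtain rfl | rfl | rfl := fin_three_cases j <;>
      simp [s, hv, h0, h10, h20, h21]

omit hρ hpos hD in
/-- A material operation is computed by its components in the coordinates `oriented S`: it is natural
under the change to these coordinates, and its components depend on the jets there only. -/
theorem eqWhereDefined_representation (hΦ : Φ.IsMaterial) :
    Φ.EqWhereDefined (representation S Φ) := by
  intro t u ρ D x hu hρ hpos hD h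
  rw [hΦ.apply_eq_rest t hu hρ hpos hD, eval_representation hS hρ hpos hD hΦ
    (jacobian_ne_zero_of_definedAt_representation hS h)]

end Composition

end

section

variable {a b c : ℕ} {κ : Kind}

/-! ### Polynomial dependence on the amplitude of a perturbation -/

/-- Families of smooth functions on space that depend polynomially on a real parameter. -/
inductive PolyFamily : (ℝ → Vec → ℝ) → Prop
  | const {g : Vec → ℝ} (hg : ContDiff ℝ ∞ g) : PolyFamily (fun _ => g)
  | add {F G : ℝ → Vec → ℝ} (hF : PolyFamily F) (hG : PolyFamily G) :
      PolyFamily (fun ε y => F ε y + G ε y)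
  | param_mul {F : ℝ → Vec → ℝ} (hF : PolyFamily F) : PolyFamily (fun ε y => ε * F ε y)

namespace PolyFamily

variable {F G : ℝ → Vec → ℝ}

theorem contDiff (hF : PolyFamily F) (ε : ℝ) : ContDiff ℝ ∞ (F ε) := by
  induction hF with
  | const hg => exact hg
  | add _ _ h1 h2 => exact h1.add h2
  | param_mul _ h => exact contDiff_const.mul h

theorem smooth_mul (hF : PolyFamily F) {g : Vec → ℝ} (hg : ContDiff ℝ ∞ g) :
    PolyFamily (fun ε y => g y * F ε y) := by
  induction hF with
  | const hg' => exact const (hg.mul hg')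
  | add _ _ h1 h2 => simpa only [mul_add] using h1.add h2
  | param_mul _ h => simpa only [mul_left_comm] using h.param_mul

theorem mul (hF : PolyFamily F) (hG : PolyFamily G) :
    PolyFamily (fun ε y => F ε y * G ε y) := by
  induction hF with
  | const hg => exact hG.smooth_mul hg
  | add _ _ h1 h2 => simpa only [add_mul] using h1.add h2
  | param_mul _ h => simpa only [mul_assoc] using h.param_mul

theorem neg (hF : PolyFamily F) : PolyFamily (fun ε y => -F ε y) := by
  simpa using hF.smooth_mul (contDiff_const (c := (-1 : ℝ)))

theorem sub (hF : PolyFamily F) (hG : PolyFamily G) :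
    PolyFamily (fun ε y => F ε y - G ε y) := by
  simpa only [sub_eq_add_neg] using hF.add hG.neg

theorem sum {ι : Type*} (s : Finset ι) {H : ι → ℝ → Vec → ℝ} (h : ∀ i ∈ s, PolyFamily (H i)) :
    PolyFamily (fun ε y => ∑ i ∈ s, H i ε y) := by
  classical
  induction s using Finset.induction_on with
  | empty => simpa using const (contDiff_const (c := (0 : ℝ)))
  | insert i s hi ih =>
    simp only [Finset.sum_insert hi]
    exact (h i (by simp)).add (ih fun j hj => h j (by simp [hj]))

theorem pd (hF : PolyFamily F) (i : Fin 3) : PolyFamily (fun ε => pd i (F ε)) := by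
  induction hF with
  | const hg => exact const (contDiff_pd hg i)
  | @add F G hF hG h1 h2 =>
    have e : ∀ ε y, MaterialOps.pd i (fun y => F ε y + G ε y) y =
        MaterialOps.pd i (F ε) y + MaterialOps.pd i (G ε) y := fun ε y =>
      pd_add ((hF.contDiff ε).differentiable (by simp) y)
        ((hG.contDiff ε).differentiable (by simp) y) i
    simpa only [← e] using h1.add h2
  | @param_mul F hF h =>
    have e : ∀ ε y, MaterialOps.pd i (fun y => ε * F ε y) y = ε * MaterialOps.pd i (F ε) y := by
      intro ε y
      rw [pd_mul (differentiableAt_const ε) ((hF.contDiff ε).differentiable (by simp) y), pd_const,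
        zero_mul, add_zero]
    simpa only [← e] using h.param_mul

theorem exists_polynomial (hF : PolyFamily F) (x : Vec) :
    ∃ p : Polynomial ℝ, ∀ ε, F ε x = p.eval ε := by
  induction hF with
  | @const g _ => exact ⟨.C (g x), fun ε => by simp⟩
  | add _ _ h1 h2 =>
    obtain ⟨⟨p, hp⟩, ⟨q, hq⟩⟩ := And.intro h1 h2
    exact ⟨p + q, fun ε => by simp [hp, hq]⟩
  | param_mul _ h =>
    obtain ⟨p, hp⟩ := h
    exact ⟨.X * p, fun ε => by simp [hp]⟩

theorem eventually_ne_zero (hF : PolyFamily F) {x : Vec} {ε₁ : ℝ} (h : F ε₁ x ≠ 0) :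
    ∀ᶠ ε in 𝓝[≠] (0 : ℝ), F ε x ≠ 0 := by
  obtain ⟨p, hp⟩ := hF.exists_polynomial x
  have hp0 : p ≠ 0 := fun h0 => h (by rw [hp, h0, Polynomial.eval_zero])
  have hfin : {ε | p.eval ε = 0}.Finite := by
    refine p.roots.toFinset.finite_toSet.subset fun ε hε => ?_
    simpa [hp0] using hε
  have hc : ∀ᶠ ε in 𝓝[≠] (0 : ℝ), ε ∈ ({ε | p.eval ε = 0} \ {0})ᶜ :=
    eventually_nhdsWithin_of_eventually_nhds
      ((hfin.subset sdiff_subset).isClosed.isOpen_compl.mem_nhds (by simp))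
  filter_upwards [hc, self_mem_nhdsWithin] with ε h1 h2 h3
  exact h1 ⟨by rw [mem_ofPred_eq, ← hp, h3], h2⟩

end PolyFamily

/-- Families of fields whose components depend polynomially on a real parameter. -/
def PolyField : (κ : Kind) → (ℝ → Vec → κ.Val) → Prop
  | .scalar, F => PolyFamily F
  | .vec, F => ∀ i, PolyFamily (fun ε y => F ε y i)
  | .skew, F => ∀ i j, PolyFamily (fun ε y => F ε y i j)

namespace Composition

/-- No functions of scalars occur in the composition. -/
def Polynomial : {κ : Kind} → Composition a b c κ → Prop
  | _, .inputScalar _ => True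
  | _, .inputVec _ => True
  | _, .inputSkew _ => True
  | _, .func _ _ _ _ _ => False
  | _, .gradVec K₀ K => K₀.Polynomial ∧ K.Polynomial
  | _, .gradSkew K₀ K => K₀.Polynomial ∧ K.Polynomial
  | _, .gradVol K => K.Polynomial
  | _, .mulVec K₀ K => K₀.Polynomial ∧ K.Polynomial
  | _, .mulSkew K₀ K => K₀.Polynomial ∧ K.Polynomial
  | _, .addVec K L => K.Polynomial ∧ L.Polynomial
  | _, .addSkew K L => K.Polynomial ∧ L.Polynomial
  | _, .wedgeVec K₀ K => K₀.Polynomial ∧ K.Polynomial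
  | _, .crossVec K₀ K => K₀.Polynomial ∧ K.Polynomial
  | _, .crossSkew K₀ K => K₀.Polynomial ∧ K.Polynomial
  | _, .divVec K => K.Polynomial
  | _, .divSkew K => K.Polynomial

theorem Polynomial.definedAt {T : Composition a b c κ} (hT : T.Polynomial) (ρ : Vec → ℝ)
    (D : Vec → Inputs a b c) (x : Vec) : T.DefinedAt ρ D x := by
  induction T with
  | inputScalar | inputVec | inputSkew => trivial
  | func => exact hT.elim
  | gradVol _ ih | divVec _ ih | divSkew _ ih => exact ih hT
  | gradVec _ _ h1 h2 | gradSkew _ _ h1 h2 | mulVec _ _ h1 h2 | mulSkew _ _ h1 h2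
  | addVec _ _ h1 h2 | addSkew _ _ h1 h2 | wedgeVec _ _ h1 h2 | crossVec _ _ h1 h2
  | crossSkew _ _ h1 h2 => exact ⟨h1 hT.1, h2 hT.2⟩

theorem Polynomial.polyField {T : Composition a b c κ} (hT : T.Polynomial) {ρ : Vec → ℝ}
    (hρ : ContDiff ℝ ∞ ρ) (hpos : ∀ y, 0 < ρ y) {D D' : Vec → Inputs a b c} (hD : ContDiff ℝ ∞ D)
    (hD' : ContDiff ℝ ∞ D') :
    PolyField κ (fun ε => T.eval ρ (fun y => D y + ε • D' y)) := by
  have hr : ContDiff ℝ ∞ (fun y => 1 / ρ y) := contDiff_const.div hρ fun y => (hpos y).ne'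
  induction T with
  | inputScalar i =>
    exact (PolyFamily.const (contDiff_pi.1 hD.fst i)).add
      (PolyFamily.const (contDiff_pi.1 hD'.fst i)).param_mul
  | inputVec i =>
    exact fun j => (PolyFamily.const (contDiff_pi.1 (contDiff_pi.1 hD.snd.fst i) j)).add
      (PolyFamily.const (contDiff_pi.1 (contDiff_pi.1 hD'.snd.fst i) j)).param_mul
  | inputSkew i =>
    exact fun j k => (PolyFamily.const (contDiff_pi.1 (contDiff_pi.1 (contDiff_pi.1
      hD.snd.snd i) j) k)).add (PolyFamily.const (contDiff_pi.1 (contDiff_pi.1 (contDiff_pi.1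
      hD'.snd.snd i) j) k)).param_mul
  | func => exact hT.elim
  | gradVec K₀ K h1 h2 =>
    exact PolyFamily.sum Finset.univ fun i _ => (h1 hT.1 i).mul (PolyFamily.pd (h2 hT.2) i)
  | gradSkew K₀ K h1 h2 =>
    exact fun i => PolyFamily.sum Finset.univ fun j _ => (h1 hT.1 i j).mul (PolyFamily.pd (h2 hT.2) j)
  | gradVol K ih =>
    exact fun i j => PolyFamily.sum Finset.univ fun k _ =>
      (PolyFamily.pd (ih hT) k).smooth_mul (hr.mul (contDiff_const (c := eps i j k)))
  | mulVec K₀ K h1 h2 => exact fun i => PolyFamily.mul (h1 hT.1) (h2 hT.2 i)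
  | mulSkew K₀ K h1 h2 => exact fun i j => PolyFamily.mul (h1 hT.1) (h2 hT.2 i j)
  | addVec K L h1 h2 => exact fun i => (h1 hT.1 i).add (h2 hT.2 i)
  | addSkew K L h1 h2 => exact fun i j => (h1 hT.1 i j).add (h2 hT.2 i j)
  | wedgeVec K₀ K h1 h2 =>
    exact fun i j => ((h1 hT.1 i).mul (h2 hT.2 j)).sub ((h2 hT.2 i).mul (h1 hT.1 j))
  | crossVec K₀ K h1 h2 =>
    exact (PolyFamily.sum Finset.univ fun i _ => PolyFamily.sum Finset.univ fun j _ => PolyFamily.sum Finset.univ fun k _ =>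
      ((h1 hT.1 i j).smooth_mul contDiff_const).mul (h2 hT.2 k)).smooth_mul hρ
  | crossSkew K₀ K h1 h2 =>
    exact fun i => (PolyFamily.sum Finset.univ fun j _ => PolyFamily.sum Finset.univ fun k _ =>
      PolyFamily.sum Finset.univ fun l _ =>
        ((h1 hT.1 i j).smooth_mul contDiff_const).mul (h2 hT.2 k l)).smooth_mul hρ
  | divVec K ih =>
    exact (PolyFamily.sum Finset.univ fun i _ => ((ih hT i).smooth_mul hρ).pd i).smooth_mul hr
  | divSkew K ih =>
    exact fun i => (PolyFamily.sum Finset.univ fun j _ => ((ih hT j i).smooth_mul hρ).pd j).smooth_mul hr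

/-- A representation in the coordinates `oriented S` is generically defined as soon as, for each
density and point, the Jacobian of `S` is nonzero for some inputs. -/
theorem genericallyDefined_representation {S : Fin 3 → Composition a b c .scalar}
    (hS : ∀ i, (S i).Polynomial)
    (hJ : ∀ (ρ : Vec → ℝ) (x : Vec), ContDiff ℝ ∞ ρ → (∀ y, 0 < ρ y) →
      ∃ D, SmoothInputs D ∧ (jac (toMap S ρ D) x).det ≠ 0)
    (Φ : LocalOperator a b c κ) : (representation S Φ).GenericallyDefined := by
  intro ρ D x hρ hpos hD
  obtain ⟨D₁, hD₁, h₁⟩ := hJ ρ x hρ hpos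
  -- The line through `D` in the direction `D₁ - D` passes through `D₁`.
  have hD' : SmoothInputs (fun y => D₁ y - D y) :=
    ⟨hD₁.smooth.sub hD.smooth, fun y i j k => by
      change (D₁ y).2.2 i j k - (D y).2.2 i j k = -((D₁ y).2.2 i k j - (D y).2.2 i k j)
      rw [hD₁.skew y i j k, hD.skew y i j k]
      ring⟩
  have hε : ∀ ε : ℝ, SmoothInputs (fun y => D y + ε • (D₁ y - D y)) := fun ε =>
    ⟨hD.smooth.add (hD'.smooth.const_smul ε), fun y i j k => by
      change (D y).2.2 i j k + ε * (D₁ y - D y).2.2 i j k =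
        -((D y).2.2 i k j + ε * (D₁ y - D y).2.2 i k j)
      rw [hD'.skew y i j k, hD.skew y i j k]
      ring⟩
  refine ⟨_, hD', ?_⟩
  have hp : (jacobian S).Polynomial := ⟨⟨hS 2, hS 1⟩, hS 0⟩
  have hpoly : PolyFamily (fun ε => (jacobian S).scalarEval ρ fun y => D y + ε • (D₁ y - D y)) :=
    hp.polyField hρ hpos hD.smooth hD'.smooth
  have h1 : (jacobian S).scalarEval ρ (fun y => D y + (1 : ℝ) • (D₁ y - D y)) x ≠ 0 := by
    have e : (fun y => D y + (1 : ℝ) • (D₁ y - D y)) = D₁ := by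
      funext y
      rw [one_smul, add_sub_cancel]
    rw [e, eval_jacobian]
    exact div_ne_zero h₁ (hpos x).ne'
  exact (hpoly.eventually_ne_zero h1).mono fun ε h =>
    definedAt_representation (fun i ρ D x => (hS i).definedAt ρ D x) hρ hpos (hε ε) h

end Composition

end

section

variable {a b c : ℕ} {κ : Kind}

/-! ### Nondegenerate inputs -/

theorem pd_coord_sub (i j : Fin 3) (p x : Vec) :
    pd i (fun y => y j - p j) x = if i = j then 1 else 0 := by
  have h : HasFDerivAt (fun y : Vec => y j - p j)
      (ContinuousLinearMap.proj j : Vec →L[ℝ] ℝ) x := (hasFDerivAt_apply j x).sub_const _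
  rw [pd, h.fderiv]
  simp [Pi.single_apply, eq_comm]

theorem pd_mul_of_eq_zero {f g : Vec → ℝ} {x : Vec} (hf : ContDiff ℝ ∞ f) (hg : ContDiff ℝ ∞ g)
    (h : g x = 0) (j : Fin 3) : pd j (fun y => f y * g y) x = f x * pd j g x := by
  rw [pd_mul (hf.differentiable (by simp) x) (hg.differentiable (by simp) x), h, mul_zero, add_zero]

/-- The polynomial `z + x y + x³ / 6` in coordinates centred at `p`. With each derivative in the
direction of `x`, another coordinate appears in the linear part: `y`, then `x`. -/
noncomputable def flagCubic (p y : Vec) : ℝ :=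
  (y 2 - p 2) + (y 0 - p 0) * (y 1 - p 1) + (y 0 - p 0) ^ 3 / 6

theorem contDiff_flagCubic (p : Vec) : ContDiff ℝ ∞ (flagCubic p) := by
  unfold flagCubic
  fun_prop

theorem pd_eq_of_hasFDerivAt {g : Vec → ℝ} {g' : Vec →L[ℝ] ℝ} {x : Vec} (h : HasFDerivAt g g' x)
    (i : Fin 3) : pd i g x = g' (Pi.single i 1) := by
  rw [pd, h.fderiv]

theorem hasFDerivAt_coord (p x : Vec) (j : Fin 3) :
    HasFDerivAt (fun y : Vec => y j - p j) (ContinuousLinearMap.proj j : Vec →L[ℝ] ℝ) x :=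
  (hasFDerivAt_apply j x).sub_const _

theorem pd_flagCubic (p x : Vec) : (fun i => pd i (flagCubic p) x) =
    ![(x 1 - p 1) + (x 0 - p 0) ^ 2 / 2, x 0 - p 0, 1] := by
  have h := ((hasFDerivAt_coord p x 2).add ((hasFDerivAt_coord p x 0).mul
    (hasFDerivAt_coord p x 1))).add (((hasFDerivAt_coord p x 0).pow 3).mul_const (1 / 6))
  have e : flagCubic p = fun y => (y 2 - p 2) + (y 0 - p 0) * (y 1 - p 1) +
    (y 0 - p 0) ^ 3 * (1 / 6) := by
    funext y; simp only [flagCubic]; ring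
  funext i
  rw [e]
  refine (pd_eq_of_hasFDerivAt h i).trans ?_
  obtain rfl | rfl | rfl := fin_three_cases i
  · simp; ring
  · simp
  · simp

/-- Three scalars obtained from `r · flagCubic p` by repeated differentiation in the direction of
the first axis are independent at `p`. -/
theorem det_jac_flag_ne_zero {r q : Vec → ℝ} (hr : ContDiff ℝ ∞ r) (hq : ContDiff ℝ ∞ q) {p : Vec}
    (hrp : r p ≠ 0) (hqp : q p ≠ 0) {ψ : Vec → Vec} (h0 : ∀ y, ψ y 0 = r y * flagCubic p y)
    (h1 : ∀ y, ψ y 1 = q y * pd 0 (fun z => ψ z 0) y)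
    (h2 : ∀ y, ψ y 2 = q y * pd 0 (fun z => ψ z 1) y) : (jac ψ p).det ≠ 0 := by
  have sg := contDiff_flagCubic p
  have e0 : (fun y => ψ y 0) = fun y => r y * flagCubic p y := funext h0
  have hg : flagCubic p p = 0 := by simp [flagCubic]
  have hp : ∀ i, pd i (flagCubic p) p = ![0, 0, 1] i := fun i => by
    rw [congrFun (pd_flagCubic p p) i]; simp
  -- The first derivatives of `flagCubic`, and their derivatives.
  set g0 : Vec → ℝ := fun y => (y 1 - p 1) + (y 0 - p 0) ^ 2 / 2 with hg0
  have sg0 : ContDiff ℝ ∞ g0 := by fun_prop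
  set g00 : Vec → ℝ := fun y => y 0 - p 0 with hg00
  have sg00 : ContDiff ℝ ∞ g00 := by fun_prop
  have eg0 : pd 0 (flagCubic p) = g0 := funext fun y => congrFun (pd_flagCubic p y) 0
  have dg0 : ∀ i x, pd i g0 x = ![x 0 - p 0, 1, 0] i := by
    intro i x
    have h := (hasFDerivAt_coord p x 1).add (((hasFDerivAt_coord p x 0).pow 2).mul_const (1 / 2))
    have e : g0 = fun y => (y 1 - p 1) + (y 0 - p 0) ^ 2 * (1 / 2) := by
      funext y; simp only [hg0]; ring
    rw [e]
    refine (pd_eq_of_hasFDerivAt h i).trans ?_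
    obtain rfl | rfl | rfl := fin_three_cases i <;> simp
  have eg00 : pd 0 g0 = g00 := funext fun y => dg0 0 y
  have dg00 : pd 0 g00 p = 1 := by rw [hg00, pd_coord_sub]; simp
  have g0p : g0 p = 0 := by simp [hg0]
  have g00p : g00 p = 0 := by simp [hg00]
  have dd := fun {f : Vec → ℝ} (h : ContDiff ℝ ∞ f) (y : Vec) => h.differentiable (by simp) y
  have sr0 := contDiff_pd hr 0
  have sr00 := contDiff_pd sr0 0
  have sq0 := contDiff_pd hq 0
  -- The derivatives of the first scalar.
  set A : Vec → ℝ := fun y => r y * g0 y + pd 0 r y * flagCubic p y with hA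
  have sA : ContDiff ℝ ∞ A := (hr.mul sg0).add (sr0.mul sg)
  have eA : pd 0 (fun y => ψ y 0) = A := by
    funext y
    rw [e0, pd_mul (dd hr y) (dd sg y), eg0]
  have Ap : A p = 0 := by simp [hA, hg, g0p]
  have e1 : (fun y => ψ y 1) = fun y => q y * A y := funext fun y => by rw [h1, eA]
  set A' : Vec → ℝ := fun y => (r y * g00 y + pd 0 r y * g0 y) +
    (pd 0 r y * g0 y + pd 0 (pd 0 r) y * flagCubic p y) with hA'
  have sA' : ContDiff ℝ ∞ A' :=
    ((hr.mul sg00).add (sr0.mul sg0)).add ((sr0.mul sg0).add (sr00.mul sg))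
  have eA' : pd 0 A = A' := by
    funext y
    rw [hA, pd_add (dd (hr.mul sg0) y) (dd (sr0.mul sg) y), pd_mul (dd hr y) (dd sg0 y),
      pd_mul (dd sr0 y) (dd sg y), eg0, eg00]
  have A'p : A' p = 0 := by simp [hA', hg, g0p, g00p]
  -- The derivative of the second scalar.
  set B : Vec → ℝ := fun y => q y * A' y + pd 0 q y * A y with hB
  have sB : ContDiff ℝ ∞ B := (hq.mul sA').add (sq0.mul sA)
  have eB : pd 0 (fun y => ψ y 1) = B := by
    funext y
    rw [e1, pd_mul (dd hq y) (dd sA y), eA']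
  have Bp : B p = 0 := by simp [hB, Ap, A'p]
  have e2 : (fun y => ψ y 2) = fun y => q y * B y := funext fun y => by rw [h2, eB]
  have d0 : ∀ j, pd j (fun y => ψ y 0) p = r p * ![0, 0, 1] j := fun j => by
    rw [e0, pd_mul_of_eq_zero hr sg hg, hp]
  have d1 : ∀ j, pd j (fun y => ψ y 1) p = q p * (r p * pd j g0 p + pd 0 r p * ![0, 0, 1] j) := by
    intro j
    rw [e1, pd_mul_of_eq_zero hq sA Ap, hA, pd_add (dd (hr.mul sg0) p) (dd (sr0.mul sg) p),
      pd_mul_of_eq_zero hr sg0 g0p, pd_mul_of_eq_zero sr0 sg hg, hp]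
  have dA' : pd 0 A' p = r p := by
    rw [hA', pd_add (dd ((hr.mul sg00).add (sr0.mul sg0)) p) (dd ((sr0.mul sg0).add (sr00.mul sg)) p),
      pd_add (dd (hr.mul sg00) p) (dd (sr0.mul sg0) p),
      pd_add (dd (sr0.mul sg0) p) (dd (sr00.mul sg) p),
      pd_mul_of_eq_zero hr sg00 g00p, pd_mul_of_eq_zero sr0 sg0 g0p, pd_mul_of_eq_zero sr00 sg hg,
      dg00, dg0, hp]
    simp
  have d2 : pd 0 (fun y => ψ y 2) p = q p * (q p * r p) := by
    rw [e2, pd_mul_of_eq_zero hq sB Bp, hB, pd_add (dd (hq.mul sA') p) (dd (sq0.mul sA) p),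
      pd_mul_of_eq_zero hq sA' A'p, pd_mul_of_eq_zero sq0 sA Ap, dA', eA', A'p, mul_zero, add_zero]
  rw [Matrix.det_fin_three]
  simp only [jac_apply, d0, d1, d2, dg0]
  simp [hrp, hqp]

namespace Composition

/-- The three scalars `s`, `v · ∇s`, `v · ∇(v · ∇s)`. -/
def iteratedGrad (v : Composition a b c .vec) (s : Composition a b c .scalar) :
    Fin 3 → Composition a b c .scalar :=
  ![s, .gradVec v s, .gradVec v (.gradVec v s)]

theorem polynomial_iteratedGrad {v : Composition a b c .vec} {s : Composition a b c .scalar}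
    (hv : v.Polynomial) (hs : s.Polynomial) (i : Fin 3) : (iteratedGrad v s i).Polynomial := by
  obtain rfl | rfl | rfl := fin_three_cases i
  · exact hs
  · exact ⟨hv, hs⟩
  · exact ⟨hv, hv, hs⟩

theorem det_jac_iteratedGrad_ne_zero {v : Composition a b c .vec} {s : Composition a b c .scalar}
    {ρ : Vec → ℝ} {D : Vec → Inputs a b c} {r q : Vec → ℝ} (hr : ContDiff ℝ ∞ r)
    (hq : ContDiff ℝ ∞ q) {p : Vec} (hrp : r p ≠ 0) (hqp : q p ≠ 0)
    (hv : ∀ y, v.eval ρ D y = (![q y, 0, 0] : Vec))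
    (hs : ∀ y, s.scalarEval ρ D y = r y * flagCubic p y) :
    (jac (toMap (iteratedGrad v s) ρ D) p).det ≠ 0 := by
  have hg : ∀ (F : Vec → ℝ) (y : Vec), MaterialOps.gradVec (v.eval ρ D) F y = q y * pd 0 F y := by
    intro F y
    have e : (v.eval ρ D : Vec → Vec) = fun y => ![q y, 0, 0] := funext hv
    rw [e]
    simp [MaterialOps.gradVec, Fin.sum_univ_three]
  exact det_jac_flag_ne_zero hr hq hrp hqp hs (fun y => hg _ y) (fun y => hg _ y)

/-- Scalars generated by a vector field `v`: its densitized divergence and the derivatives of the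
latter in the direction of `v`. -/
def vecScalars (i : Fin b) : Fin 3 → Composition a b c .scalar :=
  iteratedGrad (.inputVec i) (.divVec (.inputVec i))

/-- Scalars generated by a skew-tensor `K`: with `v` the densitized divergence of `K`, the
densitized product of `K` and `v`, and its derivatives in the direction of `v`. -/
def skewScalars (i : Fin c) : Fin 3 → Composition a b c .scalar :=
  iteratedGrad (.divSkew (.inputSkew i)) (.crossVec (.inputSkew i) (.divSkew (.inputSkew i)))

theorem exists_det_jac_inputScalar_ne_zero (h : 3 ≤ a) (ρ : Vec → ℝ) (x : Vec) :
    ∃ D : Vec → Inputs a b c, SmoothInputs D ∧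
      (jac (toMap (fun i => .inputScalar (Fin.castLE h i)) ρ D) x).det ≠ 0 := by
  refine ⟨fun y => (fun i => if hi : (i : ℕ) < 3 then y ⟨i, hi⟩ else 0, 0, 0), ⟨?_, ?_⟩, ?_⟩
  · refine ContDiff.prodMk (contDiff_pi.2 fun i => ?_) contDiff_const
    by_cases hi : (i : ℕ) < 3
    · simpa only [hi, dite_true] using contDiff_apply ℝ ℝ _
    · simpa only [hi, dite_false] using contDiff_const
  · intro y i j k
    exact neg_zero.symm
  · have e : toMap (fun i => .inputScalar (Fin.castLE h i)) ρ (fun y => ((fun i =>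
        if hi : (i : ℕ) < 3 then y ⟨i, hi⟩ else 0, 0, 0) : Inputs a b c)) = fun y => y := by
      funext y i
      change (if hi : (i : ℕ) < 3 then y ⟨i, hi⟩ else 0) = y i
      simp
    rw [e, jac_id]
    simp

theorem exists_det_jac_vecScalars_ne_zero (i : Fin b) {ρ : Vec → ℝ} (x : Vec)
    (hρ : ContDiff ℝ ∞ ρ) (hpos : ∀ y, 0 < ρ y) :
    ∃ D : Vec → Inputs a b c, SmoothInputs D ∧ (jac (toMap (vecScalars i) ρ D) x).det ≠ 0 := by
  have hr : ContDiff ℝ ∞ (fun y => 1 / ρ y) := contDiff_const.div hρ fun y => (hpos y).ne'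
  -- The derivative of `h` along the first axis is `flagCubic x`.
  set h : Vec → ℝ := fun y => 1 + (y 0 - x 0) * (y 2 - x 2) + (y 0 - x 0) ^ 2 * (1 / 2) * (y 1 - x 1)
    + (y 0 - x 0) ^ 4 * (1 / 24) with hh
  have sh : ContDiff ℝ ∞ h := by fun_prop
  have dh : ∀ y, pd 0 h y = flagCubic x y := by
    intro y
    have hd := ((((hasFDerivAt_const (1 : ℝ) y).add ((hasFDerivAt_coord x y 0).mul
      (hasFDerivAt_coord x y 2))).add ((((hasFDerivAt_coord x y 0).pow 2).mul_const (1 / 2)).mul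
      (hasFDerivAt_coord x y 1))).add (((hasFDerivAt_coord x y 0).pow 4).mul_const (1 / 24)))
    refine (pd_eq_of_hasFDerivAt hd 0).trans ?_
    simp [flagCubic]
    ring
  have sq : ContDiff ℝ ∞ (fun y => 1 / ρ y * h y) := hr.mul sh
  refine ⟨fun y => (0, fun _ => ![1 / ρ y * h y, 0, 0], 0), ⟨?_, ?_⟩, ?_⟩
  · refine contDiff_const.prodMk (ContDiff.prodMk (contDiff_pi.2 fun _ => contDiff_pi.2 fun j => ?_)
      contDiff_const)
    obtain rfl | rfl | rfl := fin_three_cases j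
    · exact sq
    · exact contDiff_const
    · exact contDiff_const
  · intro y i j k
    exact neg_zero.symm
  · refine det_jac_iteratedGrad_ne_zero (p := x) hr sq (one_div_ne_zero (hpos x).ne') ?_
      (fun y => rfl) fun y => ?_
    · simp [hh, (hpos x).ne']
    · change MaterialOps.divVec ρ (fun y => ![1 / ρ y * h y, 0, 0]) y = _
      have e : (fun y => ρ y * (1 / ρ y * h y)) = h := by
        funext y
        rw [← mul_assoc, mul_one_div_cancel (hpos y).ne', one_mul]
      simp only [MaterialOps.divVec, Fin.sum_univ_three, Matrix.cons_val, e, dh, mul_zero, pd_const,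
        add_zero]

theorem exists_det_jac_skewScalars_ne_zero (i : Fin c) {ρ : Vec → ℝ} (x : Vec)
    (hρ : ContDiff ℝ ∞ ρ) (hpos : ∀ y, 0 < ρ y) :
    ∃ D : Vec → Inputs a b c, SmoothInputs D ∧ (jac (toMap (skewScalars i) ρ D) x).det ≠ 0 := by
  have hr : ContDiff ℝ ∞ (fun y => 1 / ρ y) := contDiff_const.div hρ fun y => (hpos y).ne'
  -- The tensor is dual to the form `ω` with curl `(1, 0, 0)` and first component `flagCubic x`.
  set ω1 : Vec → ℝ := fun y => (y 0 - x 0) ^ 2 * (1 / 2) with hω1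
  set ω2 : Vec → ℝ := fun y => (y 0 - x 0) + (y 1 - x 1) with hω2
  have s0 := contDiff_flagCubic x
  have s1 : ContDiff ℝ ∞ ω1 := by fun_prop
  have s2 : ContDiff ℝ ∞ ω2 := by fun_prop
  have d0 : ∀ y i, pd i (flagCubic x) y = ![(y 1 - x 1) + (y 0 - x 0) ^ 2 / 2, y 0 - x 0, 1] i :=
    fun y i => congrFun (pd_flagCubic x y) i
  have d1 : ∀ y i, pd i ω1 y = ![y 0 - x 0, 0, 0] i := by
    intro y i
    refine (pd_eq_of_hasFDerivAt (((hasFDerivAt_coord x y 0).pow 2).mul_const (1 / 2)) i).trans ?_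
    obtain rfl | rfl | rfl := fin_three_cases i <;> simp
  have d2 : ∀ y i, pd i ω2 y = ![1, 1, 0] i := by
    intro y i
    refine (pd_eq_of_hasFDerivAt ((hasFDerivAt_coord x y 0).add (hasFDerivAt_coord x y 1)) i).trans ?_
    obtain rfl | rfl | rfl := fin_three_cases i <;> simp
  set W : Vec → Ten := fun y => ![![0, ω2 y, -ω1 y], ![-ω2 y, 0, flagCubic x y],
    ![ω1 y, -flagCubic x y, 0]] with hW
  have sW : ∀ j k, ContDiff ℝ ∞ (fun y => W y j k) := by
    intro j k
    obtain rfl | rfl | rfl := fin_three_cases j <;> obtain rfl | rfl | rfl := fin_three_cases k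
    exacts [contDiff_const, s2, s1.neg, s2.neg, contDiff_const, s0, s1, s0.neg, contDiff_const]
  have hWs : ∀ y, IsSkew (W y) := by
    intro y j k
    obtain rfl | rfl | rfl := fin_three_cases j <;> obtain rfl | rfl | rfl := fin_three_cases k <;>
      simp [hW]
  set K : Vec → Ten := fun y j k => 1 / ρ y * W y j k with hK
  have eK : ∀ j k, (fun y => ρ y * K y j k) = fun y => W y j k := by
    intro j k
    funext y
    rw [hK, ← mul_assoc, mul_one_div_cancel (hpos y).ne', one_mul]
  have hv : ∀ y, MaterialOps.divSkew ρ K y = ![-1 * (1 / ρ y), 0, 0] := by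
    intro y
    have n1 : pd 0 (fun y => -ω1 y) y = -pd 0 ω1 y := pd_neg 0
    have n2 : pd 1 (fun y => -ω2 y) y = -pd 1 ω2 y := pd_neg 1
    have n3 : pd 2 (fun y => -flagCubic x y) y = -pd 2 (flagCubic x) y := pd_neg 2
    funext j
    simp only [MaterialOps.divSkew, eK]
    obtain rfl | rfl | rfl := fin_three_cases j <;>
    · simp only [hW, Fin.sum_univ_three, Matrix.cons_val, pd_const]
      simp [n1, n2, n3, d0, d1, d2]
  refine ⟨fun y => (0, 0, fun _ => K y), ⟨?_, ?_⟩, ?_⟩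
  · exact contDiff_const.prodMk (contDiff_const.prodMk (contDiff_pi.2 fun _ => contDiff_pi.2 fun j =>
      contDiff_pi.2 fun k => hr.mul (sW j k)))
  · intro y i j k
    change 1 / ρ y * W y j k = -(1 / ρ y * W y k j)
    rw [hWs y j k]
    ring
  · refine det_jac_iteratedGrad_ne_zero (p := x) (r := fun y => -2 * (1 / ρ y))
      (q := fun y => -1 * (1 / ρ y)) (contDiff_const.mul hr) (contDiff_const.mul hr) ?_ ?_
      hv fun y => ?_
    · simp [(hpos x).ne']
    · simp [(hpos x).ne']
    · change MaterialOps.crossVec ρ K (MaterialOps.divSkew ρ K) y = _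
      have hy := (hpos y).ne'
      rw [crossVec_apply, hv]
      simp [hK, hW]
      field_simp
      ring

/-- Material operations on inputs that are not just one or two scalars are generated. -/
theorem exists_composition_of_nondegenerate (h : 0 < c ∨ 0 < b ∨ 3 ≤ a)
    {Φ : LocalOperator a b c κ} (hΦ : Φ.IsMaterial) :
    ∃ T : Composition a b c κ, T.GenericallyDefined ∧ Φ.EqWhereDefined T := by
  have key : ∀ S : Fin 3 → Composition a b c .scalar, (∀ i, (S i).Polynomial) →
      (∀ (ρ : Vec → ℝ) (x : Vec), ContDiff ℝ ∞ ρ → (∀ y, 0 < ρ y) →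
        ∃ D, SmoothInputs D ∧ (jac (toMap S ρ D) x).det ≠ 0) →
      ∃ T : Composition a b c κ, T.GenericallyDefined ∧ Φ.EqWhereDefined T := fun S hS hJ =>
    ⟨representation S Φ, genericallyDefined_representation hS hJ Φ,
      eqWhereDefined_representation (fun i ρ D x => (hS i).definedAt ρ D x) hΦ⟩
  rcases h with h | h | h
  · exact key (skewScalars ⟨0, h⟩) (polynomial_iteratedGrad trivial ⟨trivial, trivial⟩)
      fun _ x hρ hpos => exists_det_jac_skewScalars_ne_zero _ x hρ hpos
  · exact key (vecScalars ⟨0, h⟩) (polynomial_iteratedGrad trivial trivial)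
      fun _ x hρ hpos => exists_det_jac_vecScalars_ne_zero _ x hρ hpos
  · exact key (fun i => .inputScalar (Fin.castLE h i)) (fun _ => trivial)
      fun ρ x _ _ => exists_det_jac_inputScalar_ne_zero h ρ x

theorem exists_scalar_composition_of_three_le (h : 3 ≤ a) {Φ : LocalOperator a b c .scalar}
    (hΦ : Φ.IsMaterial) : ∃ T : Composition a b c .scalar,
      T.OnlyScalarOps ∧ T.GenericallyDefined ∧ Φ.EqWhereDefined T :=
  let S : Fin 3 → Composition a b c .scalar := fun i => .inputScalar (Fin.castLE h i)
  ⟨representation S Φ, onlyScalarOps_representation (S := S) (fun _ => trivial) Φ,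
    genericallyDefined_representation (S := S) (fun _ => trivial)
      (fun ρ x _ _ => exists_det_jac_inputScalar_ne_zero h ρ x) Φ,
    eqWhereDefined_representation (S := S) (fun _ _ _ _ => trivial) hΦ⟩

end Composition

end

section

/-! ### Coordinates adapted to one or two scalars -/

/-- Integrals of smooth functions over the unit interval depend smoothly on parameters. -/
theorem contDiff_intervalIntegral {H E : Type} [NormedAddCommGroup H] [NormedSpace ℝ H]
    [ProperSpace H] [NormedAddCommGroup E] [NormedSpace ℝ E] {f : H × ℝ → E}
    (hf : ContDiff ℝ ∞ f) : ContDiff ℝ ∞ (fun x => ∫ s in (0 : ℝ)..1, f (x, s)) := by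
  refine contDiff_infty.2 fun n => ?_
  induction n generalizing E with
  | zero =>
    refine contDiff_zero.2 ?_
    exact intervalIntegral.continuous_parametric_intervalIntegral_of_continuous'
      (f := fun x s => f (x, s)) hf.continuous 0 1
  | succ n ih =>
    set f' : H × ℝ → H →L[ℝ] E := fun q =>
      (fderiv ℝ f q).comp (ContinuousLinearMap.inl ℝ H ℝ) with hf'
    have sf' : ContDiff ℝ ∞ f' := (hf.fderiv_right (m := ∞) (by simp)).clm_comp contDiff_const
    have key : ∀ x, HasFDerivAt (fun x => ∫ s in (0 : ℝ)..1, f (x, s))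
        (∫ s in (0 : ℝ)..1, f' (x, s)) x := by
      intro x
      obtain ⟨C, hC⟩ := ((isCompact_closedBall x 1).prod isCompact_Icc).exists_bound_of_continuousOn
        (f := f') (s := Metric.closedBall x 1 ×ˢ Icc (0 : ℝ) 1) sf'.continuous.continuousOn
      have cx : ∀ y, Continuous fun s : ℝ => f (y, s) := fun y => hf.continuous.comp (by fun_prop)
      have cx' : ∀ y, Continuous fun s : ℝ => f' (y, s) := fun y =>
        sf'.continuous.comp (by fun_prop)
      refine intervalIntegral.hasFDerivAt_integral_of_dominated_of_fderiv_le
        (F := fun y s => f (y, s)) (F' := fun y s => f' (y, s)) (bound := fun _ => C)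
        (Metric.closedBall_mem_nhds x one_pos)
        (Eventually.of_forall fun y => (cx y).aestronglyMeasurable)
        ((cx x).intervalIntegrable 0 1) (cx' x).aestronglyMeasurable
        (Eventually.of_forall fun s hs y hy => hC _ ⟨hy, ?_⟩) (by simp)
        (Eventually.of_forall fun s _ y _ => ?_)
      · rw [uIoc_of_le zero_le_one] at hs
        exact Ioc_subset_Icc_self hs
      · have h1 : HasFDerivAt f (fderiv ℝ f (y, s)) (y, s) :=
          (hf.differentiable (by simp) _).hasFDerivAt
        exact h1.comp y ((hasFDerivAt_id y).prodMk (hasFDerivAt_const s y))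
    rw [Nat.cast_succ, contDiff_succ_iff_fderiv]
    refine ⟨fun x => (key x).differentiableAt, by simp, ?_⟩
    have e : (fderiv ℝ fun x => ∫ s in (0 : ℝ)..1, f (x, s)) =
        fun x => ∫ s in (0 : ℝ)..1, f' (x, s) := funext fun x => (key x).fderiv
    rw [e]
    exact ih sf'

/-- Smooth functions have smooth primitives in the direction of the last axis. -/
theorem exists_primitive {g : Vec → ℝ} (hg : ContDiff ℝ ∞ g) :
    ∃ θ : Vec → ℝ, ContDiff ℝ ∞ θ ∧ ∀ z, pd 2 θ z = g z := by
  have sU : ContDiff ℝ ∞ (fun q : Vec × ℝ => (Function.update q.1 2 (q.2 * q.1 2) : Vec)) := by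
    refine contDiff_pi.2 fun i => ?_
    obtain rfl | rfl | rfl := fin_three_cases i <;> simp <;> fun_prop
  -- The integral from `0` to `z 2`, rescaled to a fixed interval.
  set θ : Vec → ℝ := fun z => z 2 * ∫ s in (0 : ℝ)..1, g (Function.update z 2 (s * z 2)) with hθ
  have sθ : ContDiff ℝ ∞ θ := (contDiff_apply ℝ ℝ 2).mul (contDiff_intervalIntegral (hg.comp sU))
  refine ⟨θ, sθ, fun z => ?_⟩
  have cg : Continuous fun t : ℝ => g (Function.update z 2 t) :=
    hg.continuous.comp (continuous_const.update 2 continuous_id)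
  have e : (fun t : ℝ => θ (Function.update z 2 t)) =
      fun t => ∫ s in (0 : ℝ)..t, g (Function.update z 2 s) := by
    funext t
    have h := intervalIntegral.smul_integral_comp_mul_right
      (f := fun s => g (Function.update z 2 s)) (a := 0) (b := 1) t
    simp only [zero_mul, one_mul] at h
    rw [← h]
    simp [hθ]
  have h1 : HasDerivAt (fun t : ℝ => θ (Function.update z 2 t)) (g z) (z 2) := by
    rw [e]
    have := intervalIntegral.integral_hasDerivAt_right (cg.intervalIntegrable 0 (z 2))
      (cg.stronglyMeasurableAtFilter _ _) cg.continuousAt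
    simpa using this
  have h2 : HasDerivAt (fun t : ℝ => Function.update z 2 t) (Pi.single 2 1) (z 2) :=
    hasDerivAt_update z 2 (z 2)
  have h3 : HasFDerivAt θ (fderiv ℝ θ z) (Function.update z 2 (z 2)) := by
    rw [Function.update_eq_self]
    exact (sθ.differentiable (by simp) z).hasFDerivAt
  exact (h3.comp_hasDerivAt (z 2) h2).unique h1

/-- Two independent scalars are the first two coordinates of a system in which the density is one. -/
theorem exists_unimodular_coordinates {K : Fin 2 → Vec → ℝ} (hK : ∀ i, ContDiff ℝ ∞ (K i))
    {ρ : Vec → ℝ} (hρ : ContDiff ℝ ∞ ρ) (hpos : ∀ y, 0 < ρ y) {x : Vec}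
    (hx : pd 0 (K 0) x * pd 1 (K 1) x - pd 1 (K 0) x * pd 0 (K 1) x ≠ 0) :
    ∃ θ : Vec → ℝ, ContDiff ℝ ∞ θ ∧
      ∀ᶠ y in 𝓝 x, (jac (fun z => ![K 0 z, K 1 z, θ z]) y).det = ρ y := by
  obtain ⟨s, hs⟩ : ∃ s : ℝ,
      0 < (pd 0 (K 0) x * pd 1 (K 1) x - pd 1 (K 0) x * pd 0 (K 1) x) * s := by
    rcases lt_or_gt_of_ne hx with h | h
    · exact ⟨-1, by linarith⟩
    · exact ⟨1, by linarith⟩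
  have smooth3 : ∀ {f : Vec → ℝ}, ContDiff ℝ ∞ f →
      ContDiff ℝ ∞ (fun z => (![K 0 z, K 1 z, f z] : Vec)) := by
    intro f hf
    refine contDiff_pi.2 fun i => ?_
    obtain rfl | rfl | rfl := fin_three_cases i
    exacts [hK 0, hK 1, hf]
  have sl : ContDiff ℝ ∞ (fun y : Vec => s * y 2) := by fun_prop
  set φ : Vec → Vec := fun z => ![K 0 z, K 1 z, s * z 2] with hφ
  have sφ : ContDiff ℝ ∞ φ := smooth3 sl
  have dl : ∀ j, pd j (fun y : Vec => s * y 2) x = s * if j = 2 then 1 else 0 := by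
    intro j
    have := pd_coord_sub j 2 0 x
    simp only [Pi.zero_apply, sub_zero] at this
    rw [pd_mul (differentiableAt_const s) (differentiableAt_apply 2 x), pd_const, this]
    ring
  have hdet : 0 < (jac φ x).det := by
    have e : (jac φ x).det =
        (pd 0 (K 0) x * pd 1 (K 1) x - pd 1 (K 0) x * pd 0 (K 1) x) * s := by
      rw [Matrix.det_fin_three]
      simp [jac_apply, hφ, dl]
      ring
    rwa [e]
  -- In the coordinates `φ`, whose last one is linear, a primitive of the density in the direction of
  -- the last axis makes the density one.
  obtain ⟨ρ', _, sρ', -, -, hc⟩ := exists_carries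
    (Eventually.of_forall fun y => sφ.contDiffAt) hdet hρ hpos
    (D := fun _ => (0 : Inputs 0 0 0)) ⟨contDiff_const, fun _ i => i.elim0⟩
  obtain ⟨θ, sθ, dθ⟩ := exists_primitive sρ'
  refine ⟨fun z => θ (φ z), sθ.comp sφ, ?_⟩
  filter_upwards [hc] with y hy
  rw [hy.1, ← dθ]
  have h2 : ∀ j, pd j (fun z => θ (φ z)) y = ∑ i, pd i θ (φ y) * jac φ y i j := fun j =>
    pd_comp (sθ.differentiable (by simp) _) (sφ.differentiable (by simp) _) j
  rw [Matrix.det_fin_three, Matrix.det_fin_three]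
  simp only [jac_apply, Matrix.cons_val] at h2 ⊢
  simp only [h2, Fin.sum_univ_three]
  simp only [hφ, Matrix.cons_val]
  ring

end

section

variable {a : ℕ} {κ : Kind}

/-! ### Material operations on one or two scalars -/

/-- The first `a` coordinates, as scalar inputs. -/
def coordInputs (h : a ≤ 3) (y : Vec) : Inputs a 0 0 :=
  (fun i => y (Fin.castLE h i), Fin.elim0, Fin.elim0)

theorem smoothInputs_coordInputs (h : a ≤ 3) : SmoothInputs (coordInputs h) :=
  ⟨(contDiff_pi.2 fun _ => contDiff_apply ℝ ℝ _).prodMk contDiff_const, fun _ i => i.elim0⟩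

/-- The value of a material operation on scalars, when the density is one and the scalars are
Cartesian coordinates. -/
noncomputable def LocalOperator.standardValue (Φ : LocalOperator a 0 0 κ) (h : a ≤ 3) :
    Vec → κ.Val := Φ.rest (fun _ => 1) (coordInputs h)

variable {Φ : LocalOperator a 0 0 κ} (hΦ : Φ.IsMaterial)

include hΦ

theorem LocalOperator.IsMaterial.contDiff_standardValue (h : a ≤ 3) :
    ContDiff ℝ ∞ (Φ.standardValue h) :=
  hΦ.contDiff_rest contDiff_const (fun _ => one_pos) (smoothInputs_coordInputs h)

/-- In coordinates that start with the scalar inputs and in which the density is one, a material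
operation takes its standard value. -/
theorem LocalOperator.IsMaterial.push_rest_eq_standardValue (h : a ≤ 3) {ρ : Vec → ℝ}
    (hρ : ContDiff ℝ ∞ ρ) (hpos : ∀ y, 0 < ρ y) {D : Vec → Inputs a 0 0} (hD : SmoothInputs D)
    {ψ : Vec → Vec} (hψ : ContDiff ℝ ∞ ψ) {x : Vec} (hψρ : ∀ᶠ y in 𝓝 x, (jac ψ y).det = ρ y)
    (hψD : ∀ y i, ψ y (Fin.castLE h i) = (D y).1 i) :
    κ.push (jac ψ x) (Φ.rest ρ D x) = Φ.standardValue h (ψ x) := by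
  refine (hΦ.naturalAt (Eventually.of_forall fun y => hψ.contDiffAt)
    (by rw [hψρ.self_of_nhds]; exact hpos x) ρ D _ _ hρ hpos hD contDiff_const (fun _ => one_pos)
    (smoothInputs_coordInputs h) ?_).symm
  filter_upwards [hψρ] with y hy
  refine ⟨by rw [hy, one_mul], ?_⟩
  refine Prod.ext (funext fun i => hψD y i) (Prod.ext (Subsingleton.elim _ _) (Subsingleton.elim _ _))

/-- Translations along the last axis and shears in its direction preserve the standard density and
the first two coordinates. -/
theorem LocalOperator.IsMaterial.push_standardValue (h : a ≤ 2) (r s : ℝ) (c : ℝ) (y : Vec) :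
    κ.push (!![1, 0, 0; 0, 1, 0; r, s, 1] : Matrix (Fin 3) (Fin 3) ℝ)
      (Φ.standardValue (h.trans (by norm_num)) y) =
    Φ.standardValue (h.trans (by norm_num)) ![y 0, y 1, r * y 0 + s * y 1 + y 2 + c] := by
  set ψ : Vec → Vec := fun y => ![y 0, y 1, r * y 0 + s * y 1 + y 2 + c] with hψ
  have sψ : ContDiff ℝ ∞ ψ := by
    refine contDiff_pi.2 fun i => ?_
    obtain rfl | rfl | rfl := fin_three_cases i <;> simp [hψ] <;> fun_prop
  have hj : ∀ y, jac ψ y = !![1, 0, 0; 0, 1, 0; r, s, 1] := by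
    intro y
    have d := fun i => (hasFDerivAt_apply (𝕜 := ℝ) (F' := fun _ : Fin 3 => ℝ) i y)
    ext i j
    rw [jac_apply]
    obtain rfl | rfl | rfl := fin_three_cases i
    · refine (pd_eq_of_hasFDerivAt (d 0) j).trans ?_
      obtain rfl | rfl | rfl := fin_three_cases j <;> simp
    · refine (pd_eq_of_hasFDerivAt (d 1) j).trans ?_
      obtain rfl | rfl | rfl := fin_three_cases j <;> simp
    · refine (pd_eq_of_hasFDerivAt (((((d 0).const_mul r).add ((d 1).const_mul s)).add
        (d 2)).add_const c) j).trans ?_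
      obtain rfl | rfl | rfl := fin_three_cases j <;> simp
  rw [← hj y]
  refine hΦ.push_rest_eq_standardValue _ contDiff_const (fun _ => one_pos)
    (smoothInputs_coordInputs _) sψ (Eventually.of_forall fun y => ?_) fun y i => ?_
  · rw [hj, Matrix.det_fin_three]
    simp
  · have hi : Fin.castLE (h.trans (by norm_num) : a ≤ 3) i = 0 ∨
        Fin.castLE (h.trans (by norm_num) : a ≤ 3) i = 1 := by
      have := i.2
      rcases (show (i : ℕ) = 0 ∨ (i : ℕ) = 1 by omega) with h0 | h0
      · exact Or.inl (Fin.ext h0)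
      · exact Or.inr (Fin.ext h0)
    change _ = y _
    rcases hi with hi | hi <;> rw [hi] <;> rfl

/-- The standard value is a function of the first two coordinates. -/
theorem LocalOperator.IsMaterial.standardValue_eq (h : a ≤ 2) (y : Vec) :
    Φ.standardValue (h.trans (by norm_num)) y =
      Φ.standardValue (h.trans (by norm_num)) ![y 0, y 1, 0] := by
  have e := hΦ.push_standardValue h 0 0 (-y 2) y
  have h1 : (!![1, 0, 0; 0, 1, 0; 0, 0, 1] : Matrix (Fin 3) (Fin 3) ℝ) = 1 := by
    ext i j
    obtain rfl | rfl | rfl := fin_three_cases i <;> obtain rfl | rfl | rfl := fin_three_cases j <;>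
      simp
  rw [h1, Kind.push_one] at e
  simpa using e

theorem LocalOperator.IsMaterial.push_shear_standardValue (h : a ≤ 2) (r s : ℝ) (y : Vec) :
    κ.push (!![1, 0, 0; 0, 1, 0; r, s, 1] : Matrix (Fin 3) (Fin 3) ℝ)
      (Φ.standardValue (h.trans (by norm_num)) y) = Φ.standardValue (h.trans (by norm_num)) y := by
  rw [hΦ.push_standardValue h r s 0, hΦ.standardValue_eq h, hΦ.standardValue_eq h y]
  rfl

omit hΦ

/-- A vector fixed by the shears in the direction of the last axis is parallel to this axis. -/
theorem LocalOperator.IsMaterial.standardValue_vec (h : a ≤ 2) {Φ : LocalOperator a 0 0 .vec}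
    (hΦ : Φ.IsMaterial) (y : Vec) (V : Vec)
    (hV : Φ.standardValue (h.trans (by norm_num)) y = V) : V 0 = 0 ∧ V 1 = 0 := by
  have h0 := hΦ.push_shear_standardValue h 1 0 y
  have h1 := hΦ.push_shear_standardValue h 0 1 y
  rw [hV] at h0 h1
  have e0 := (pushVec_apply _ V 2).symm.trans (congrFun h0 2)
  have e1 := (pushVec_apply _ V 2).symm.trans (congrFun h1 2)
  simp [Fin.sum_univ_three] at e0 e1
  exact ⟨e0, e1⟩

/-- A skew-tensor fixed by the shears in the direction of the last axis is an exterior product with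
this axis. -/
theorem LocalOperator.IsMaterial.standardValue_skew (h : a ≤ 2) {Φ : LocalOperator a 0 0 .skew}
    (hΦ : Φ.IsMaterial) (y : Vec) (V : Ten)
    (hV : Φ.standardValue (h.trans (by norm_num)) y = V) : IsSkew V ∧ V 0 1 = 0 := by
  have hs : IsSkew V := hV ▸ hΦ.symm_rest contDiff_const (fun _ => one_pos)
    (smoothInputs_coordInputs _) y
  have h1 := hΦ.push_shear_standardValue h 0 1 y
  rw [hV] at h1
  have e1 : pushSkew _ V 0 2 = V 0 2 := congrFun (congrFun h1 0) 2
  simp [pushSkew, Fin.sum_univ_three] at e1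
  exact ⟨hs, e1⟩

end

section

variable {a b c : ℕ} {κ : Kind}

/-- The quantity with standard value `V` that two scalars generate: a scalar, a multiple of
`(1/ρ) ∇K₀ × ∇K₁`, or a combination of the densitized duals of `∇K₀` and `∇K₁`. -/
noncomputable def fromStandard : (κ : Kind) → κ.Val → (Vec → ℝ) → (Fin 2 → Vec → ℝ) → Vec → κ.Val
  | .scalar, V, _, _, _ => V
  | .vec, V, ρ, K, x => (show Vec from V) 2 • gradSkew (gradVol ρ (K 1)) (K 0) x
  | .skew, V, ρ, K, x =>
    (show Ten from V) 1 2 • gradVol ρ (K 0) x + (-(show Ten from V) 0 2) • gradVol ρ (K 1) x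

/-- The standard value determines the value of a material operation wherever the two scalars are
independent. -/
theorem LocalOperator.IsMaterial.rest_eq_fromStandard (h : a ≤ 2) {Φ : LocalOperator a 0 0 κ}
    (hΦ : Φ.IsMaterial) {ρ : Vec → ℝ} (hρ : ContDiff ℝ ∞ ρ) (hpos : ∀ y, 0 < ρ y)
    {D : Vec → Inputs a 0 0} (hD : SmoothInputs D) {K : Fin 2 → Vec → ℝ}
    (hK : ∀ i, ContDiff ℝ ∞ (K i)) (hKD : ∀ y i, K (Fin.castLE h i) y = (D y).1 i) {x : Vec}
    (hx : pd 0 (K 0) x * pd 1 (K 1) x - pd 1 (K 0) x * pd 0 (K 1) x ≠ 0) :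
    Φ.rest ρ D x = fromStandard κ
      (Φ.standardValue (h.trans (by norm_num)) ![K 0 x, K 1 x, 0]) ρ K x := by
  obtain ⟨θ, sθ, hθ⟩ := exists_unimodular_coordinates hK hρ hpos hx
  set ψ : Vec → Vec := fun z => ![K 0 z, K 1 z, θ z] with hψ
  have sψ : ContDiff ℝ ∞ ψ := by
    refine contDiff_pi.2 fun i => ?_
    obtain rfl | rfl | rfl := fin_three_cases i
    exacts [hK 0, hK 1, sθ]
  have key := hΦ.push_rest_eq_standardValue (h.trans (by norm_num)) hρ hpos hD sψ hθ (x := x) (by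
    intro y i
    rw [← hKD y i]
    have := i.2
    rcases (show (i : ℕ) = 0 ∨ (i : ℕ) = 1 by omega) with h0 | h0
    · rw [show Fin.castLE (h.trans (by norm_num) : a ≤ 3) i = 0 from Fin.ext h0,
        show Fin.castLE h i = 0 from Fin.ext h0]
      rfl
    · rw [show Fin.castLE (h.trans (by norm_num) : a ≤ 3) i = 1 from Fin.ext h0,
        show Fin.castLE h i = 1 from Fin.ext h0]
      rfl)
  rw [hΦ.standardValue_eq h] at key
  change _ = Φ.standardValue _ ![K 0 x, K 1 x, 0] at key
  have hdet : (jac ψ x).det = ρ x := hθ.self_of_nhds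
  have hu : IsUnit (jac ψ x).det := by rw [hdet]; exact (hpos x).ne'.isUnit
  have inj : ∀ v w : κ.Val, κ.push (jac ψ x) v = κ.push (jac ψ x) w → v = w := by
    intro v w hvw
    rw [← κ.push_one v, ← κ.push_one w, ← Matrix.nonsing_inv_mul _ hu, κ.push_mul, hvw, κ.push_mul]
  have hJ0 : ∀ j, pd j (K 0) x = jac ψ x 0 j := fun _ => rfl
  have hJ1 : ∀ j, pd j (K 1) x = jac ψ x 1 j := fun _ => rfl
  have hρx := (hpos x).ne'
  refine inj _ _ (key.trans ?_)
  match κ, Φ with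
  | .scalar, Φ => rfl
  | .vec, Φ =>
    generalize hV : Φ.standardValue (h.trans (by norm_num)) ![K 0 x, K 1 x, 0] = V
    obtain ⟨h0, h1⟩ := hΦ.standardValue_vec h _ V hV
    change V = pushVec _ ((show Vec from V) 2 • gradSkew (gradVol ρ (K 1)) (K 0) x)
    rw [gradSkew_gradVol]
    simp only [hJ0, hJ1]
    generalize jac ψ x = M at hdet
    rw [Matrix.det_fin_three] at hdet
    funext i
    rw [pushVec_apply, Fin.sum_univ_three]
    obtain rfl | rfl | rfl := fin_three_cases i
    · rw [h0]; simp; field_simp; ring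
    · rw [h1]; simp; field_simp; ring
    · simp; field_simp; rw [← hdet]; ring
  | .skew, Φ =>
    generalize hV : Φ.standardValue (h.trans (by norm_num)) ![K 0 x, K 1 x, 0] = V
    obtain ⟨hs, h01⟩ := hΦ.standardValue_skew h _ V hV
    have h00 : ∀ i, (show Ten from V) i i = 0 := fun i => by
      have := hs i i
      change (show Ten from V) i i = -(show Ten from V) i i at this
      linarith
    have h10 := hs 1 0
    have h20 := hs 2 0
    have h21 := hs 2 1
    change V = pushSkew _ ((show Ten from V) 1 2 • gradVol ρ (K 0) x +
      (-(show Ten from V) 0 2) • gradVol ρ (K 1) x)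
    rw [gradVol_apply, gradVol_apply]
    simp only [hJ0, hJ1]
    generalize jac ψ x = M at hdet
    rw [Matrix.det_fin_three] at hdet
    change Ten at V
    funext i j
    simp only [pushSkew, Fin.sum_univ_three]
    obtain rfl | rfl | rfl := fin_three_cases i <;> obtain rfl | rfl | rfl := fin_three_cases j <;>
    · simp [h00, h01, h10, h20, h21]
      try field_simp
      try first | ring1 | (rw [← hdet]; ring1)

/-- The value of a local operator depends continuously on the amplitude of a perturbation. -/
theorem LocalOperator.continuous_rest_add_smul (Φ : LocalOperator a b c κ) {ρ : Vec → ℝ}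
    (hρ : ContDiff ℝ ∞ ρ) (hpos : ∀ y, 0 < ρ y) {D D' : Vec → Inputs a b c}
    (hD : ContDiff ℝ ∞ D) (hD' : ContDiff ℝ ∞ D') (x : Vec) :
    Continuous fun ε : ℝ => Φ.rest ρ (fun y => D y + ε • D' y) x := by
  have hjet : Continuous fun ε : ℝ => jet Φ.order 0 ρ (fun y => D y + ε • D' y) x := by
    refine continuous_pi fun n => ?_
    set A : Vec → Config a b c := fun y => ((0 : Vec → Vec) y, ρ y, D y) with hA
    set B : Vec → Config a b c := fun y => (0, 0, D' y) with hB
    have sA : ContDiff ℝ n A := (contDiff_const.prodMk (hρ.prodMk hD)).of_le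
      (by exact_mod_cast le_top)
    have sB : ContDiff ℝ n B := (contDiff_const.prodMk (contDiff_const.prodMk hD')).of_le
      (by exact_mod_cast le_top)
    have e : ∀ ε : ℝ, jet Φ.order 0 ρ (fun y => D y + ε • D' y) x n =
        iteratedFDeriv ℝ (n : ℕ) A x + ε • iteratedFDeriv ℝ (n : ℕ) B x := by
      intro ε
      have e1 : (fun y => (((0 : Vec → Vec) y, ρ y, D y + ε • D' y) : Config a b c)) =
          A + ε • B := by
        funext y
        simp [hA, hB]
      have sεB : ContDiff ℝ n (ε • B) := sB.const_smul ε
      rw [jet, e1, iteratedFDeriv_add_apply sA.contDiffAt sεB.contDiffAt,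
        iteratedFDeriv_const_smul_apply sB.contDiffAt]
    simp only [e]
    fun_prop
  have hc : Continuous fun ε : ℝ => ((0 : ℝ), x, jet Φ.order 0 ρ (fun y => D y + ε • D' y) x) :=
    continuous_const.prodMk (continuous_const.prodMk hjet)
  exact Φ.smooth.continuousOn.comp_continuous hc fun ε => hpos x

namespace Composition

/-- The first two scalar inputs, where missing ones are replaced by zero. -/
noncomputable def twoInputs (i : Fin 2) : Composition a b c .scalar :=
  if h : (i : ℕ) < a then .inputScalar ⟨i, h⟩ else const 0

/-- A function of the standard value of a material operation on at most two scalars. -/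
noncomputable def standardCoeff (h : a ≤ 2) {Φ : LocalOperator a 0 0 κ} (hΦ : Φ.IsMaterial)
    (ℓ : κ.Val → ℝ) (hℓ : ContDiff ℝ ∞ ℓ) : Composition a 0 0 .scalar :=
  .func (fun z : Fin 2 → ℝ => ℓ (Φ.standardValue (h.trans (by norm_num)) ![z 0, z 1, 0]))
    univ isOpen_univ
    ((hℓ.comp ((hΦ.contDiff_standardValue (h.trans (by norm_num))).comp (contDiff_pi.2 fun i => by
      obtain rfl | rfl | rfl := fin_three_cases i <;> simp <;> fun_prop))).contDiffOn)
    twoInputs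

/-- The composition that computes a material operation on at most two scalars. -/
noncomputable def standardForm (h : a ≤ 2) :
    {κ : Kind} → {Φ : LocalOperator a 0 0 κ} → Φ.IsMaterial → Composition a 0 0 κ
  | .scalar, _, hΦ => standardCoeff h hΦ (fun v : ℝ => v) contDiff_id
  | .vec, _, hΦ => .mulVec (standardCoeff h hΦ (fun v : Vec => v 2) (contDiff_apply ℝ ℝ 2))
      (cross (twoInputs 0) (twoInputs 1))
  | .skew, _, hΦ => .addSkew
      (.mulSkew (standardCoeff h hΦ (fun A : Ten => A 1 2) (contDiff_apply_apply ℝ ℝ 1 2))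
        (.gradVol (twoInputs 0)))
      (.mulSkew (standardCoeff h hΦ (fun A : Ten => -A 0 2) (contDiff_apply_apply ℝ ℝ 0 2).neg)
        (.gradVol (twoInputs 1)))

theorem definedAt_twoInputs (ρ : Vec → ℝ) (D : Vec → Inputs a b c) (x : Vec) (i : Fin 2) :
    (twoInputs i : Composition a b c .scalar).DefinedAt ρ D x := by
  unfold twoInputs
  split
  · trivial
  · exact ⟨fun i => i.elim0, trivial⟩

theorem onlyScalarOps_twoInputs (i : Fin 2) :
    (twoInputs i : Composition a b c .scalar).OnlyScalarOps := by
  unfold twoInputs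
  split
  · trivial
  · exact fun i => i.elim0

theorem scalarEval_twoInputs_castLE (h : a ≤ 2) (ρ : Vec → ℝ) (D : Vec → Inputs a b c) (x : Vec)
    (i : Fin a) : (twoInputs (Fin.castLE h i) : Composition a b c .scalar).scalarEval ρ D x =
      (D x).1 i := by
  have : ((Fin.castLE h i : Fin 2) : ℕ) < a := i.2
  rw [twoInputs, dif_pos this]
  rfl

variable (h : a ≤ 2) {Φ : LocalOperator a 0 0 κ} (hΦ : Φ.IsMaterial)

theorem definedAt_standardCoeff (ℓ : κ.Val → ℝ) (hℓ : ContDiff ℝ ∞ ℓ) (ρ : Vec → ℝ)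
    (D : Vec → Inputs a 0 0) (x : Vec) : (standardCoeff h hΦ ℓ hℓ).DefinedAt ρ D x :=
  ⟨definedAt_twoInputs ρ D x, trivial⟩

theorem definedAt_standardForm (ρ : Vec → ℝ) (D : Vec → Inputs a 0 0) (x : Vec) :
    (standardForm h hΦ).DefinedAt ρ D x := by
  have hi := definedAt_twoInputs ρ D x
  have hc := fun ℓ hℓ => definedAt_standardCoeff h hΦ ℓ hℓ ρ D x
  match κ, Φ, hΦ with
  | .scalar, Φ, hΦ =>
    change (standardCoeff h hΦ (fun v : ℝ => v) contDiff_id).DefinedAt ρ D x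
    exact hc _ _
  | .vec, Φ, hΦ => exact ⟨hc _ _, hi 1, hi 0⟩
  | .skew, Φ, hΦ => exact ⟨⟨hc _ _, hi 0⟩, hc _ _, hi 1⟩

theorem eval_standardForm (ρ : Vec → ℝ) (D : Vec → Inputs a 0 0) (x : Vec) :
    (standardForm h hΦ).eval ρ D x = fromStandard κ (Φ.standardValue (h.trans (by norm_num))
      ![(twoInputs 0).scalarEval ρ D x, (twoInputs 1).scalarEval ρ D x, 0]) ρ
      (fun i => (twoInputs i).scalarEval ρ D) x := by
  match κ, Φ, hΦ with
  | .scalar, Φ, hΦ => rfl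
  | .vec, Φ, hΦ => rfl
  | .skew, Φ, hΦ => rfl

theorem onlyScalarOps_standardForm {Φ : LocalOperator a 0 0 .scalar} (hΦ : Φ.IsMaterial) :
    (standardForm h hΦ).OnlyScalarOps := by
  change (standardCoeff h hΦ (fun v : ℝ => v) contDiff_id).OnlyScalarOps
  exact onlyScalarOps_twoInputs

theorem genericallyDefined_standardForm : (standardForm h hΦ).GenericallyDefined := by
  intro ρ D x _ _ _
  exact ⟨fun _ => 0, ⟨contDiff_const, fun _ i => i.elim0⟩,
    Eventually.of_forall fun ε => definedAt_standardForm h hΦ _ _ _⟩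

/-- At points where the scalars are dependent, the identity follows by perturbation and
continuity. -/
theorem eqWhereDefined_standardForm : Φ.EqWhereDefined (standardForm h hΦ) := by
  intro t u ρ D x hu hρ hpos hD _
  rw [hΦ.apply_eq_rest t hu hρ hpos hD, eval_standardForm]
  have h3 : a ≤ 3 := h.trans (by norm_num)
  set K : Fin 2 → Vec → ℝ := fun i => (twoInputs i).scalarEval ρ D with hK
  have sK : ∀ i, ContDiff ℝ ∞ (K i) := fun i => contDiff_iff_contDiffAt.2 fun y =>
    (DefinedAt.eventually_and_contDiffAt hρ hpos hD _ (definedAt_twoInputs ρ D y i)).2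
  set ι : Fin 2 → Fin 3 := Fin.castLE (by norm_num) with hι
  set L : ℝ → Fin 2 → Vec → ℝ := fun ε i y => K i y + ε * y (ι i) with hL
  have sx : ∀ (ε : ℝ) (i : Fin 3), ContDiff ℝ ∞ fun y : Vec => ε * y i := fun ε i => by fun_prop
  have sL : ∀ ε i, ContDiff ℝ ∞ (L ε i) := fun ε i => (sK i).add (sx ε (ι i))
  have dL : ∀ ε i j, pd j (L ε i) x = pd j (K i) x + ε * if j = ι i then 1 else 0 := by
    intro ε i j
    have e := pd_coord_sub j (ι i) 0 x
    simp only [Pi.zero_apply, sub_zero] at e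
    rw [← e, hL, pd_add ((sK i).differentiable (by simp) x) ((sx ε _).differentiable (by simp) x),
      pd_mul (differentiableAt_const ε) (differentiableAt_apply (ι i) x), pd_const, zero_mul,
      add_zero]
  have hDε : ∀ ε : ℝ, SmoothInputs (fun y => D y + ε • coordInputs h3 y) := fun ε =>
    ⟨hD.smooth.add ((smoothInputs_coordInputs h3).smooth.const_smul ε), fun _ i => i.elim0⟩
  -- The perturbed scalars are independent, for small nonzero amplitudes.
  have hm : ∀ᶠ ε in 𝓝[≠] (0 : ℝ),
      pd 0 (L ε 0) x * pd 1 (L ε 1) x - pd 1 (L ε 0) x * pd 0 (L ε 1) x ≠ 0 := by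
    set A := pd 0 (K 0) x
    set B := pd 1 (K 1) x
    set C := pd 1 (K 0) x * pd 0 (K 1) x
    have e : ∀ ε, pd 0 (L ε 0) x * pd 1 (L ε 1) x - pd 1 (L ε 0) x * pd 0 (L ε 1) x =
        (A + ε * 1) * (B + ε * 1) - C := by
      intro ε
      have h0 : ι 0 = 0 := rfl
      have h1 : ι 1 = 1 := rfl
      rw [dL, dL, dL, dL, h0, h1]
      simp [A, B, C]
    have pc : ∀ r : ℝ, PolyFamily fun _ _ => r := fun r => .const contDiff_const
    have hp : PolyFamily fun ε _ => (A + ε * 1) * (B + ε * 1) - C :=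
      (((pc A).add (pc 1).param_mul).mul ((pc B).add (pc 1).param_mul)).sub (pc C)
    simp only [e]
    -- The quadratic polynomial in `ε` has leading coefficient one.
    by_contra hcon
    have hz : ∀ ε : ℝ, (A + ε * 1) * (B + ε * 1) - C = 0 := fun ε => by
      by_contra hε
      exact hcon (hp.eventually_ne_zero (x := x) hε)
    linarith [hz 0, hz 1, hz (-1)]
  have hV := (hΦ.contDiff_standardValue h3).continuous
  have hcV : Continuous fun ε : ℝ => Φ.standardValue h3 ![L ε 0 x, L ε 1 x, 0] := by
    refine hV.comp (continuous_pi fun i => ?_)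
    obtain rfl | rfl | rfl := fin_three_cases i <;> simp [hL] <;> fun_prop
  have hcd : ∀ i j, Continuous fun ε => pd j (L ε i) x := fun i j => by
    simp only [dL]
    fun_prop
  have hcont : Continuous fun ε => fromStandard κ
      (Φ.standardValue h3 ![L ε 0 x, L ε 1 x, 0]) ρ (L ε) x := by
    have hvol : ∀ i j k, Continuous fun ε => MaterialOps.gradVol ρ (L ε i) x j k := fun i j k =>
      continuous_finsetSum _ fun l _ => continuous_const.mul (hcd i l)
    match κ, Φ with
    | .scalar, Φ => exact hcV
    | .vec, Φ =>
      exact continuous_pi fun i => ((continuous_apply 2).comp hcV).mul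
        (continuous_finsetSum _ fun j _ => (hvol 1 i j).mul (hcd 0 j))
    | .skew, Φ =>
      exact continuous_pi fun i => continuous_pi fun j =>
        (((continuous_apply_apply 1 2).comp hcV).mul (hvol 0 i j)).add
        ((((continuous_apply_apply 0 2).comp hcV).neg).mul (hvol 1 i j))
  have hrest := Φ.continuous_rest_add_smul hρ hpos hD.smooth (smoothInputs_coordInputs h3).smooth x
  have heq : (fun ε : ℝ => Φ.rest ρ (fun y => D y + ε • coordInputs h3 y) x) =ᶠ[𝓝[≠] 0]
      fun ε => fromStandard κ (Φ.standardValue h3 ![L ε 0 x, L ε 1 x, 0]) ρ (L ε) x := by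
    filter_upwards [hm] with ε hε
    refine hΦ.rest_eq_fromStandard h hρ hpos (hDε ε) (sL ε) (fun y i => ?_) hε
    simp only [hL, hK, scalarEval_twoInputs_castLE]
    rfl
  have key := tendsto_nhds_unique_of_eventuallyEq
    (hrest.continuousAt.tendsto.mono_left nhdsWithin_le_nhds)
    (hcont.continuousAt.tendsto.mono_left nhdsWithin_le_nhds) heq
  have e0 : L 0 = K := by
    funext i y
    simp [hL]
  rw [e0] at key
  simpa using key

include h hΦ in
theorem exists_composition_of_le_two : ∃ T : Composition a 0 0 κ,
    T.GenericallyDefined ∧ Φ.EqWhereDefined T :=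
  ⟨standardForm h hΦ, genericallyDefined_standardForm h hΦ, eqWhereDefined_standardForm h hΦ⟩

end Composition

end

end MaterialOps

theorem theorem3p1 :
    (∀ (Ω : Set (ℝ × MaterialOps.Vec)) (u : ℝ → MaterialOps.Vec → MaterialOps.Vec)
        (ρ : ℝ → MaterialOps.Vec → ℝ),
      IsOpen Ω → MaterialOps.IsFlowOn Ω u ρ → MaterialOps.GeneratorsMaterialOn Ω u ρ) ∧
    (∀ (a b c : ℕ) (κ : MaterialOps.Kind) (Φ : MaterialOps.LocalOperator a b c κ),
      Φ.IsMaterial →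
        ∃ T : MaterialOps.Composition a b c κ, T.GenericallyDefined ∧ Φ.EqWhereDefined T) ∧
    (∀ (a : ℕ) (Φ : MaterialOps.LocalOperator a 0 0 .scalar),
      Φ.IsMaterial →
        ∃ T : MaterialOps.Composition a 0 0 .scalar,
          T.OnlyScalarOps ∧ T.GenericallyDefined ∧ Φ.EqWhereDefined T) := by
  refine ⟨fun Ω u ρ hΩ hf => MaterialOps.generatorsMaterialOn hΩ hf, fun a b c κ Φ hΦ => ?_,
    fun a Φ hΦ => ?_⟩
  · by_cases h : 0 < c ∨ 0 < b ∨ 3 ≤ a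
    · exact MaterialOps.Composition.exists_composition_of_nondegenerate h hΦ
    · push Not at h
      obtain ⟨hc, hb, ha⟩ := h
      obtain rfl : c = 0 := by omega
      obtain rfl : b = 0 := by omega
      exact MaterialOps.Composition.exists_composition_of_le_two (by omega) hΦ
  · by_cases h : 3 ≤ a
    · exact MaterialOps.Composition.exists_scalar_composition_of_three_le h hΦ
    · have h2 : a ≤ 2 := by omega
      exact ⟨_, MaterialOps.Composition.onlyScalarOps_standardForm h2 hΦ,
        MaterialOps.Composition.genericallyDefined_standardForm h2 hΦ,
        MaterialOps.Composition.eqWhereDefined_standardForm h2 hΦ⟩
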